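/- **Notation.** Fix $1<\alpha\le\beta\le2$, $\nu,\mu>0$, $r>0$, $c_1,c_2>0$. For a function $g$ on $\mathbb R^n$ put $$\|g\|_{\dot C^\beta}=\max_{|\gamma|=\lfloor\beta\rfloor}\sup_{x\ne x'}\frac{|\partial^\gamma g(x)-\partial^\gamma g(x')|}{|x-x'|^{\beta-\lfloor\beta\rfloor}},\qquad \|g\|_{C^\beta}=\max_{|\gamma|\le\lfloor\beta\rfloor}\sup|\partial^\gamma g|+\|g\|_{\dot C^\beta},$$ and call $g$ of class $C^\beta$ if it is $\lfloor\beta\rfloor$ times continuously differentiable and the relevant (semi)norm is finite. *Cartoon-like images.* Let $STAR^\alpha(\nu,r)$ be the set of all $B\subset[0,1]^3$ of the form $B=\{x_0+tu:\ |u|=1,\ 0\le t\le\rho(u)\}$, where $r\le\rho\le\rho_0$ on the unit sphere for some $\rho_0<1$, and where, in every system of spherical coordinates (that is, for every choice of orthonormal axes), $\rho$ is, as a function of the angles $(\theta_1,\theta_2)\in\mathbb R^2$, of class $C^\alpha$ with $\|\rho\|_{\dot C^\alpha}\le\nu$. Let $f=f_0+\chi_Bf_1$ with $B\in STAR^\alpha(\nu,r)$,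 $f_0,f_1:\mathbb R^3\to\mathbb C$ of class $C^\beta$, $\|f_i\|_{C^\beta}\le\mu$, $\operatorname{supp}f_0\subset[0,1]^3$. *Shearlets.* Let $\psi\in L^2(\mathbb R^3)$ be compactly supported, and suppose that there are constants $K$, $\delta>8$, $\gamma\ge4$ and a function $h\in L^1(\mathbb R)$ such that, with $\hat\psi(\xi)=\int\psi(x)e^{-2\pi i\langle\xi,x\rangle}dx$, 1. $|\hat\psi(\xi)|\le K\min\{1,|\xi_1|^\delta\}\min\{1,|\xi_1|^{-\gamma}\}\min\{1,|\xi_2|^{-\gamma}\}\min\{1,|\xi_3|^{-\gamma}\}$ for all $\xi$ (where $\min\{1,|0|^{-\gamma}\}=1$); 2. $|\partial_{\xi_i}\hat\psi(\xi)|\le|h(\xi_1)|\,(1+|\xi_2|/|\xi_1|)^{-\gamma}(1+|\xi_3|/|\xi_1|)^{-\gamma}$ for $i=2,3$ and all $\xi$ with $\xi_1\ne0$. For $j\in\mathbb N_0$, $k\in\mathbb Z^2$ with $|k_1|,|k_2|\le\lceil2^{j(\alpha-1)/2}\rceil$ and $m\in\operatorname{diag}(c_1,c_2,c_2)\mathbb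 Z^3$ let $\psi_\lambda=\psi_{j,k,m}=2^{j(\alpha+2)/4}\psi(S_kA_{2^j}\cdot-m)$, where $$A_{2^j}=\operatorname{diag}(2^{j\alpha/2},2^{j/2},2^{j/2}),\qquad S_k=\begin{pmatrix}1&k_1&k_2\\0&1&0\\0&0&1\end{pmatrix}.$$ For $p\in\mathbb Z^3$ let $\mathcal Q_{j,p}=[-2^{-j/2},2^{-j/2}]^3+2^{-j/2}\,2p$. **Theorem.** There is a constant $C>0$, depending only on $\alpha,\beta,\nu,\mu,r,c_1,c_2$ and $\psi$, such that the following holds for all such $B$ and $f$, all $j\ge0$ and $p\in\mathbb Z^3$, all such $\lambda=(j,k,m)$, and every $\hat x\in\operatorname{int}(\mathcal Q_{j,p})\cap\operatorname{int}(\operatorname{supp}\psi_\lambda)\cap\partial B$. Let $H$ be the tangent plane to $\partial B$ at $\hat x$. (i) If $H$ has normal vector $(-1,s_1,s_2)$ with $|s_1|\le3$ and $|s_2|\le3$, then $$|\langle f,\psi_\lambda\rangle|\le C\min_{i=1,2}\left\{\frac{2^{-j(\alpha/4+1/2)}}{|k_i+2^{j(\alpha-1)/2}s_i|^{\alpha+1}}\right\},$$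 where a term with zero denominator is read as $+\infty$. (ii) If $H$ has normal vector $(-1,s_1,s_2)$ with $|s_1|\ge3/2$ or $|s_2|\ge3/2$, then $$|\langle f,\psi_\lambda\rangle|\le C\,2^{-j(\alpha/2+1/4)\alpha}.$$ (iii) If $H$ has normal vector $(0,s_1,s_2)\neq0$, then the estimate of (ii) holds. -/

import Mathlib

open MeasureTheory Filter Topology Asymptotics
open scoped ENNReal FourierTransform ComplexConjugate

noncomputable section

/-- Euclidean 3-space. -/
abbrev E3 := EuclideanSpace ℝ (Fin 3)

/-! ### Hölder (semi)norms -/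

/-- The partial derivative `∂_{i 0} ⋯ ∂_{i (m-1)} f`. As `i` runs over all maps `Fin m → Fin n`,
these are the derivatives `∂^γ f` over all multi-indices with `|γ| = m`. -/
def partialDeriv {n m : ℕ} {F : Type*} [NormedAddCommGroup F] [NormedSpace ℝ F]
    (i : Fin m → Fin n) (f : EuclideanSpace ℝ (Fin n) → F) (x : EuclideanSpace ℝ (Fin n)) : F :=
  iteratedFDeriv ℝ m f x (fun l => EuclideanSpace.single (i l) (1 : ℝ))

/-- The homogeneous Hölder seminorm
`max_{|γ| = ⌊β⌋} sup_{x,x'} |∂^γ f(x) - ∂^γ f(x')| / |x - x'|^{β - ⌊β⌋}`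
(the diagonal `x = x'` contributes `0`). -/
def holderSeminorm {n : ℕ} {F : Type*} [NormedAddCommGroup F] [NormedSpace ℝ F]
    (β : ℝ) (f : EuclideanSpace ℝ (Fin n) → F) : ℝ≥0∞ :=
  ⨆ i : Fin ⌊β⌋₊ → Fin n, ⨆ x, ⨆ x',
    ‖partialDeriv i f x - partialDeriv i f x'‖ₑ / ‖x - x'‖ₑ ^ (β - (⌊β⌋₊ : ℝ))

/-- The Hölder norm `max_{|γ| ≤ ⌊β⌋} sup |∂^γ f| + (seminorm of f)`. -/
def holderNorm {n : ℕ} {F : Type*} [NormedAddCommGroup F] [NormedSpace ℝ F]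
    (β : ℝ) (f : EuclideanSpace ℝ (Fin n) → F) : ℝ≥0∞ :=
  (⨆ m : ℕ, ⨆ _ : m ≤ ⌊β⌋₊, ⨆ i : Fin m → Fin n, ⨆ x, ‖partialDeriv i f x‖ₑ)
    + holderSeminorm β f

/-! ### Star-shaped sets and cartoon-like images -/

/-- The unit vector with spherical angles `(θ₁, θ₂)`. -/
def sphericalDir (θ : EuclideanSpace ℝ (Fin 2)) : E3 :=
  !₂[Real.cos (θ 0) * Real.sin (θ 1), Real.sin (θ 0) * Real.sin (θ 1), Real.cos (θ 1)]

/-- The set that is star-shaped about `x₀` with radius `ρ u` in the direction `u`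
(only the values of `ρ` at unit vectors matter). -/
def starBody (x₀ : E3) (ρ : E3 → ℝ) : Set E3 :=
  {x | ∃ u : E3, ‖u‖ = 1 ∧ ∃ t : ℝ, 0 ≤ t ∧ t ≤ ρ u ∧ x = x₀ + t • u}

/-- The closed unit cube `[0,1]³`. -/
def unitCube : Set E3 := {x | ∀ i, 0 ≤ x i ∧ x i ≤ 1}

/-- Star-shaped sets in `[0,1]³` whose boundary is a closed `C^α` surface: the radius is bounded
below by `r` and above by some `ρ₀ < 1`, and, as a function of the spherical angles, it is
`C^α` with homogeneous Hölder seminorm at most `ν`. The last condition is imposed for every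
choice `O` of the axes of the spherical coordinates, since one system of spherical coordinates
does not control the surface near its own poles. -/
def STAR (α ν r : ℝ) : Set (Set E3) :=
  {B | B ⊆ unitCube ∧ ∃ (x₀ : E3) (ρ : E3 → ℝ), B = starBody x₀ ρ ∧
    (∀ u : E3, ‖u‖ = 1 → r ≤ ρ u) ∧
    (∃ ρ₀ : ℝ, ρ₀ < 1 ∧ ∀ u : E3, ‖u‖ = 1 → ρ u ≤ ρ₀) ∧
    ∀ O : E3 ≃ₗᵢ[ℝ] E3,
      ContDiff ℝ ⌊α⌋₊ (fun θ => ρ (O (sphericalDir θ))) ∧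
      holderSeminorm α (fun θ => ρ (O (sphericalDir θ))) ≤ ENNReal.ofReal ν}

/-- `f = f₀ + f₁ χ_B` is a cartoon-like image with discontinuity surface `∂B`. -/
def IsCartoon (α β ν μ r : ℝ) (B : Set E3) (f : E3 → ℂ) : Prop :=
  B ∈ STAR α ν r ∧ ∃ f₀ f₁ : E3 → ℂ,
    f = f₀ + B.indicator f₁ ∧ tsupport f₀ ⊆ unitCube ∧
    (ContDiff ℝ ⌊β⌋₊ f₀ ∧ holderNorm β f₀ ≤ ENNReal.ofReal μ) ∧
    (ContDiff ℝ ⌊β⌋₊ f₁ ∧ holderNorm β f₁ ≤ ENNReal.ofReal μ)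

/-- The plane through `x` with normal vector `n` is the tangent plane of `S` at `x`: the distance
of `y ∈ S` from it is `o(|y - x|)`. -/
def IsTangentPlaneNormal (S : Set E3) (x n : E3) : Prop :=
  x ∈ S ∧ n ≠ 0 ∧ (fun y : E3 => inner ℝ (y - x) n) =o[𝓝[S] x] (fun y : E3 => y - x)

/-! ### Shearlets -/

/-- The scaling matrix `A_{2^j}`. -/
def scalingMatrix (α : ℝ) (j : ℕ) : Matrix (Fin 3) (Fin 3) ℝ :=
  Matrix.diagonal ![(2 : ℝ) ^ ((j : ℝ) * α / 2), (2 : ℝ) ^ ((j : ℝ) / 2), (2 : ℝ) ^ ((j : ℝ) / 2)]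

/-- The shear matrix `S_k`. -/
def shearMatrix (k : Fin 2 → ℤ) : Matrix (Fin 3) (Fin 3) ℝ :=
  !![1, (k 0 : ℝ), (k 1 : ℝ); 0, 1, 0; 0, 0, 1]

/-- The lattice point `M_c z`, where `M_c = diag(c₁, c₂, c₂)`. -/
def latticePoint (c₁ c₂ : ℝ) (z : Fin 3 → ℤ) : E3 :=
  !₂[c₁ * (z 0 : ℝ), c₂ * (z 1 : ℝ), c₂ * (z 2 : ℝ)]

/-- The shearlet `ψ_{j,k,m} = 2^{j(α+2)/4} ψ(S_k A_{2^j} · - m)`. -/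
def shearlet (α : ℝ) (ψ : E3 → ℂ) (j : ℕ) (k : Fin 2 → ℤ) (m : E3) (x : E3) : ℂ :=
  (((2 : ℝ) ^ ((j : ℝ) * (α + 2) / 4) : ℝ) : ℂ) *
    ψ (WithLp.toLp 2 (Matrix.mulVec (shearMatrix k * scalingMatrix α j) (WithLp.ofLp x)) - m)

/-- The shearlet coefficient `⟨f, g⟩ = ∫ f \bar g`. -/
def coeff (f g : E3 → ℂ) : ℂ := ∫ x, f x * conj (g x)

/-- The dyadic cube `[-2^{-j/2}, 2^{-j/2}]³ + 2^{-j/2} 2p`. -/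
def dyadicCube (j : ℕ) (p : Fin 3 → ℤ) : Set E3 :=
  {x | ∀ i, |x i - (2 : ℝ) ^ (-((j : ℝ) / 2)) * (2 * (p i : ℝ))| ≤ (2 : ℝ) ^ (-((j : ℝ) / 2))}

/-- `min {1, |t|^{-γ}}`, which is `1` at `t = 0`. -/
def decayFactor (γ t : ℝ) : ℝ := (max 1 |t|) ^ (-γ)

/-- The decay conditions on the Fourier transform of the generator:
(i) on `ψ̂` and (ii) on its derivatives in the second and third variable. -/
def DecayConditions (ψ : E3 → ℂ) : Prop :=
  ∃ (K δ γ : ℝ) (h : ℝ → ℝ), 8 < δ ∧ 4 ≤ γ ∧ Integrable h ∧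
    (∀ ξ : E3, ‖𝓕 ψ ξ‖ ≤
      K * min 1 (|ξ 0| ^ δ) * decayFactor γ (ξ 0) * decayFactor γ (ξ 1) * decayFactor γ (ξ 2)) ∧
    (∀ ξ : E3, ξ 0 ≠ 0 → ∀ i : Fin 3, i ≠ 0 →
      ‖fderiv ℝ (𝓕 ψ) ξ (EuclideanSpace.single i (1 : ℝ))‖ ≤
        |h (ξ 0)| * (1 + |ξ 1| / |ξ 0|) ^ (-γ) * (1 + |ξ 2| / |ξ 0|) ^ (-γ))

end

/-!
The decay of `𝓕 ψ` makes it integrable, so `ψ̄` agrees almost everywhere with a continuous function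
`η`, and the zero of `𝓕 ψ` on the plane `ξ₁ = 0` gives `η` small zeroth and first moments along
lines `v = b + a t` of small slope `a`, where `t` is the coordinate along the first axis.

Near a boundary point `x` the body is `{φ ≥ 0}`, where `φ` is the radial function minus the distance
to the centre, so that `dφ` is `(α - 1)`-Hölder. Moving `x` to the origin and undoing `S_k A_{2^j}`
turns the coefficient into an integral against `η` over a bounded region. Let `ε` be the inverse of
`|k_i + 2^{j(α-1)/2} s_i|`. In every slice parallel to the axes `1` and `i + 1` the derivative of
the rescaled `φ` along axis `i + 1` exceeds that along axis `1` by a factor of order `1 / ε`. Hence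
the rescaled body is in the slice a half plane bounded by a line of slope `O(ε)`, up to a strip of
width `O(ε ^ (α + 1))`. The strip contributes `O(ε ^ (α + 1))`. The half plane is a union of lines
parallel to its boundary, and along them `f₀` and `f₁` differ from their first-order Taylor
polynomials by `O(ε ^ (α + 1))`, while the moments of `η` annihilate these up to the same order.

If the tangent plane is steep, the shear cannot cancel its slope, and the same argument applies with
`ε = 2^{-j(α-1)/2}` along the axis on which the normal vector is longest.
-/

/-! ### Coordinates along the shear directions -/

/-- The point with coordinate `t` along the first axis, `v` along the axis `i.succ`, which is the
one sheared by `k i`, and `s` along the remaining axis. -/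
noncomputable def axisPoint (i : Fin 2) (t v s : ℝ) : E3 :=
  t • EuclideanSpace.single 0 (1 : ℝ) + v • EuclideanSpace.single i.succ (1 : ℝ) +
    s • EuclideanSpace.single i.rev.succ (1 : ℝ)

section AxisPoint

variable (i : Fin 2)

lemma axisPoint_apply_zero (t v s : ℝ) : axisPoint i t v s 0 = t := by
  fin_cases i <;> simp [axisPoint, Fin.rev]

lemma axisPoint_apply_succ (t v s : ℝ) : axisPoint i t v s i.succ = v := by
  fin_cases i <;> simp [axisPoint, Fin.rev]

lemma axisPoint_apply_rev_succ (t v s : ℝ) : axisPoint i t v s i.rev.succ = s := by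
  fin_cases i <;> simp [axisPoint, Fin.rev]

lemma inner_axisPoint (t v s t' v' s' : ℝ) :
    inner ℝ (axisPoint i t v s) (axisPoint i t' v' s') = t * t' + v * v' + s * s' := by
  rw [PiLp.inner_apply, Fin.sum_univ_three]
  fin_cases i <;> simp [axisPoint, Fin.rev] <;> ring

lemma continuous_axisPoint :
    Continuous fun q : ℝ × ℝ × ℝ => axisPoint i q.1 q.2.1 q.2.2 := by
  unfold axisPoint
  fun_prop

lemma continuous_axisPoint_comp {X : Type*} [TopologicalSpace X] {t v s : X → ℝ}
    (ht : Continuous t) (hv : Continuous v) (hs : Continuous s) :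
    Continuous fun x => axisPoint i (t x) (v x) (s x) :=
  (continuous_axisPoint i).comp (ht.prodMk (hv.prodMk hs))

lemma axisPoint_injective :
    Function.Injective fun q : ℝ × ℝ × ℝ => axisPoint i q.1 q.2.1 q.2.2 := by
  rintro ⟨t, v, s⟩ ⟨t', v', s'⟩ (h : axisPoint i t v s = axisPoint i t' v' s')
  have hzero := congrArg (fun x : E3 => x 0) h
  have hsucc := congrArg (fun x : E3 => x i.succ) h
  have hrev := congrArg (fun x : E3 => x i.rev.succ) h
  simp only [axisPoint_apply_zero, axisPoint_apply_succ, axisPoint_apply_rev_succ]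
    at hzero hsucc hrev
  rw [hzero, hsucc, hrev]

lemma measurableEmbedding_axisPoint :
    MeasurableEmbedding fun q : ℝ × ℝ × ℝ => axisPoint i q.1 q.2.1 q.2.2 :=
  (continuous_axisPoint i).measurableEmbedding (axisPoint_injective i)

lemma measurePreserving_axisPoint :
    MeasurePreserving (fun q : ℝ × ℝ × ℝ => axisPoint i q.1 q.2.1 q.2.2) := by
  have hrotate : MeasurePreserving (fun q : ℝ × ℝ × ℝ => (q.2.2, (q.1, q.2.1))) :=
    (Measure.measurePreserving_swap (μ := (volume : Measure (ℝ × ℝ)))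
      (ν := (volume : Measure ℝ))).comp
      (volume_preserving_prodAssoc (α₁ := ℝ) (β₁ := ℝ) (γ₁ := ℝ)).symm
  have hpair : MeasurePreserving
      (Prod.map (id : ℝ → ℝ) (MeasurableEquiv.finTwoArrow (α := ℝ)).symm) :=
    (MeasurePreserving.id (volume : Measure ℝ)).prod (volume_preserving_finTwoArrow ℝ).symm
  have hinsert := (volume_preserving_piFinSuccAbove (fun _ : Fin 3 => ℝ) i.rev.succ).symm
  convert ((PiLp.volume_preserving_toLp (Fin 3)).comp (hinsert.comp hpair)).comp hrotate using 1
  ext ⟨t, v, s⟩ l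
  fin_cases i <;> fin_cases l <;>
    simp [axisPoint, Fin.rev, Fin.insertNth, Fin.succAboveCases, MeasurableEquiv.finTwoArrow,
      MeasurableEquiv.piFinSuccAbove, Fin.insertNthEquiv]

lemma integral_axisPoint {F : Type*} [NormedAddCommGroup F] [NormedSpace ℝ F] (f : E3 → F) :
    ∫ q : ℝ × ℝ × ℝ, f (axisPoint i q.1 q.2.1 q.2.2) = ∫ x, f x :=
  (measurePreserving_axisPoint i).integral_comp (measurableEmbedding_axisPoint i) f

lemma integrable_axisPoint_iff {F : Type*} [NormedAddCommGroup F] {f : E3 → F} :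
    Integrable (fun q : ℝ × ℝ × ℝ => f (axisPoint i q.1 q.2.1 q.2.2)) ↔ Integrable f :=
  (measurePreserving_axisPoint i).integrable_comp_emb (measurableEmbedding_axisPoint i)

lemma measurePreserving_axisPoint_shear (a : ℝ) :
    MeasurePreserving (fun p : (ℝ × ℝ) × ℝ => axisPoint i (p.2 - a * p.1.1) p.1.1 p.1.2) := by
  have hshear : MeasurePreserving
      (fun p : (ℝ × ℝ) × ℝ => ((p.1, p.2 - a * p.1.1) : (ℝ × ℝ) × ℝ)) := by
    refine (MeasurePreserving.id (volume : Measure (ℝ × ℝ))).skew_product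
      (g := fun q τ => τ - a * q.1) (by fun_prop) (.of_forall fun q => ?_)
    exact (measurePreserving_sub_right (volume : Measure ℝ) (a * q.1)).map_eq
  have hswap : MeasurePreserving (Prod.swap : (ℝ × ℝ) × ℝ → ℝ × ℝ × ℝ) :=
    Measure.measurePreserving_swap
  exact (measurePreserving_axisPoint i).comp (hswap.comp hshear)

lemma measurableEmbedding_axisPoint_shear (a : ℝ) :
    MeasurableEmbedding (fun p : (ℝ × ℝ) × ℝ => axisPoint i (p.2 - a * p.1.1) p.1.1 p.1.2) := by
  refine Continuous.measurableEmbedding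
    (continuous_axisPoint_comp i (by fun_prop) (by fun_prop) (by fun_prop)) ?_
  rintro ⟨⟨v, s⟩, t⟩ ⟨⟨v', s'⟩, t'⟩ h
  have heq := axisPoint_injective i (a₁ := (t - a * v, v, s)) (a₂ := (t' - a * v', v', s')) h
  simp only [Prod.mk.injEq] at heq ⊢
  obtain ⟨ht, rfl, rfl⟩ := heq
  exact ⟨⟨rfl, rfl⟩, by linarith⟩

end AxisPoint

/-! ### Fourier inversion almost everywhere -/

section FourierInversion

variable {V : Type*} [NormedAddCommGroup V] [InnerProductSpace ℝ V] [MeasurableSpace V]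
  [BorelSpace V] [FiniteDimensional ℝ V]

lemma continuous_fourier_of_integrable {f : V → ℂ} (hf : Integrable f) : Continuous (𝓕 f) :=
  VectorFourier.fourierIntegral_continuous (e := 𝐞) Real.continuous_fourierChar
    (L := innerₗ V) (by exact continuous_inner) hf

lemma continuous_fourierInv_of_integrable {f : V → ℂ} (hf : Integrable f) :
    Continuous (𝓕⁻ f) := by
  rw [funext (Real.fourierInv_eq_fourier_neg f)]
  exact (continuous_fourier_of_integrable hf).comp continuous_neg

lemma norm_fourierInv_le_integral_norm (f : V → ℂ) (x : V) : ‖𝓕⁻ f x‖ ≤ ∫ ξ, ‖f ξ‖ := by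
  rw [Real.fourierInv_eq_fourier_neg]
  exact VectorFourier.norm_fourierIntegral_le_integral_norm 𝐞 volume (innerₗ V) f (-x)

lemma integral_fourier_mul_eq_flip {f g : V → ℂ} (hf : Integrable f) (hg : Integrable g) :
    ∫ x, 𝓕 f x * g x = ∫ x, f x * 𝓕 g x := by
  simpa using! VectorFourier.integral_fourierIntegral_smul_eq_flip (L := innerₗ V)
    Real.continuous_fourierChar continuous_inner hf hg

lemma integral_fourierInv_mul_eq_flip {f g : V → ℂ} (hf : Integrable f) (hg : Integrable g) :
    ∫ x, 𝓕⁻ f x * g x = ∫ x, f x * 𝓕⁻ g x := by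
  rw [Real.fourierInv_eq_fourier_comp_neg g, ← integral_fourier_mul_eq_flip hf hg.comp_neg,
    ← integral_neg_eq_self]
  simp_rw [Real.fourierInv_eq_fourier_neg, neg_neg]

lemma fourierInv_fourier_ae_eq {ψ : V → ℂ} (hψ : Integrable ψ) (hF : Integrable (𝓕 ψ)) :
    𝓕⁻ (𝓕 ψ) =ᵐ[volume] ψ := by
  refine ae_eq_of_integral_contDiff_smul_eq
    (continuous_fourierInv_of_integrable hF).locallyIntegrable hψ.locallyIntegrable
    fun g hg hg_supp => ?_
  have hgℂ_supp : HasCompactSupport (fun x => (g x : ℂ)) := hg_supp.comp_left Complex.ofReal_zero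
  let S : SchwartzMap V ℂ := hgℂ_supp.toSchwartzMap (Complex.ofRealCLM.contDiff.comp hg)
  have hpairing : ∫ x, 𝓕⁻ (𝓕 ψ) x * S x = ∫ x, ψ x * S x := by
    rw [integral_fourierInv_mul_eq_flip hF S.integrable, ← SchwartzMap.fourierInv_coe,
      integral_fourier_mul_eq_flip hψ (𝓕⁻ S).integrable, ← SchwartzMap.fourier_coe,
      FourierTransform.fourier_fourierInv_eq]
  have hS : (S : V → ℂ) = fun x => (g x : ℂ) := rfl
  rw [hS] at hpairing
  simp_rw [Complex.real_smul]
  simpa only [mul_comm] using hpairing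

lemma norm_fourierChar_mul (x : ℝ) (z : ℂ) : ‖(𝐞 x : ℂ) * z‖ = ‖z‖ := by
  rw [norm_mul, Circle.norm_coe, one_mul]

end FourierInversion

/-! ### Moments of functions of one variable -/

section Moments

variable {E : Type*} [NormedAddCommGroup E] [NormedSpace ℝ E]

lemma norm_integral_le_of_eq_zero_of_lt_abs {F : ℝ → E} {R c : ℝ} (hR : 0 ≤ R)
    (hzero : ∀ t, R < |t| → F t = 0) (hF : ∀ t, |t| ≤ R → ‖F t‖ ≤ c) :
    ‖∫ t, F t‖ ≤ c * (2 * R) := by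
  have hIcc : ∫ t in Set.Icc (-R) R, F t = ∫ t, F t :=
    setIntegral_eq_integral_of_forall_compl_eq_zero fun t ht =>
      hzero t (not_le.1 fun h => ht (abs_le.1 h))
  have hbound : ‖∫ t in Set.Icc (-R) R, F t‖ ≤ c * volume.real (Set.Icc (-R) R) :=
    norm_setIntegral_le_of_norm_le_const (by simp) fun t ht => hF t (abs_le.2 ht)
  rw [← hIcc]
  refine hbound.trans_eq ?_
  rw [Real.volume_real_Icc_of_le (by linarith)]
  ring

lemma norm_exp_mul_I_sub_one_sub_le (x : ℝ) :
    ‖Complex.exp (x * Complex.I) - 1 - x * Complex.I‖ ≤ 3 * x ^ 2 := by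
  have hnorm : ‖(x : ℂ) * Complex.I‖ = |x| := by simp
  rcases le_total |x| 1 with h | h
  · refine (Complex.norm_exp_sub_one_sub_id_le (by rwa [hnorm])).trans ?_
    rw [hnorm, sq_abs]
    nlinarith [sq_nonneg x]
  · calc ‖Complex.exp (x * Complex.I) - 1 - x * Complex.I‖
        ≤ ‖Complex.exp (x * Complex.I)‖ + ‖(1 : ℂ)‖ + ‖(x : ℂ) * Complex.I‖ :=
          (norm_sub_le _ _).trans (by gcongr; exact norm_sub_le _ _)
      _ = 2 + |x| := by rw [hnorm, Complex.norm_exp_ofReal_mul_I, norm_one]; ring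
      _ ≤ 3 * x ^ 2 := by rw [← sq_abs]; nlinarith

variable {u : ℝ → ℂ} {R : ℝ}

lemma hasCompactSupport_of_eq_zero_of_lt_abs (hu : ∀ t, R < |t| → u t = 0) :
    HasCompactSupport u :=
  .intro (isCompact_Icc (a := -R) (b := R)) fun t ht => hu t (not_le.1 fun h => ht (abs_le.1 h))

/-- The first moment is a difference quotient of the Fourier transform at `0`, up to the
second-order Taylor remainder of the exponential. -/
lemma norm_integral_id_mul_le_norm_fourier {N ε : ℝ} (hR : 0 ≤ R) (hc : Continuous u)
    (hu : ∀ t, R < |t| → u t = 0) (hN : ∀ t, ‖u t‖ ≤ N) (hε : 0 < ε) :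
    2 * Real.pi * ε * ‖∫ t : ℝ, (t : ℂ) * u t‖ ≤
      ‖𝓕 u 0‖ + ‖𝓕 u ε‖ + 24 * Real.pi ^ 2 * R ^ 3 * N * ε ^ 2 := by
  set e : ℝ → ℂ := fun t => Complex.exp (↑(-2 * Real.pi * t * ε) * Complex.I)
  set rem : ℝ → ℂ := fun t => e t - 1 - ↑(-2 * Real.pi * t * ε) * Complex.I with hrem
  have hsupp := hasCompactSupport_of_eq_zero_of_lt_abs hu
  have hint : ∀ g : ℝ → ℂ, Continuous g → Integrable fun t => g t * u t := fun g hg =>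
    (hg.mul hc).integrable_of_hasCompactSupport hsupp.mul_left
  have hfourier_zero : 𝓕 u 0 = ∫ t, u t := by simp [Real.fourier_real_eq]
  have hfourier : 𝓕 u ε = ∫ t, e t * u t := by
    rw [Real.fourier_real_eq_integral_exp_smul]
    rfl
  have htaylor : (2 * Real.pi * ε * Complex.I : ℂ) * ∫ t : ℝ, (t : ℂ) * u t =
      (𝓕 u 0 - 𝓕 u ε) + ∫ t : ℝ, rem t * u t := by
    have hui : Integrable u := hc.integrable_of_hasCompactSupport hsupp
    have hei : Integrable fun t => e t * u t := hint e (by fun_prop)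
    have hri : Integrable fun t => rem t * u t := hint rem (by fun_prop)
    have hpointwise : ∀ t : ℝ, (2 * Real.pi * ε * Complex.I : ℂ) * (t * u t) =
        (u t - e t * u t) + rem t * u t := fun t => by
      simp only [hrem]
      push_cast
      ring
    rw [hfourier_zero, hfourier, ← integral_const_mul, ← integral_sub hui hei,
      ← integral_add (by exact hui.sub hei) hri]
    exact integral_congr_ae (.of_forall hpointwise)
  have hremainder : ‖∫ t : ℝ, rem t * u t‖ ≤ (3 * (2 * Real.pi * R * ε) ^ 2 * N) * (2 * R) := by
    refine norm_integral_le_of_eq_zero_of_lt_abs hR (fun t ht => by rw [hu t ht, mul_zero])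
      fun t ht => ?_
    rw [norm_mul]
    gcongr
    · refine (norm_exp_mul_I_sub_one_sub_le _).trans ?_
      rw [← sq_abs, abs_mul, abs_mul, abs_mul, abs_neg, abs_of_pos Real.pi_pos, abs_of_pos hε,
        abs_two]
      gcongr
    · exact hN t
  calc 2 * Real.pi * ε * ‖∫ t : ℝ, (t : ℂ) * u t‖
      = ‖(2 * Real.pi * ε * Complex.I : ℂ) * ∫ t : ℝ, (t : ℂ) * u t‖ := by
        simp [abs_of_pos hε, abs_of_pos Real.pi_pos]
    _ ≤ ‖𝓕 u 0‖ + ‖𝓕 u ε‖ + (3 * (2 * Real.pi * R * ε) ^ 2 * N) * (2 * R) := by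
        rw [htaylor]
        exact (norm_add_le _ _).trans (add_le_add (norm_sub_le _ _) hremainder)
    _ = _ := by ring

end Moments

/-! ### Moments along lines of a function with prescribed Fourier decay -/

/-- Decay of `G` of order four along the axes, together with a zero of order four in the first
variable. For `G = 𝓕 ψ` the zero produces vanishing moments of `ψ`. -/
def HasFourierDecay (K : ℝ) (G : E3 → ℂ) : Prop :=
  ∀ ξ, ‖G ξ‖ ≤ K * min (ξ 0 ^ 4) (1 + ξ 0 ^ 2)⁻¹ *
    (((1 + |ξ 1|) ^ 4)⁻¹ * ((1 + |ξ 2|) ^ 4)⁻¹)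

lemma inv_one_add_abs_pow_four_le (t : ℝ) : ((1 + |t|) ^ 4)⁻¹ ≤ (1 + t ^ 2)⁻¹ := by
  refine inv_anti₀ (by positivity) ?_
  have habs := abs_nonneg t
  have hsq := sq_abs t
  nlinarith [pow_nonneg habs 2, pow_nonneg habs 3, pow_nonneg habs 4]

lemma integrable_inv_one_add_abs_pow_four : Integrable fun t : ℝ => ((1 + |t|) ^ 4)⁻¹ := by
  refine integrable_inv_one_add_sq.mono' (by fun_prop (disch := intros; positivity))
    (.of_forall fun t => ?_)
  rw [Real.norm_of_nonneg (by positivity)]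
  exact inv_one_add_abs_pow_four_le t

lemma integral_inv_one_add_abs_pow_four_le : ∫ t : ℝ, ((1 + |t|) ^ 4)⁻¹ ≤ 4 :=
  calc ∫ t : ℝ, ((1 + |t|) ^ 4)⁻¹ ≤ ∫ t : ℝ, (1 + t ^ 2)⁻¹ :=
        integral_mono integrable_inv_one_add_abs_pow_four integrable_inv_one_add_sq
          inv_one_add_abs_pow_four_le
    _ = Real.pi := integral_univ_inv_one_add_sq
    _ ≤ 4 := Real.pi_le_four

lemma min_pow_four_inv_le_one (t : ℝ) : min (t ^ 4) (1 + t ^ 2)⁻¹ ≤ 1 :=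
  (min_le_right _ _).trans (inv_le_one_of_one_le₀ (by nlinarith [sq_nonneg t]))

lemma min_pow_four_le_mul_inv {t u : ℝ} (hu : 0 < u) (ht : |t| ≤ u) :
    min (t ^ 4) (1 + t ^ 2)⁻¹ ≤ 2 * (u ^ 4 * (1 + u ^ 2)⁻¹) := by
  have hpow : min (t ^ 4) (1 + t ^ 2)⁻¹ ≤ u ^ 4 := by
    refine (min_le_left _ _).trans ?_
    rw [← Even.pow_abs (by decide)]
    gcongr
  have hone := min_pow_four_inv_le_one t
  rw [← mul_assoc, ← div_eq_mul_inv, le_div_iff₀ (by positivity)]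
  rcases le_total u 1 with h | h
  · nlinarith [pow_le_one₀ hu.le h (n := 2), pow_pos hu 4]
  · nlinarith [one_le_pow₀ h (n := 2), sq_nonneg (u ^ 2 - 1)]

lemma min_pow_four_mul_inv_pow_le {ε t w : ℝ} (hε : 0 < ε) (ht : |t| ≤ ε * (1 + |w|)) :
    min (t ^ 4) (1 + t ^ 2)⁻¹ * ((1 + |w|) ^ 4)⁻¹ ≤ 2 * ε ^ 4 * (1 + (ε * w) ^ 2)⁻¹ := by
  have : 0 < 1 + |w| := by positivity
  have hmono : (ε * w) ^ 2 ≤ (ε * (1 + |w|)) ^ 2 := by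
    rw [mul_pow, mul_pow, ← sq_abs w]
    gcongr
    linarith
  calc min (t ^ 4) (1 + t ^ 2)⁻¹ * ((1 + |w|) ^ 4)⁻¹
      ≤ 2 * ((ε * (1 + |w|)) ^ 4 * (1 + (ε * (1 + |w|)) ^ 2)⁻¹) * ((1 + |w|) ^ 4)⁻¹ := by
        gcongr
        exact min_pow_four_le_mul_inv (by positivity) ht
    _ = 2 * ε ^ 4 * (1 + (ε * (1 + |w|)) ^ 2)⁻¹ := by field_simp
    _ ≤ 2 * ε ^ 4 * (1 + (ε * w) ^ 2)⁻¹ := by gcongr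

lemma integrable_inv_one_add_mul_sq {ε : ℝ} (hε : ε ≠ 0) :
    Integrable fun w : ℝ => (1 + (ε * w) ^ 2)⁻¹ :=
  integrable_inv_one_add_sq.comp_mul_left' hε

lemma integral_inv_one_add_mul_sq (ε : ℝ) :
    ∫ w : ℝ, (1 + (ε * w) ^ 2)⁻¹ = Real.pi / |ε| := by
  rw [Measure.integral_comp_mul_left (fun w => (1 + w ^ 2)⁻¹) ε, integral_univ_inv_one_add_sq,
    abs_inv, smul_eq_mul, inv_mul_eq_div]

/-- The integrals of `G` over the planes `ξ 0 = τ - a * ξ i.succ`, twisted by a character. As a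
function of `τ` this is the Fourier transform of the restriction of `𝓕⁻ G` to the line
`t ↦ (t, v + a t, s)`. -/
noncomputable def planeTransform (i : Fin 2) (G : E3 → ℂ) (a v s τ : ℝ) : ℂ :=
  ∫ q : ℝ × ℝ, (𝐞 (q.1 * v + q.2 * s) : ℂ) * G (axisPoint i (τ - a * q.1) q.1 q.2)

section PlaneTransform

variable {i : Fin 2} {G : E3 → ℂ}

lemma integrable_planeTransform_integrand (hG : Integrable G) (a v s : ℝ) :
    Integrable fun p : (ℝ × ℝ) × ℝ => (𝐞 (p.1.1 * v + p.1.2 * s) : ℂ) *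
      G (axisPoint i (p.2 - a * p.1.1) p.1.1 p.1.2) := by
  have hsheared := ((measurePreserving_axisPoint_shear i a).integrable_comp_emb
    (measurableEmbedding_axisPoint_shear i a)).2 hG
  have := Real.continuous_fourierChar
  refine hsheared.norm.mono' (.mul (Continuous.aestronglyMeasurable (by fun_prop))
    hsheared.aestronglyMeasurable) (.of_forall fun p => ?_)
  rw [norm_fourierChar_mul]
  rfl

lemma integrable_planeTransform (hG : Integrable G) (a v s : ℝ) :
    Integrable (planeTransform i G a v s) :=
  (integrable_planeTransform_integrand hG a v s).integral_prod_right

lemma fourierInv_axisPoint_line_eq (hG : Integrable G) (a v s t : ℝ) :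
    𝓕⁻ G (axisPoint i t (v + a * t) s) = 𝓕⁻ (planeTransform i G a v s) t := by
  have hint := integrable_planeTransform_integrand (i := i) hG a v s
  have hphase : ∀ p : (ℝ × ℝ) × ℝ,
      𝐞 (inner ℝ (axisPoint i (p.2 - a * p.1.1) p.1.1 p.1.2) (axisPoint i t (v + a * t) s)) •
        G (axisPoint i (p.2 - a * p.1.1) p.1.1 p.1.2) =
      (𝐞 (p.2 * t) : ℂ) * ((𝐞 (p.1.1 * v + p.1.2 * s) : ℂ) *
        G (axisPoint i (p.2 - a * p.1.1) p.1.1 p.1.2)) := fun p => by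
    rw [inner_axisPoint, Circle.smul_def, smul_eq_mul, ← mul_assoc, ← Circle.coe_mul,
      ← AddChar.map_add_eq_mul]
    congr 3
    ring
  have hint_twisted : Integrable fun p : (ℝ × ℝ) × ℝ => (𝐞 (p.2 * t) : ℂ) *
      ((𝐞 (p.1.1 * v + p.1.2 * s) : ℂ) *
        G (axisPoint i (p.2 - a * p.1.1) p.1.1 p.1.2)) := by
    have := Real.continuous_fourierChar
    refine hint.norm.mono' (.mul (Continuous.aestronglyMeasurable (by fun_prop))
      hint.aestronglyMeasurable) (.of_forall fun p => ?_)
    rw [norm_fourierChar_mul]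
  rw [Real.fourierInv_eq, Real.fourierInv_eq,
    ← (measurePreserving_axisPoint_shear i a).integral_comp
      (measurableEmbedding_axisPoint_shear i a)]
  simp_rw [hphase]
  rw [Measure.volume_eq_prod, integral_prod_symm _ hint_twisted]
  refine integral_congr_ae (.of_forall fun τ => ?_)
  simp only [integral_const_mul, Circle.smul_def, smul_eq_mul, planeTransform,
    RCLike.inner_apply, conj_trivial, mul_comm]

end PlaneTransform

namespace HasFourierDecay

variable {K : ℝ} {G : E3 → ℂ}

lemma nonneg (hG : HasFourierDecay K G) : 0 ≤ K := by
  have hone := (norm_nonneg _).trans (hG (EuclideanSpace.single 0 1))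
  simp at hone
  linarith

lemma norm_axisPoint_le (hG : HasFourierDecay K G) (i : Fin 2) (t v s : ℝ) :
    ‖G (axisPoint i t v s)‖ ≤
      K * min (t ^ 4) (1 + t ^ 2)⁻¹ * (((1 + |v|) ^ 4)⁻¹ * ((1 + |s|) ^ 4)⁻¹) := by
  have hbound := hG (axisPoint i t v s)
  rw [axisPoint_apply_zero] at hbound
  fin_cases i
  · simpa [axisPoint, Fin.rev] using hbound
  · simpa [axisPoint, Fin.rev, mul_comm] using hbound

lemma integrable (hG : HasFourierDecay K G) (hc : Continuous G) : Integrable G := by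
  have hK := hG.nonneg
  rw [← integrable_axisPoint_iff 0]
  refine ((integrable_inv_one_add_sq.const_mul K).mul_prod
    (integrable_inv_one_add_abs_pow_four.mul_prod integrable_inv_one_add_abs_pow_four)).mono'
    (hc.comp (continuous_axisPoint 0)).aestronglyMeasurable (.of_forall fun ⟨t, v, s⟩ => ?_)
  refine (hG.norm_axisPoint_le 0 t v s).trans ?_
  dsimp only
  gcongr
  exact min_le_right _ _

lemma continuous_planeTransform (hG : HasFourierDecay K G) (hc : Continuous G) (i : Fin 2)
    (a v s : ℝ) : Continuous (planeTransform i G a v s) := by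
  have hK := hG.nonneg
  have := Real.continuous_fourierChar
  refine continuous_of_dominated
    (bound := fun q : ℝ × ℝ => K * (((1 + |q.1|) ^ 4)⁻¹ * ((1 + |q.2|) ^ 4)⁻¹))
    (fun τ => Continuous.aestronglyMeasurable (.mul (by fun_prop) (hc.comp
      (continuous_axisPoint_comp i (by fun_prop) (by fun_prop) (by fun_prop)))))
    (fun τ => .of_forall fun q => ?_)
    ((integrable_inv_one_add_abs_pow_four.mul_prod
      integrable_inv_one_add_abs_pow_four).const_mul K)
    (.of_forall fun q => continuous_const.mul (hc.comp
      (continuous_axisPoint_comp i (by fun_prop) (by fun_prop) (by fun_prop))))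
  rw [norm_fourierChar_mul]
  refine (hG.norm_axisPoint_le i _ _ _).trans ?_
  gcongr
  exact mul_le_of_le_one_right hK (min_pow_four_inv_le_one _)

lemma norm_planeTransform_le (hG : HasFourierDecay K G) (i : Fin 2) {ε a τ : ℝ} (hε : 0 < ε)
    (ha : |a| ≤ ε) (hτ : |τ| ≤ ε) (v s : ℝ) :
    ‖planeTransform i G a v s τ‖ ≤ 32 * K * ε ^ 3 := by
  have hK := hG.nonneg
  have hpointwise : ∀ q : ℝ × ℝ, ‖G (axisPoint i (τ - a * q.1) q.1 q.2)‖ ≤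
      (K * (2 * ε ^ 4) * (1 + (ε * q.1) ^ 2)⁻¹) * ((1 + |q.2|) ^ 4)⁻¹ := fun q => by
    have hshift : |τ - a * q.1| ≤ ε * (1 + |q.1|) :=
      calc |τ - a * q.1| ≤ |τ| + |a| * |q.1| := by rw [← abs_mul]; exact abs_sub _ _
        _ ≤ ε + ε * |q.1| := by gcongr
        _ = ε * (1 + |q.1|) := by ring
    calc ‖G (axisPoint i (τ - a * q.1) q.1 q.2)‖
        ≤ K * (min ((τ - a * q.1) ^ 4) (1 + (τ - a * q.1) ^ 2)⁻¹ * ((1 + |q.1|) ^ 4)⁻¹) *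
            ((1 + |q.2|) ^ 4)⁻¹ := (hG.norm_axisPoint_le i _ _ _).trans_eq (by ring)
      _ ≤ K * (2 * ε ^ 4 * (1 + (ε * q.1) ^ 2)⁻¹) * ((1 + |q.2|) ^ 4)⁻¹ :=
        mul_le_mul_of_nonneg_right (mul_le_mul_of_nonneg_left
          (min_pow_four_mul_inv_pow_le hε hshift) hK) (by positivity)
      _ = _ := by ring
  calc ‖planeTransform i G a v s τ‖
      ≤ ∫ q : ℝ × ℝ, (K * (2 * ε ^ 4) * (1 + (ε * q.1) ^ 2)⁻¹) * ((1 + |q.2|) ^ 4)⁻¹ :=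
        norm_integral_le_of_norm_le (((integrable_inv_one_add_mul_sq hε.ne').const_mul _).mul_prod
          integrable_inv_one_add_abs_pow_four) (.of_forall fun q => by
            rw [norm_fourierChar_mul]; exact hpointwise q)
    _ = (K * (2 * ε ^ 4) * (Real.pi / ε)) * ∫ t : ℝ, ((1 + |t|) ^ 4)⁻¹ := by
        rw [Measure.volume_eq_prod,
          integral_prod_mul (fun x : ℝ => K * (2 * ε ^ 4) * (1 + (ε * x) ^ 2)⁻¹)
            (fun x : ℝ => ((1 + |x|) ^ 4)⁻¹),
          integral_const_mul, integral_inv_one_add_mul_sq, abs_of_pos hε]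
    _ ≤ (K * (2 * ε ^ 4) * (4 / ε)) * 4 := by
        gcongr
        exacts [Real.pi_le_four, integral_inv_one_add_abs_pow_four_le]
    _ = 32 * K * ε ^ 3 := by field_simp; ring

lemma fourier_axisPoint_line_eq (hG : HasFourierDecay K G) (hc : Continuous G) (i : Fin 2)
    (a v s : ℝ) (hint : Integrable fun t => 𝓕⁻ G (axisPoint i t (v + a * t) s)) :
    𝓕 (fun t => 𝓕⁻ G (axisPoint i t (v + a * t) s)) = planeTransform i G a v s := by
  have hG_int := hG.integrable hc
  have hinv : (fun t => 𝓕⁻ G (axisPoint i t (v + a * t) s)) = 𝓕⁻ (planeTransform i G a v s) :=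
    funext fun t => fourierInv_axisPoint_line_eq hG_int a v s t
  have hfourier_int : Integrable (𝓕 (planeTransform i G a v s)) := by
    rw [hinv] at hint
    convert hint.comp_neg using 1
    ext τ
    rw [Real.fourierInv_eq_fourier_neg, neg_neg]
  rw [hinv]
  exact (hG.continuous_planeTransform hc i a v s).fourier_fourierInv_eq
    (integrable_planeTransform hG_int a v s) hfourier_int

lemma exists_line_moments_le (hG : HasFourierDecay K G) (hc : Continuous G) {R : ℝ} (hR : 0 ≤ R)
    (hsupp : ∀ x : E3, R < |x 0| → 𝓕⁻ G x = 0) (i : Fin 2) :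
    ∃ C : ℝ, ∀ ε a v s : ℝ, 0 < ε → ε ≤ 1 → |a| ≤ ε →
      ‖∫ t, 𝓕⁻ G (axisPoint i t (v + a * t) s)‖ ≤ C * ε ^ 3 ∧
      ‖∫ t : ℝ, (t : ℂ) * 𝓕⁻ G (axisPoint i t (v + a * t) s)‖ ≤ C * ε := by
  have hK := hG.nonneg
  have hG_int := hG.integrable hc
  set N : ℝ := ∫ ξ, ‖G ξ‖
  have : 0 ≤ N := integral_nonneg fun _ => norm_nonneg _
  have hpi := Real.pi_gt_three
  refine ⟨64 * K + 24 * Real.pi ^ 2 * R ^ 3 * N, fun ε a v s hε hε1 ha => ?_⟩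
  set u : ℝ → ℂ := fun t => 𝓕⁻ G (axisPoint i t (v + a * t) s)
  have hu_cont : Continuous u := (continuous_fourierInv_of_integrable hG_int).comp
    (continuous_axisPoint_comp i (by fun_prop) (by fun_prop) (by fun_prop))
  have hu_zero : ∀ t, R < |t| → u t = 0 := fun t ht =>
    hsupp _ (by rwa [axisPoint_apply_zero])
  have hfourier_u : 𝓕 u = planeTransform i G a v s := hG.fourier_axisPoint_line_eq hc i a v s
    (hu_cont.integrable_of_hasCompactSupport (hasCompactSupport_of_eq_zero_of_lt_abs hu_zero))
  have hfourier_le : ∀ τ : ℝ, |τ| ≤ ε → ‖𝓕 u τ‖ ≤ 32 * K * ε ^ 3 := fun τ hτ => by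
    rw [hfourier_u]
    exact hG.norm_planeTransform_le i hε ha hτ v s
  have hfourier_zero := hfourier_le 0 (by simpa using hε.le)
  constructor
  · have hintegral : 𝓕 u 0 = ∫ t, u t := by simp [Real.fourier_real_eq]
    rw [← hintegral]
    refine hfourier_zero.trans (mul_le_mul_of_nonneg_right ?_ (by positivity))
    have : 0 ≤ 24 * Real.pi ^ 2 * R ^ 3 * N := by positivity
    linarith
  · have hmoment := norm_integral_id_mul_le_norm_fourier hR hu_cont hu_zero
      (fun t => norm_fourierInv_le_integral_norm G _) hε
    have hfourier_ε := hfourier_le ε (abs_of_pos hε).le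
    have hcube : 32 * K * ε ^ 3 ≤ 32 * K * ε ^ 2 :=
      mul_le_mul_of_nonneg_left (pow_le_pow_of_le_one hε.le hε1 (by norm_num)) (by positivity)
    refine le_of_mul_le_mul_left ?_ hε
    calc ε * ‖∫ t : ℝ, (t : ℂ) * u t‖ ≤ 2 * Real.pi * ε * ‖∫ t : ℝ, (t : ℂ) * u t‖ :=
          mul_le_mul_of_nonneg_right (by nlinarith) (norm_nonneg _)
      _ ≤ 64 * K * ε ^ 2 + 24 * Real.pi ^ 2 * R ^ 3 * N * ε ^ 2 := by linarith
      _ = ε * ((64 * K + 24 * Real.pi ^ 2 * R ^ 3 * N) * ε) := by ring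

end HasFourierDecay

/-! ### The continuous representative of the generator -/

/-- A continuous function supported in the cube `[-R, R]³` whose zeroth and first moments along
the lines `t ↦ (t, v + a t, s)` are small when the slope `a` is small. -/
structure IsGenerator (R N : ℝ) (η : E3 → ℂ) : Prop where
  radius_pos : 0 < R
  continuous : Continuous η
  norm_le : ∀ x, ‖η x‖ ≤ N
  eq_zero : ∀ x l, R < |x l| → η x = 0
  moment_zero : ∀ (i : Fin 2) (ε a v s : ℝ), 0 < ε → ε ≤ 1 → |a| ≤ ε →
    ‖∫ t, η (axisPoint i t (v + a * t) s)‖ ≤ N * ε ^ 3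
  moment_one : ∀ (i : Fin 2) (ε a v s : ℝ), 0 < ε → ε ≤ 1 → |a| ≤ ε →
    ‖∫ t : ℝ, (t : ℂ) * η (axisPoint i t (v + a * t) s)‖ ≤ N * ε

lemma IsGenerator.bound_nonneg {R N : ℝ} {η : E3 → ℂ} (hη : IsGenerator R N η) : 0 ≤ N :=
  (norm_nonneg _).trans (hη.norm_le 0)

lemma IsGenerator.of_conj {R N : ℝ} {η : E3 → ℂ} (hη : IsGenerator R N η) :
    IsGenerator R N fun x => conj (η x) where
  radius_pos := hη.radius_pos
  continuous := Complex.continuous_conj.comp hη.continuous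
  norm_le x := by
    rw [RCLike.norm_conj]
    exact hη.norm_le x
  eq_zero x l hx := by rw [hη.eq_zero x l hx, map_zero]
  moment_zero i ε a v s hε hε1 ha := by
    rw [integral_conj, RCLike.norm_conj]
    exact hη.moment_zero i ε a v s hε hε1 ha
  moment_one i ε a v s hε hε1 ha := by
    have hconj : ∀ t : ℝ, (t : ℂ) * conj (η (axisPoint i t (v + a * t) s)) =
        conj ((t : ℂ) * η (axisPoint i t (v + a * t) s)) := fun t => by
      rw [map_mul, Complex.conj_ofReal]
    simp_rw [hconj]
    rw [integral_conj, RCLike.norm_conj]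
    exact hη.moment_one i ε a v s hε hε1 ha

lemma HasFourierDecay.exists_isGenerator {K R : ℝ} {G : E3 → ℂ} (hG : HasFourierDecay K G)
    (hc : Continuous G) (hR : 0 < R) (hsupp : ∀ x l, R < |x l| → 𝓕⁻ G x = 0) :
    ∃ N, IsGenerator R N (𝓕⁻ G) := by
  choose C hC using fun i => hG.exists_line_moments_le hc hR.le (fun x => hsupp x 0) i
  have hsum : ∀ i, C i ≤ |C 0| + |C 1| := fun i => by
    fin_cases i
    exacts [(le_abs_self _).trans (by simp), (le_abs_self _).trans (by simp)]
  have hint_nonneg : 0 ≤ ∫ ξ, ‖G ξ‖ := integral_nonneg fun _ => norm_nonneg _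
  refine ⟨(∫ ξ, ‖G ξ‖) + (|C 0| + |C 1|), hR,
    continuous_fourierInv_of_integrable (hG.integrable hc),
    fun x => (norm_fourierInv_le_integral_norm G x).trans (le_add_of_nonneg_right (by positivity)),
    hsupp, fun i ε a v s hε hε1 ha => ?_, fun i ε a v s hε hε1 ha => ?_⟩
  · refine (hC i ε a v s hε hε1 ha).1.trans (mul_le_mul_of_nonneg_right ?_ (by positivity))
    linarith [hsum i]
  · refine (hC i ε a v s hε hε1 ha).2.trans (mul_le_mul_of_nonneg_right ?_ hε.le)
    linarith [hsum i]

lemma integrable_of_memLp_two_of_hasCompactSupport {X E : Type*} [TopologicalSpace X]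
    [MeasurableSpace X] [OpensMeasurableSpace X] {μ : Measure X} [IsFiniteMeasureOnCompacts μ]
    [NormedAddCommGroup E] {f : X → E} (hf : MemLp f 2 μ) (hsupp : HasCompactSupport f) :
    Integrable f μ := by
  have hfinite : IsFiniteMeasure (μ.restrict (tsupport f)) :=
    ⟨by simpa using hsupp.measure_lt_top⟩
  exact (integrableOn_iff_integrable_of_support_subset (subset_tsupport f)).1
    ((hf.restrict (tsupport f)).integrable (by norm_num))

lemma eq_zero_of_ae_eq_of_notMem_tsupport {X E : Type*} [TopologicalSpace X]
    [MeasurableSpace X] [OpensMeasurableSpace X] {μ : Measure X} [μ.IsOpenPosMeasure]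
    [TopologicalSpace E] [T2Space E] [Zero E] {f g : X → E} (hg : Continuous g) (hgf : g =ᵐ[μ] f)
    {x : X} (hx : x ∉ tsupport f) : g x = 0 := by
  have hopen : IsOpen (tsupport f)ᶜ := (isClosed_tsupport f).isOpen_compl
  refine Measure.eqOn_open_of_ae_eq (μ := μ) (f := g) (g := fun _ => 0) ?_ hopen hg.continuousOn
    continuousOn_const hx
  filter_upwards [ae_restrict_of_ae hgf, ae_restrict_mem hopen.measurableSet] with y hy hmem
  rw [hy, image_eq_zero_of_notMem_tsupport hmem]

lemma exists_isGenerator_conj_ae_eq {K : ℝ} {ψ : E3 → ℂ} (hψ : Integrable ψ)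
    (hsupp : HasCompactSupport ψ) (hdecay : HasFourierDecay K (𝓕 ψ)) :
    ∃ (R N : ℝ) (η : E3 → ℂ), IsGenerator R N η ∧ (∀ x ∈ tsupport ψ, ∀ l, |x l| ≤ R) ∧
      (fun x => conj (ψ x)) =ᵐ[volume] η := by
  have hF_cont := continuous_fourier_of_integrable hψ
  have hF_int := hdecay.integrable hF_cont
  obtain ⟨R, hR, hball⟩ := hsupp.isBounded.subset_closedBall_lt 0 0
  have hcoord : ∀ x ∈ tsupport ψ, ∀ l, |x l| ≤ R := fun x hx l =>
    (PiLp.norm_apply_le x l).trans (mem_closedBall_zero_iff.1 (hball hx))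
  have hae : 𝓕⁻ (𝓕 ψ) =ᵐ[volume] ψ := fourierInv_fourier_ae_eq hψ hF_int
  obtain ⟨N, hN⟩ := hdecay.exists_isGenerator hF_cont hR fun x l hx =>
    eq_zero_of_ae_eq_of_notMem_tsupport (continuous_fourierInv_of_integrable hF_int) hae
      fun hmem => (hcoord x hmem l).not_gt hx
  refine ⟨R, N, _, hN.of_conj, hcoord, ?_⟩
  filter_upwards [hae] with x hx
  rw [hx]

section DecayFactor

variable {γ : ℝ}

lemma decayFactor_nonneg (t : ℝ) : 0 ≤ decayFactor γ t :=
  Real.rpow_nonneg (by positivity) _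

lemma decayFactor_le (hγ : 4 ≤ γ) (t : ℝ) : decayFactor γ t ≤ (max 1 |t| ^ 4)⁻¹ := by
  have hone : (1 : ℝ) ≤ max 1 |t| := le_max_left _ _
  calc decayFactor γ t ≤ (max 1 |t|) ^ (-(4 : ℝ)) :=
        Real.rpow_le_rpow_of_exponent_le hone (by linarith)
    _ = (max 1 |t| ^ 4)⁻¹ := by
        rw [Real.rpow_neg (by positivity)]
        norm_cast

lemma decayFactor_le_one (hγ : 4 ≤ γ) (t : ℝ) : decayFactor γ t ≤ 1 :=
  (decayFactor_le hγ t).trans (inv_le_one_of_one_le₀ (one_le_pow₀ (le_max_left _ _)))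

lemma decayFactor_le_inv_pow (hγ : 4 ≤ γ) (t : ℝ) :
    decayFactor γ t ≤ 16 * ((1 + |t|) ^ 4)⁻¹ := by
  have hpow : (1 + |t|) ^ 4 ≤ 16 * max 1 |t| ^ 4 :=
    calc (1 + |t|) ^ 4 ≤ (2 * max 1 |t|) ^ 4 := by
          gcongr
          linarith [le_max_left 1 |t|, le_max_right 1 |t|]
      _ = 16 * max 1 |t| ^ 4 := by ring
  refine (decayFactor_le hγ t).trans ?_
  rwa [← div_eq_mul_inv, inv_eq_one_div, div_le_div_iff₀ (by positivity) (by positivity), one_mul]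

lemma decayFactor_le_inv_one_add_sq (hγ : 4 ≤ γ) (t : ℝ) :
    decayFactor γ t ≤ 2 * (1 + t ^ 2)⁻¹ := by
  have hone : (1 : ℝ) ≤ max 1 |t| := le_max_left _ _
  have hsq : |t| ^ 2 ≤ max 1 |t| ^ 2 := by
    gcongr
    exact le_max_right _ _
  refine (decayFactor_le hγ t).trans ?_
  rw [← div_eq_mul_inv, inv_eq_one_div, div_le_div_iff₀ (by positivity) (by positivity), ← sq_abs]
  linarith [one_le_pow₀ (n := 4) hone, pow_le_pow_right₀ hone (show 2 ≤ 4 by norm_num)]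

lemma min_one_rpow_nonneg (δ t : ℝ) : 0 ≤ min 1 (|t| ^ δ) :=
  le_min zero_le_one (Real.rpow_nonneg (abs_nonneg t) _)

lemma min_one_rpow_le_pow_four {δ : ℝ} (hδ : 4 ≤ δ) (t : ℝ) : min 1 (|t| ^ δ) ≤ t ^ 4 := by
  rw [← Even.pow_abs (by decide)]
  rcases le_total |t| 1 with h | h
  · refine (min_le_right _ _).trans ?_
    rw [← Real.rpow_natCast]
    exact Real.rpow_le_rpow_of_exponent_ge_of_imp (abs_nonneg t) h (by exact_mod_cast hδ)
      fun _ hδ0 => by linarith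
  · exact (min_le_left _ _).trans (one_le_pow₀ h)

lemma min_one_rpow_mul_decayFactor_le {δ : ℝ} (hδ : 4 ≤ δ) (hγ : 4 ≤ γ) (t : ℝ) :
    min 1 (|t| ^ δ) * decayFactor γ t ≤ 2 * min (t ^ 4) (1 + t ^ 2)⁻¹ := by
  rw [mul_min_of_nonneg _ _ zero_le_two]
  refine le_min ?_ ?_
  · calc min 1 (|t| ^ δ) * decayFactor γ t ≤ t ^ 4 * 1 :=
          mul_le_mul (min_one_rpow_le_pow_four hδ t) (decayFactor_le_one hγ t)
            (decayFactor_nonneg t) (by positivity)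
      _ ≤ 2 * t ^ 4 := by linarith [show 0 ≤ t ^ 4 by positivity]
  · exact (mul_le_of_le_one_left (decayFactor_nonneg t) (min_le_left _ _)).trans
      (decayFactor_le_inv_one_add_sq hγ t)

lemma DecayConditions.exists_hasFourierDecay {ψ : E3 → ℂ} (hψ : DecayConditions ψ) :
    ∃ K, HasFourierDecay K (𝓕 ψ) := by
  obtain ⟨K, δ, γ, h, hδ, hγ, -, hK, -⟩ := hψ
  have hnonneg := decayFactor_nonneg (γ := γ)
  refine ⟨512 * |K|, fun ξ => ?_⟩
  calc ‖𝓕 ψ ξ‖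
      ≤ K * min 1 (|ξ 0| ^ δ) * decayFactor γ (ξ 0) * decayFactor γ (ξ 1) * decayFactor γ (ξ 2) :=
        hK ξ
    _ = K * ((min 1 (|ξ 0| ^ δ) * decayFactor γ (ξ 0)) *
          (decayFactor γ (ξ 1) * decayFactor γ (ξ 2))) := by ring
    _ ≤ |K| * ((2 * min (ξ 0 ^ 4) (1 + ξ 0 ^ 2)⁻¹) *
          ((16 * ((1 + |ξ 1|) ^ 4)⁻¹) * (16 * ((1 + |ξ 2|) ^ 4)⁻¹))) := by
        have hmin := min_one_rpow_nonneg δ (ξ 0)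
        have : 0 ≤ min (ξ 0 ^ 4) (1 + ξ 0 ^ 2)⁻¹ := by positivity
        refine mul_le_mul (le_abs_self K) ?_ (mul_nonneg (mul_nonneg hmin (hnonneg _))
          (mul_nonneg (hnonneg _) (hnonneg _))) (abs_nonneg K)
        exact mul_le_mul (min_one_rpow_mul_decayFactor_le (by linarith) hγ _)
          (mul_le_mul (decayFactor_le_inv_pow hγ _) (decayFactor_le_inv_pow hγ _) (hnonneg _)
            (by positivity)) (mul_nonneg (hnonneg _) (hnonneg _)) (by positivity)
    _ = _ := by ring

end DecayFactor

/-! ### Hölder continuity of the gradient -/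

/-- `f` is differentiable at the points of `s`, and on `s` its derivative is bounded by `M` and
`a`-Hölder continuous with constant `M`. -/
structure GradHolderOn {E F : Type*} [NormedAddCommGroup E] [NormedSpace ℝ E]
    [NormedAddCommGroup F] [NormedSpace ℝ F] (a M : ℝ) (f : E → F) (s : Set E) : Prop where
  differentiableAt : ∀ x ∈ s, DifferentiableAt ℝ f x
  norm_fderiv_le : ∀ x ∈ s, ‖fderiv ℝ f x‖ ≤ M
  norm_fderiv_sub_le : ∀ x ∈ s, ∀ y ∈ s, ‖fderiv ℝ f x - fderiv ℝ f y‖ ≤ M * ‖x - y‖ ^ a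

namespace GradHolderOn

variable {E F G : Type*} [NormedAddCommGroup E] [NormedSpace ℝ E] [NormedAddCommGroup F]
  [NormedSpace ℝ F] [NormedAddCommGroup G] [NormedSpace ℝ G] {a M N : ℝ} {f g : E → F} {s t : Set E}

lemma continuous (hf : GradHolderOn a M f Set.univ) : Continuous f :=
  continuous_iff_continuousAt.2 fun x => (hf.differentiableAt x trivial).continuousAt

lemma mono (hf : GradHolderOn a M f t) (hst : s ⊆ t) : GradHolderOn a M f s where
  differentiableAt x hx := hf.differentiableAt x (hst hx)
  norm_fderiv_le x hx := hf.norm_fderiv_le x (hst hx)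
  norm_fderiv_sub_le x hx y hy := hf.norm_fderiv_sub_le x (hst hx) y (hst hy)

lemma weaken (hf : GradHolderOn a M f s) (hMN : M ≤ N) : GradHolderOn a N f s where
  differentiableAt := hf.differentiableAt
  norm_fderiv_le x hx := (hf.norm_fderiv_le x hx).trans hMN
  norm_fderiv_sub_le x hx y hy := (hf.norm_fderiv_sub_le x hx y hy).trans (by gcongr)

lemma congr (hs : IsOpen s) (hf : GradHolderOn a M f s) (hfg : Set.EqOn g f s) :
    GradHolderOn a M g s := by
  have heq : ∀ x ∈ s, g =ᶠ[𝓝 x] f := fun x hx => hfg.eventuallyEq_of_mem (hs.mem_nhds hx)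
  refine ⟨fun x hx => (hf.differentiableAt x hx).congr_of_eventuallyEq (heq x hx), fun x hx => ?_,
    fun x hx y hy => ?_⟩
  · rw [(heq x hx).fderiv_eq]
    exact hf.norm_fderiv_le x hx
  · rw [(heq x hx).fderiv_eq, (heq y hy).fderiv_eq]
    exact hf.norm_fderiv_sub_le x hx y hy

lemma sub (hf : GradHolderOn a M f s) (hg : GradHolderOn a N g s) :
    GradHolderOn a (M + N) (fun x => f x - g x) s := by
  have hfderiv : ∀ x ∈ s, fderiv ℝ (fun x => f x - g x) x = fderiv ℝ f x - fderiv ℝ g x :=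
    fun x hx => fderiv_fun_sub (hf.differentiableAt x hx) (hg.differentiableAt x hx)
  refine ⟨fun x hx => (hf.differentiableAt x hx).sub (hg.differentiableAt x hx), fun x hx => ?_,
    fun x hx y hy => ?_⟩
  · rw [hfderiv x hx]
    exact (norm_sub_le _ _).trans (add_le_add (hf.norm_fderiv_le x hx) (hg.norm_fderiv_le x hx))
  · rw [hfderiv x hx, hfderiv y hy, sub_sub_sub_comm, add_mul]
    exact (norm_sub_le _ _).trans
      (add_le_add (hf.norm_fderiv_sub_le x hx y hy) (hg.norm_fderiv_sub_le x hx y hy))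

lemma norm_sub_le (hs : Convex ℝ s) (hf : GradHolderOn a M f s) {x y : E} (hx : x ∈ s)
    (hy : y ∈ s) : ‖f x - f y‖ ≤ M * ‖x - y‖ :=
  hs.norm_image_sub_le_of_norm_fderiv_le hf.differentiableAt hf.norm_fderiv_le hy hx

lemma norm_clm_comp_sub_comp_le (L L' : F →L[ℝ] G) (A A' : E →L[ℝ] F) :
    ‖L.comp A - L'.comp A'‖ ≤ ‖L‖ * ‖A - A'‖ + ‖L - L'‖ * ‖A'‖ := by
  have hsplit : L.comp A - L'.comp A' = L.comp (A - A') + (L - L').comp A' := by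
    rw [ContinuousLinearMap.comp_sub, ContinuousLinearMap.sub_comp]
    abel
  rw [hsplit]
  exact (norm_add_le _ _).trans (add_le_add (ContinuousLinearMap.opNorm_comp_le _ _)
    (ContinuousLinearMap.opNorm_comp_le _ _))

lemma comp {g : F → G} {Φ : E → F} {u : Set F} (ha : 0 ≤ a) (hs : Convex ℝ s)
    (hg : GradHolderOn a M g u) (hΦ : GradHolderOn a N Φ s) (hmaps : Set.MapsTo Φ s u) :
    GradHolderOn a (M * N + M * N ^ a * N) (fun x => g (Φ x)) s := by
  have hfderiv : ∀ x ∈ s, fderiv ℝ (fun x => g (Φ x)) x =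
      (fderiv ℝ g (Φ x)).comp (fderiv ℝ Φ x) := fun x hx =>
    fderiv_comp x (hg.differentiableAt _ (hmaps hx)) (hΦ.differentiableAt x hx)
  have hM : ∀ x ∈ s, 0 ≤ M := fun x hx => (norm_nonneg _).trans (hg.norm_fderiv_le _ (hmaps hx))
  have hN : ∀ x ∈ s, 0 ≤ N := fun x hx => (norm_nonneg _).trans (hΦ.norm_fderiv_le x hx)
  refine ⟨fun x hx => (hg.differentiableAt _ (hmaps hx)).comp x (hΦ.differentiableAt x hx),
    fun x hx => ?_, fun x hx y hy => ?_⟩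
  · have := hM x hx
    have := hN x hx
    rw [hfderiv x hx]
    calc _ ≤ ‖fderiv ℝ g (Φ x)‖ * ‖fderiv ℝ Φ x‖ := ContinuousLinearMap.opNorm_comp_le _ _
      _ ≤ M * N := mul_le_mul (hg.norm_fderiv_le _ (hmaps hx)) (hΦ.norm_fderiv_le x hx)
          (norm_nonneg _) (hM x hx)
      _ ≤ _ := le_add_of_nonneg_right (by positivity)
  · have := hM x hx
    have := hN x hx
    have hgΦ : ‖fderiv ℝ g (Φ x) - fderiv ℝ g (Φ y)‖ ≤ M * (N * ‖x - y‖) ^ a :=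
      (hg.norm_fderiv_sub_le _ (hmaps hx) _ (hmaps hy)).trans
        (by gcongr; exact hΦ.norm_sub_le hs hx hy)
    rw [hfderiv x hx, hfderiv y hy]
    calc _ ≤ ‖fderiv ℝ g (Φ x)‖ * ‖fderiv ℝ Φ x - fderiv ℝ Φ y‖ +
          ‖fderiv ℝ g (Φ x) - fderiv ℝ g (Φ y)‖ * ‖fderiv ℝ Φ y‖ :=
          norm_clm_comp_sub_comp_le _ _ _ _
      _ ≤ M * (N * ‖x - y‖ ^ a) + M * (N * ‖x - y‖) ^ a * N := by
          gcongr
          · exact hg.norm_fderiv_le _ (hmaps hx)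
          · exact hΦ.norm_fderiv_sub_le x hx y hy
          · exact hΦ.norm_fderiv_le y hy
      _ = _ := by
          rw [Real.mul_rpow (hN x hx) (norm_nonneg _)]
          ring

end GradHolderOn

/-- On pairs at distance more than `1` the Hölder bound is the bound on the derivative. -/
lemma exists_gradHolderOn_of_contDiffOn {E F : Type*} [NormedAddCommGroup E] [NormedSpace ℝ E]
    [NormedAddCommGroup F] [NormedSpace ℝ F] {f : E → F} {U Q : Set E} {a : ℝ} (ha0 : 0 ≤ a)
    (ha1 : a ≤ 1) (hU : IsOpen U) (hf : ContDiffOn ℝ 2 f U) (hQ : IsCompact Q)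
    (hconv : Convex ℝ Q) (hQU : Q ⊆ U) : ∃ M, GradHolderOn a M f Q := by
  have hf1 : ContDiffOn ℝ 1 (fderiv ℝ f) U := hf.fderiv_of_isOpen hU (by norm_num)
  obtain ⟨M₁, hM₁⟩ := hQ.exists_bound_of_continuousOn (hf1.continuousOn.mono hQU)
  obtain ⟨M₂, hM₂⟩ := hQ.exists_bound_of_continuousOn (E := E →L[ℝ] E →L[ℝ] F)
    ((hf1.continuousOn_fderiv_of_isOpen hU le_rfl).mono hQU)
  refine ⟨2 * M₁ + M₂, fun x hx => (hf.differentiableOn two_ne_zero).differentiableAt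
    (hU.mem_nhds (hQU hx)), fun x hx => ?_, fun x hx y hy => ?_⟩
  all_goals
    have hM₁0 : 0 ≤ M₁ := (norm_nonneg _).trans (hM₁ x hx)
    have hM₂0 : 0 ≤ M₂ := (norm_nonneg _).trans (hM₂ x hx)
  · linarith [hM₁ x hx]
  · rcases le_total ‖x - y‖ 1 with hxy | hxy
    · calc ‖fderiv ℝ f x - fderiv ℝ f y‖ ≤ M₂ * ‖x - y‖ :=
            hconv.norm_image_sub_le_of_norm_fderiv_le (fun z hz =>
              (hf1.differentiableOn one_ne_zero).differentiableAt (hU.mem_nhds (hQU hz)))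
              hM₂ hy hx
        _ ≤ (2 * M₁ + M₂) * ‖x - y‖ ^ a := by
            gcongr
            · linarith
            · exact Real.self_le_rpow_of_le_one (norm_nonneg _) hxy ha1
    · calc ‖fderiv ℝ f x - fderiv ℝ f y‖ ≤ 2 * M₁ := by
            linarith [norm_sub_le (fderiv ℝ f x) (fderiv ℝ f y), hM₁ x hx, hM₁ y hy]
        _ ≤ 2 * M₁ + M₂ := le_add_of_nonneg_right hM₂0
        _ ≤ (2 * M₁ + M₂) * ‖x - y‖ ^ a :=
            le_mul_of_one_le_right (by positivity) (Real.one_le_rpow hxy ha0)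

lemma natCast_mul_le_natCast_mul_mul (n : ℕ) {c : ℝ} (hc : 0 ≤ c) : n * c ≤ n * (n * c) := by
  rcases Nat.eq_zero_or_pos n with rfl | hn
  · simp
  · exact mul_le_mul_of_nonneg_left (le_mul_of_one_le_left hc (by exact_mod_cast hn))
      n.cast_nonneg

lemma natFloor_eq_one {β : ℝ} (h1 : 1 ≤ β) (h2 : β < 2) : ⌊β⌋₊ = 1 := by
  rw [Nat.floor_eq_iff (by linarith)]
  norm_num
  exact ⟨h1, h2⟩

section Holder

variable {n : ℕ} {F : Type*} [NormedAddCommGroup F] [NormedSpace ℝ F]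
  {f : EuclideanSpace ℝ (Fin n) → F} {β c : ℝ}

lemma opNorm_le_of_forall_single {L : EuclideanSpace ℝ (Fin n) →L[ℝ] F} (hc : 0 ≤ c)
    (hL : ∀ l, ‖L (EuclideanSpace.single l (1 : ℝ))‖ ≤ c) : ‖L‖ ≤ n * c := by
  refine L.opNorm_le_bound (by positivity) fun x => ?_
  have hx : x = ∑ l, x l • EuclideanSpace.single l (1 : ℝ) := by
    ext k
    simp [Finset.sum_apply, Pi.single_apply]
  calc ‖L x‖ = ‖∑ l, x l • L (EuclideanSpace.single l (1 : ℝ))‖ := by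
        conv_lhs => rw [hx]
        simp only [map_sum, map_smul]
    _ ≤ ∑ _l : Fin n, ‖x‖ * c := by
        refine (norm_sum_le _ _).trans (Finset.sum_le_sum fun l _ => ?_)
        rw [norm_smul]
        exact mul_le_mul (PiLp.norm_apply_le x l) (hL l) (norm_nonneg _) (norm_nonneg _)
    _ = n * c * ‖x‖ := by
        rw [Finset.sum_const, Finset.card_univ, Fintype.card_fin, nsmul_eq_mul]
        ring

lemma norm_partialDeriv_sub_le {m : ℕ} (hm : ⌊β⌋₊ = m) (hc : 0 ≤ c)
    (hf : holderSeminorm β f ≤ ENNReal.ofReal c) (i : Fin m → Fin n)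
    (x y : EuclideanSpace ℝ (Fin n)) :
    ‖partialDeriv i f x - partialDeriv i f y‖ ≤ c * ‖x - y‖ ^ (β - m) := by
  subst hm
  rcases eq_or_ne x y with rfl | hxy
  · simp only [sub_self, norm_zero]
    positivity
  have hquot : ‖partialDeriv i f x - partialDeriv i f y‖ₑ / ‖x - y‖ₑ ^ (β - (⌊β⌋₊ : ℝ)) ≤
      ENNReal.ofReal c := by
    simp only [holderSeminorm, iSup_le_iff] at hf
    exact hf i x y
  have hpos : 0 < ‖x - y‖ := norm_sub_pos_iff.2 hxy
  have hden : 0 < ‖x - y‖ ^ (β - (⌊β⌋₊ : ℝ)) := Real.rpow_pos_of_pos hpos _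
  rwa [← ofReal_norm (x - y), ENNReal.ofReal_rpow_of_pos hpos,
    ENNReal.div_le_iff (by simpa using hden) ENNReal.ofReal_ne_top, ← ENNReal.ofReal_mul hc,
    ← ofReal_norm, ENNReal.ofReal_le_ofReal_iff (by positivity)] at hquot

lemma norm_partialDeriv_le {m : ℕ} (hm : m ≤ ⌊β⌋₊) (hc : 0 ≤ c)
    (hf : holderNorm β f ≤ ENNReal.ofReal c) (i : Fin m → Fin n)
    (x : EuclideanSpace ℝ (Fin n)) : ‖partialDeriv i f x‖ ≤ c := by
  have hsup : ‖partialDeriv i f x‖ₑ ≤ ENNReal.ofReal c := by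
    refine le_trans ?_ (le_self_add.trans hf)
    exact le_iSup_of_le m (le_iSup_of_le hm (le_iSup_of_le i (le_iSup_of_le x le_rfl)))
  rwa [← ofReal_norm, ENNReal.ofReal_le_ofReal_iff hc] at hsup

lemma partialDeriv_one (l : Fin n) (f : EuclideanSpace ℝ (Fin n) → F)
    (x : EuclideanSpace ℝ (Fin n)) :
    partialDeriv (fun _ : Fin 1 => l) f x = fderiv ℝ f x (EuclideanSpace.single l (1 : ℝ)) := by
  simp [partialDeriv, iteratedFDeriv_one_apply]

lemma partialDeriv_two (l l' : Fin n) (f : EuclideanSpace ℝ (Fin n) → F)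
    (x : EuclideanSpace ℝ (Fin n)) :
    partialDeriv ![l, l'] f x = fderiv ℝ (fderiv ℝ f) x (EuclideanSpace.single l (1 : ℝ))
      (EuclideanSpace.single l' (1 : ℝ)) := by
  simp [partialDeriv, iteratedFDeriv_two_apply]

lemma differentiable_fderiv_of_contDiff_two (hf : ContDiff ℝ 2 f) :
    Differentiable ℝ (fderiv ℝ f) :=
  (hf.fderiv_right (m := 1) (by norm_num)).differentiable one_ne_zero

lemma norm_fderiv_sub_le_of_partialDeriv_two (hc : 0 ≤ c) (hf : ContDiff ℝ 2 f)
    (hbound : ∀ l l' x, ‖partialDeriv ![l, l'] f x‖ ≤ c) (x y : EuclideanSpace ℝ (Fin n)) :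
    ‖fderiv ℝ f x - fderiv ℝ f y‖ ≤ n * (n * c) * ‖x - y‖ := by
  refine convex_univ.norm_image_sub_le_of_norm_fderiv_le
    (fun z _ => differentiable_fderiv_of_contDiff_two hf z) (fun z _ => ?_) trivial trivial
  refine opNorm_le_of_forall_single (by positivity) fun l =>
    opNorm_le_of_forall_single hc fun l' => ?_
  rw [← partialDeriv_two]
  exact hbound l l' z

/-- For `β = 2` the seminorm has exponent `0` and only bounds the oscillation of the second
derivatives, so their size has to be supplied. -/
lemma norm_fderiv_sub_le_of_holderSeminorm (h1 : 1 < β) (h2 : β ≤ 2) (hc : 0 ≤ c)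
    (hf : ContDiff ℝ ⌊β⌋₊ f) (hseminorm : holderSeminorm β f ≤ ENNReal.ofReal c)
    (htwo : β = 2 → ∀ l l' x, ‖partialDeriv ![l, l'] f x‖ ≤ c) (x y : EuclideanSpace ℝ (Fin n)) :
    ‖fderiv ℝ f x - fderiv ℝ f y‖ ≤ n * (n * c) * ‖x - y‖ ^ (β - 1) := by
  rcases h2.lt_or_eq with h2 | rfl
  · calc ‖fderiv ℝ f x - fderiv ℝ f y‖ ≤ n * (c * ‖x - y‖ ^ (β - 1)) := by
          refine opNorm_le_of_forall_single (by positivity) fun l => ?_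
          rw [_root_.sub_apply, ← partialDeriv_one, ← partialDeriv_one]
          simpa using norm_partialDeriv_sub_le (natFloor_eq_one h1.le h2) hc hseminorm
            (fun _ => l) x y
      _ ≤ n * (n * c) * ‖x - y‖ ^ (β - 1) := by
          rw [← mul_assoc]
          exact mul_le_mul_of_nonneg_right (natCast_mul_le_natCast_mul_mul n hc) (by positivity)
  · rw [Nat.floor_ofNat] at hf
    rw [show (2 : ℝ) - 1 = 1 by norm_num, Real.rpow_one]
    exact norm_fderiv_sub_le_of_partialDeriv_two hc (by exact_mod_cast hf) (htwo rfl) x y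

lemma norm_le_of_holderNorm_le (hc : 0 ≤ c) (hf : holderNorm β f ≤ ENNReal.ofReal c)
    (x : EuclideanSpace ℝ (Fin n)) : ‖f x‖ ≤ c := by
  simpa [partialDeriv] using norm_partialDeriv_le (Nat.zero_le _) hc hf Fin.elim0 x

lemma gradHolderOn_univ_of_holderNorm_le (h1 : 1 < β) (h2 : β ≤ 2) (hc : 0 ≤ c)
    (hf : ContDiff ℝ ⌊β⌋₊ f) (hnorm : holderNorm β f ≤ ENNReal.ofReal c) :
    GradHolderOn (β - 1) (n * (n * c)) f Set.univ := by
  have hfloor : 1 ≤ ⌊β⌋₊ := (Nat.one_le_floor_iff β).2 h1.le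
  have hf1 : ContDiff ℝ 1 f := hf.of_le (by exact_mod_cast hfloor)
  refine ⟨fun x _ => hf1.differentiable one_ne_zero x, fun x _ => ?_, fun x _ y _ => ?_⟩
  · refine (opNorm_le_of_forall_single hc fun l => ?_).trans (natCast_mul_le_natCast_mul_mul n hc)
    rw [← partialDeriv_one]
    exact norm_partialDeriv_le hfloor hc hnorm _ x
  · refine norm_fderiv_sub_le_of_holderSeminorm h1 h2 hc hf (le_add_self.trans hnorm) ?_ x y
    rintro rfl l l' z
    exact norm_partialDeriv_le (Nat.floor_ofNat 2).ge hc hnorm _ z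

end Holder

section Periodic

variable {n : ℕ} {f : EuclideanSpace ℝ (Fin n) → ℝ} {P c : ℝ}

lemma exists_fderiv_add_smul_eq_zero {E : Type*} [NormedAddCommGroup E] [NormedSpace ℝ E]
    {f : E → ℝ} (hP : 0 < P) (hf : Differentiable ℝ f) (x e : E) (hper : f (x + P • e) = f x) :
    ∃ t, 0 < t ∧ t < P ∧ fderiv ℝ f (x + t • e) e = 0 := by
  have hderiv : ∀ t : ℝ, HasDerivAt (fun t : ℝ => f (x + t • e)) (fderiv ℝ f (x + t • e) e) t :=
    fun t => (hf (x + t • e)).hasFDerivAt.comp_hasDerivAt t (by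
      simpa using ((hasDerivAt_id t).smul_const e).const_add x)
  obtain ⟨t, ht, hzero⟩ := exists_hasDerivAt_eq_zero hP
    (continuous_iff_continuousAt.2 fun t => (hderiv t).continuousAt).continuousOn
    (by simpa using hper.symm) (fun t _ => hderiv t)
  exact ⟨t, ht.1, ht.2, hzero⟩

lemma norm_partialDeriv_two_le_of_periodic (hP : 0 < P) (hc : 0 ≤ c) (hf : ContDiff ℝ 2 f)
    (hseminorm : holderSeminorm 2 f ≤ ENNReal.ofReal c)
    (hper : ∀ x l, f (x + P • EuclideanSpace.single l (1 : ℝ)) = f x) (l l' : Fin n)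
    (x : EuclideanSpace ℝ (Fin n)) : ‖partialDeriv ![l, l'] f x‖ ≤ c := by
  have hdiff := differentiable_fderiv_of_contDiff_two hf
  have hper_fderiv : fderiv ℝ f (x + P • EuclideanSpace.single l (1 : ℝ)) = fderiv ℝ f x := by
    rw [← fderiv_comp_add_right]
    simp_rw [hper]
  obtain ⟨t, -, -, ht⟩ := exists_fderiv_add_smul_eq_zero hP
    (f := fun x => fderiv ℝ f x (EuclideanSpace.single l' (1 : ℝ)))
    (fun z => (hdiff z).clm_apply (differentiableAt_const _)) x
    (EuclideanSpace.single l (1 : ℝ)) (by rw [hper_fderiv])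
  have hzero : partialDeriv ![l, l'] f (x + t • EuclideanSpace.single l (1 : ℝ)) = 0 := by
    rw [partialDeriv_two]
    simpa [fderiv_clm_apply (hdiff _) (differentiableAt_const _)] using ht
  have hosc := norm_partialDeriv_sub_le (Nat.floor_ofNat 2) hc hseminorm ![l, l'] x
    (x + t • EuclideanSpace.single l (1 : ℝ))
  simpa [hzero] using hosc

lemma norm_fderiv_le_of_periodic {a : ℝ} (ha : 0 ≤ a) (hP : 0 < P) (hc : 0 ≤ c)
    (hf : Differentiable ℝ f)
    (hholder : ∀ x y, ‖fderiv ℝ f x - fderiv ℝ f y‖ ≤ c * ‖x - y‖ ^ a)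
    (hper : ∀ x l, f (x + P • EuclideanSpace.single l (1 : ℝ)) = f x)
    (x : EuclideanSpace ℝ (Fin n)) : ‖fderiv ℝ f x‖ ≤ n * (c * P ^ a) := by
  refine opNorm_le_of_forall_single (by positivity) fun l => ?_
  set e : EuclideanSpace ℝ (Fin n) := EuclideanSpace.single l 1
  have he : ‖e‖ = 1 := by simp [e]
  obtain ⟨t, ht0, htP, ht⟩ := exists_fderiv_add_smul_eq_zero hP hf x e (hper x l)
  have hdist : ‖x - (x + t • e)‖ ≤ P := by
    rw [sub_add_cancel_left, norm_neg, norm_smul, he, mul_one, Real.norm_of_nonneg ht0.le]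
    exact htP.le
  calc ‖fderiv ℝ f x e‖ = ‖(fderiv ℝ f x - fderiv ℝ f (x + t • e)) e‖ := by
        rw [_root_.sub_apply, ht, sub_zero]
    _ ≤ ‖fderiv ℝ f x - fderiv ℝ f (x + t • e)‖ := by
        simpa [he] using (fderiv ℝ f x - fderiv ℝ f (x + t • e)).le_opNorm e
    _ ≤ c * ‖x - (x + t • e)‖ ^ a := hholder _ _
    _ ≤ c * P ^ a := by gcongr

lemma gradHolderOn_univ_of_periodic {α : ℝ} (h1 : 1 < α) (h2 : α ≤ 2) (hc : 0 ≤ c) (hP : 0 < P)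
    (hf : ContDiff ℝ ⌊α⌋₊ f) (hseminorm : holderSeminorm α f ≤ ENNReal.ofReal c)
    (hper : ∀ x l, f (x + P • EuclideanSpace.single l (1 : ℝ)) = f x) :
    GradHolderOn (α - 1) (n * (n * c) * (1 + n * P ^ (α - 1))) f Set.univ := by
  have hfloor : 1 ≤ ⌊α⌋₊ := (Nat.one_le_floor_iff α).2 h1.le
  have hf1 : ContDiff ℝ 1 f := hf.of_le (by exact_mod_cast hfloor)
  have hM : 0 ≤ n * (n * c) := by positivity
  have hholder : ∀ x y, ‖fderiv ℝ f x - fderiv ℝ f y‖ ≤ n * (n * c) * ‖x - y‖ ^ (α - 1) := by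
    refine norm_fderiv_sub_le_of_holderSeminorm h1 h2 hc hf hseminorm ?_
    rintro rfl
    rw [Nat.floor_ofNat] at hf
    exact norm_partialDeriv_two_le_of_periodic hP hc (by exact_mod_cast hf) hseminorm hper
  refine ⟨fun x _ => hf1.differentiable one_ne_zero x, fun x _ => ?_,
    fun x _ y _ => (hholder x y).trans ?_⟩
  · refine (norm_fderiv_le_of_periodic (by linarith) hP hM (hf1.differentiable one_ne_zero)
      hholder hper x).trans ?_
    linarith
  · exact mul_le_mul_of_nonneg_right
      (le_mul_of_one_le_right hM (le_add_of_nonneg_right (by positivity))) (by positivity)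

end Periodic

/-! ### The radial function of a star-shaped body -/

/-- The spherical angles of a point with positive first coordinate, that is, away from the poles of
the spherical coordinates. -/
noncomputable def sphericalAngles (z : E3) : EuclideanSpace ℝ (Fin 2) :=
  !₂[Real.arctan (z 1 / z 0), Real.arccos (z 2 / ‖z‖)]

lemma norm_sq_eq_sum_three (z : E3) : ‖z‖ ^ 2 = z 0 ^ 2 + z 1 ^ 2 + z 2 ^ 2 := by
  simp [EuclideanSpace.norm_sq_eq, Fin.sum_univ_three]

lemma ne_zero_of_apply_zero_pos {z : E3} (hz : 0 < z 0) : z ≠ 0 := by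
  rintro rfl
  simp at hz

lemma isOpen_apply_zero_pos : IsOpen {z : E3 | 0 < z 0} :=
  isOpen_lt continuous_const (by fun_prop)

lemma cos_sin_arctan_div {x : ℝ} (hx : 0 < x) (y : ℝ) :
    Real.cos (Real.arctan (y / x)) = x / √(x ^ 2 + y ^ 2) ∧
      Real.sin (Real.arctan (y / x)) = y / √(x ^ 2 + y ^ 2) := by
  have hsq : √(x ^ 2 + y ^ 2) ^ 2 = x ^ 2 + y ^ 2 := Real.sq_sqrt (by positivity)
  have : 0 < √(x ^ 2 + y ^ 2) := Real.sqrt_pos.2 (by positivity)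
  have hsqrt : √(1 + (y / x) ^ 2) = √(x ^ 2 + y ^ 2) / x := by
    rw [Real.sqrt_eq_iff_mul_self_eq (by positivity) (by positivity)]
    field_simp
    exact hsq.symm
  rw [Real.cos_arctan, Real.sin_arctan, hsqrt]
  constructor <;> field_simp

lemma cos_sin_arccos_div {x y n : ℝ} (hn : 0 < n) (hx : 0 ≤ x) (hxy : n ^ 2 = x ^ 2 + y ^ 2) :
    Real.cos (Real.arccos (y / n)) = y / n ∧ Real.sin (Real.arccos (y / n)) = x / n := by
  have hle : |y / n| ≤ 1 := by
    rw [abs_div, abs_of_pos hn, div_le_one hn]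
    exact abs_le_of_sq_le_sq (by linarith [sq_nonneg x]) hn.le
  refine ⟨Real.cos_arccos (abs_le.1 hle).1 (abs_le.1 hle).2, ?_⟩
  rw [Real.sin_arccos, show 1 - (y / n) ^ 2 = (x / n) ^ 2 by field_simp; linarith,
    Real.sqrt_sq (by positivity)]

lemma sphericalDir_sphericalAngles {z : E3} (hz : 0 < z 0) :
    sphericalDir (sphericalAngles z) = ‖z‖⁻¹ • z := by
  have hpos : 0 < ‖z‖ := norm_pos_iff.2 (ne_zero_of_apply_zero_pos hz)
  have hw : 0 < √(z 0 ^ 2 + z 1 ^ 2) := Real.sqrt_pos.2 (by positivity)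
  obtain ⟨hcos, hsin⟩ := cos_sin_arctan_div hz (z 1)
  obtain ⟨hcos', hsin'⟩ := cos_sin_arccos_div (y := z 2) hpos hw.le (by
    rw [Real.sq_sqrt (by positivity), norm_sq_eq_sum_three])
  ext l
  fin_cases l
  · change Real.cos (Real.arctan (z 1 / z 0)) * Real.sin (Real.arccos (z 2 / ‖z‖)) = ‖z‖⁻¹ * z 0
    rw [hcos, hsin']
    field_simp
  · change Real.sin (Real.arctan (z 1 / z 0)) * Real.sin (Real.arccos (z 2 / ‖z‖)) = ‖z‖⁻¹ * z 1
    rw [hsin, hsin']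
    field_simp
  · change Real.cos (Real.arccos (z 2 / ‖z‖)) = ‖z‖⁻¹ * z 2
    rw [hcos']
    field_simp

lemma contDiffOn_sphericalAngles : ContDiffOn ℝ 2 sphericalAngles {z : E3 | 0 < z 0} := by
  intro z (hz : 0 < z 0)
  have hz0 := ne_zero_of_apply_zero_pos hz
  have hpos : 0 < ‖z‖ := norm_pos_iff.2 hz0
  have hcoord : ∀ l : Fin 3, ContDiffAt ℝ 2 (fun z : E3 => z l) z := fun l =>
    (EuclideanSpace.proj (𝕜 := ℝ) l).contDiff.contDiffAt
  have hlt : (z 2 / ‖z‖) ^ 2 < 1 := by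
    rw [div_pow, div_lt_one (by positivity), norm_sq_eq_sum_three]
    linarith [sq_nonneg (z 1), pow_pos hz 2]
  have hlt' := abs_lt.1 ((sq_lt_one_iff_abs_lt_one _).1 hlt)
  refine (contDiffAt_euclidean.2 fun l => ?_).contDiffWithinAt
  fin_cases l
  · change ContDiffAt ℝ 2 (fun z : E3 => Real.arctan (z 1 / z 0)) z
    exact Real.contDiff_arctan.contDiffAt.comp z ((hcoord 1).div (hcoord 0) hz.ne')
  · change ContDiffAt ℝ 2 (fun z : E3 => Real.arccos (z 2 / ‖z‖)) z
    exact (Real.contDiffAt_arccos hlt'.1.ne' hlt'.2.ne).comp (g := Real.arccos) z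
      ((hcoord 2).div (contDiffAt_norm ℝ hz0) hpos.ne')

lemma sphericalDir_periodic (θ : EuclideanSpace ℝ (Fin 2)) (l : Fin 2) :
    sphericalDir (θ + (2 * Real.pi) • EuclideanSpace.single l (1 : ℝ)) = sphericalDir θ := by
  fin_cases l <;> simp [sphericalDir]

/-- The compact convex region of points with first coordinate at least `r / 2` and norm at most `2`,
on which the spherical angles are smooth. -/
def chartRegion (r : ℝ) : Set E3 := {z | r / 2 ≤ z 0} ∩ Metric.closedBall 0 2

lemma isCompact_chartRegion (r : ℝ) : IsCompact (chartRegion r) :=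
  (isCompact_closedBall 0 2).inter_left (isClosed_le continuous_const (by fun_prop))

lemma convex_chartRegion (r : ℝ) : Convex ℝ (chartRegion r) :=
  (convex_halfSpace_ge (f := fun z : E3 => z 0) ⟨fun _ _ => rfl, fun _ _ => rfl⟩ (r / 2)).inter
    (convex_closedBall 0 2)

lemma apply_zero_pos_of_mem_chartRegion {r : ℝ} (hr : 0 < r) {z : E3} (hz : z ∈ chartRegion r) :
    0 < z 0 :=
  (half_pos hr).trans_le hz.1

lemma exists_gradHolderOn_chartRegion {r a : ℝ} (hr : 0 < r) (ha0 : 0 ≤ a) (ha1 : a ≤ 1) (M : ℝ) :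
    ∃ N, ∀ g : EuclideanSpace ℝ (Fin 2) → ℝ, GradHolderOn a M g Set.univ →
      GradHolderOn a N (fun z => g (sphericalAngles z) - ‖z‖) (chartRegion r) := by
  have hsubset : chartRegion r ⊆ {z | 0 < z 0} := fun z => apply_zero_pos_of_mem_chartRegion hr
  have hnorm : ContDiffOn ℝ 2 (fun z : E3 => ‖z‖) {z | 0 < z 0} := fun z hz =>
    (contDiffAt_norm ℝ (ne_zero_of_apply_zero_pos hz)).contDiffWithinAt
  obtain ⟨N, hN⟩ := exists_gradHolderOn_of_contDiffOn ha0 ha1 isOpen_apply_zero_pos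
    contDiffOn_sphericalAngles (isCompact_chartRegion r) (convex_chartRegion r) hsubset
  obtain ⟨N', hN'⟩ := exists_gradHolderOn_of_contDiffOn ha0 ha1 isOpen_apply_zero_pos
    hnorm (isCompact_chartRegion r) (convex_chartRegion r) hsubset
  exact ⟨_, fun g hg =>
    (hg.comp ha0 (convex_chartRegion r) hN (Set.mapsTo_univ _ _)).sub hN'⟩

/-- The radius function in the direction of `x`, minus the distance of `x` to the centre `x₀`: it is
nonnegative on the star-shaped body and negative outside. At `x = x₀` the direction is the junk
value `0`. -/
noncomputable def radialDefect (x₀ : E3) (ρ : E3 → ℝ) (x : E3) : ℝ :=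
  ρ (‖x - x₀‖⁻¹ • (x - x₀)) - ‖x - x₀‖

lemma exists_isometry_symm_eq_single_zero {n : ℕ} (w : EuclideanSpace ℝ (Fin (n + 1))) :
    ∃ O : EuclideanSpace ℝ (Fin (n + 1)) ≃ₗᵢ[ℝ] EuclideanSpace ℝ (Fin (n + 1)),
      O.symm w = ‖w‖ • EuclideanSpace.single 0 (1 : ℝ) := by
  set e : EuclideanSpace ℝ (Fin (n + 1)) := ‖w‖ • EuclideanSpace.single 0 (1 : ℝ) with he
  have hnorm : ‖e‖ = ‖w‖ := by simp [he, norm_smul]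
  refine ⟨((ℝ ∙ (e - w))ᗮ).reflection, ?_⟩
  rw [LinearIsometryEquiv.symm_apply_eq]
  exact (Submodule.reflection_sub hnorm).symm

section RadialDefect

variable {x₀ x w : E3} {ρ : E3 → ℝ}

lemma mem_starBody_iff (hx : x ≠ x₀) : x ∈ starBody x₀ ρ ↔ 0 ≤ radialDefect x₀ ρ x := by
  have hw : x - x₀ ≠ 0 := sub_ne_zero.2 hx
  constructor
  · rintro ⟨u, hu, t, ht0, htρ, rfl⟩
    rw [add_sub_cancel_left] at hw
    have ht : t ≠ 0 := left_ne_zero_of_smul hw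
    rw [radialDefect, add_sub_cancel_left, norm_smul, hu, mul_one, Real.norm_of_nonneg ht0,
      smul_smul, inv_mul_cancel₀ ht, one_smul]
    linarith
  · intro hdefect
    refine ⟨‖x - x₀‖⁻¹ • (x - x₀), norm_smul_inv_norm (𝕜 := ℝ) hw, ‖x - x₀‖, norm_nonneg _,
      sub_nonneg.1 hdefect, ?_⟩
    rw [smul_smul, mul_inv_cancel₀ (norm_ne_zero_iff.2 hw), one_smul, add_sub_cancel]

lemma radialDefect_eq_chart (O : E3 ≃ₗᵢ[ℝ] E3) (hx : 0 < O.symm (x - x₀) 0) :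
    radialDefect x₀ ρ x =
      ρ (O (sphericalDir (sphericalAngles (O.symm (x - x₀))))) - ‖O.symm (x - x₀)‖ := by
  rw [sphericalDir_sphericalAngles hx, radialDefect, map_smul, LinearIsometryEquiv.apply_symm_apply,
    LinearIsometryEquiv.norm_map]

lemma radialDefect_add_smul {t : ℝ} (ht : 0 < t) (w : E3) :
    radialDefect x₀ ρ (x₀ + t • w) = ρ (‖w‖⁻¹ • w) - t * ‖w‖ := by
  rw [radialDefect, add_sub_cancel_left, norm_smul, Real.norm_of_nonneg ht.le, smul_smul, mul_inv,
    mul_right_comm, inv_mul_cancel₀ ht.ne', one_mul]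

end RadialDefect

section Frontier

variable {x₀ x : E3} {ρ : E3 → ℝ} {r : ℝ}

lemma mem_starBody_of_norm_sub_le (hr : 0 < r) (hρ : ∀ u, ‖u‖ = 1 → r ≤ ρ u)
    (hx : ‖x - x₀‖ ≤ r) : x ∈ starBody x₀ ρ := by
  rcases eq_or_ne x x₀ with rfl | hne
  · have hunit : ‖(EuclideanSpace.single 0 (1 : ℝ) : E3)‖ = 1 := by simp
    exact ⟨_, hunit, 0, le_rfl, hr.le.trans (hρ _ hunit), by simp⟩
  · rw [mem_starBody_iff hne, radialDefect]
    have hunit : ‖‖x - x₀‖⁻¹ • (x - x₀)‖ = 1 := norm_smul_inv_norm (𝕜 := ℝ) (sub_ne_zero.2 hne)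
    linarith [hρ _ hunit]

lemma starBody_mem_nhds_center (hr : 0 < r) (hρ : ∀ u, ‖u‖ = 1 → r ≤ ρ u) :
    starBody x₀ ρ ∈ 𝓝 x₀ := by
  filter_upwards [Metric.closedBall_mem_nhds x₀ hr] with y hy
  exact mem_starBody_of_norm_sub_le hr hρ (by simpa [dist_eq_norm] using hy)

lemma differentiableAt_radialDefect
    (hdiff : ∀ O : E3 ≃ₗᵢ[ℝ] E3, Differentiable ℝ (fun θ => ρ (O (sphericalDir θ))))
    (hx : x ≠ x₀) : DifferentiableAt ℝ (radialDefect x₀ ρ) x := by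
  obtain ⟨O, hO⟩ := exists_isometry_symm_eq_single_zero (x - x₀)
  have hpos : 0 < O.symm (x - x₀) 0 := by
    rw [hO]
    simpa using sub_ne_zero.2 hx
  have hangles : DifferentiableAt ℝ sphericalAngles (O.symm (x - x₀)) :=
    (contDiffOn_sphericalAngles.differentiableOn two_ne_zero).differentiableAt
      (isOpen_apply_zero_pos.mem_nhds hpos)
  have hnorm : DifferentiableAt ℝ (fun z : E3 => ‖z‖) (O.symm (x - x₀)) :=
    differentiableAt_id.norm ℝ (ne_zero_of_apply_zero_pos hpos)
  have hO' : DifferentiableAt ℝ (fun y => O.symm (y - x₀)) x :=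
    O.symm.differentiable.differentiableAt.comp x (differentiableAt_id.sub_const x₀)
  have hopen : IsOpen {y | 0 < O.symm (y - x₀) 0} :=
    isOpen_apply_zero_pos.preimage (O.symm.continuous.comp (continuous_sub_right x₀))
  refine DifferentiableAt.congr_of_eventuallyEq
    ((((hdiff O _).comp _ hangles).sub hnorm).comp x hO') ?_
  filter_upwards [hopen.mem_nhds hpos] with y hy
  exact radialDefect_eq_chart O hy

lemma isClosed_starBody (hr : 0 < r) (hρ : ∀ u, ‖u‖ = 1 → r ≤ ρ u)
    (hdiff : ∀ O : E3 ≃ₗᵢ[ℝ] E3, Differentiable ℝ (fun θ => ρ (O (sphericalDir θ)))) :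
    IsClosed (starBody x₀ ρ) := by
  rw [← isOpen_compl_iff, isOpen_iff_mem_nhds]
  intro x hx
  have hne : x ≠ x₀ := by
    rintro rfl
    exact hx (mem_of_mem_nhds (starBody_mem_nhds_center hr hρ))
  rw [Set.mem_compl_iff, mem_starBody_iff hne, not_le] at hx
  filter_upwards [(differentiableAt_radialDefect hdiff hne).continuousAt.eventually_lt_const hx,
    isOpen_ne.mem_nhds hne] with y hy hy_ne
  rwa [Set.mem_compl_iff, mem_starBody_iff hy_ne, not_le]

lemma radialDefect_eq_zero_of_mem_frontier (hr : 0 < r) (hρ : ∀ u, ‖u‖ = 1 → r ≤ ρ u)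
    (hdiff : ∀ O : E3 ≃ₗᵢ[ℝ] E3, Differentiable ℝ (fun θ => ρ (O (sphericalDir θ))))
    (hx : x ∈ frontier (starBody x₀ ρ)) : x ≠ x₀ ∧ radialDefect x₀ ρ x = 0 := by
  rw [(isClosed_starBody hr hρ hdiff).frontier_eq] at hx
  have hne : x ≠ x₀ := by
    rintro rfl
    exact hx.2 (mem_interior_iff_mem_nhds.2 (starBody_mem_nhds_center hr hρ))
  refine ⟨hne, le_antisymm ?_ ((mem_starBody_iff hne).1 hx.1)⟩
  by_contra! hpos
  refine hx.2 (mem_interior_iff_mem_nhds.2 ?_)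
  filter_upwards [(differentiableAt_radialDefect hdiff hne).continuousAt.eventually_const_lt hpos,
    isOpen_ne.mem_nhds hne] with y hy hy_ne
  exact (mem_starBody_iff hy_ne).2 hy.le

lemma add_smul_mem_frontier_starBody (hr : 0 < r) (hρ : ∀ u, ‖u‖ = 1 → r ≤ ρ u)
    (hdiff : ∀ O : E3 ≃ₗᵢ[ℝ] E3, Differentiable ℝ (fun θ => ρ (O (sphericalDir θ)))) {w : E3}
    (hw : w ≠ 0) : x₀ + (ρ (‖w‖⁻¹ • w) / ‖w‖) • w ∈ frontier (starBody x₀ ρ) := by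
  have hnorm : 0 < ‖w‖ := norm_pos_iff.2 hw
  set s := ρ (‖w‖⁻¹ • w) / ‖w‖ with hs
  have hs0 : 0 < s := div_pos (hr.trans_le (hρ _ (norm_smul_inv_norm (𝕜 := ℝ) hw))) hnorm
  have hmem : ∀ t : ℝ, 0 < t → (x₀ + t • w ∈ starBody x₀ ρ ↔ t ≤ s) := fun t ht => by
    rw [mem_starBody_iff (by simp [ht.ne', hw]), radialDefect_add_smul ht, hs, le_div_iff₀ hnorm,
      sub_nonneg]
  rw [(isClosed_starBody hr hρ hdiff).frontier_eq]
  refine ⟨(hmem s hs0).2 le_rfl, fun hint => ?_⟩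
  have hline : ContinuousAt (fun t : ℝ => x₀ + t • w) s := by fun_prop
  have hnear : ∀ᶠ t in 𝓝[>] s, x₀ + t • w ∈ starBody x₀ ρ :=
    (hline.eventually (mem_interior_iff_mem_nhds.1 hint)).filter_mono nhdsWithin_le_nhds
  obtain ⟨t, ht, hst : s < t⟩ := (hnear.and self_mem_nhdsWithin).exists
  exact hst.not_ge ((hmem t (hs0.trans hst)).1 ht)

/-- The curve is the radial projection onto the boundary of the line through `x` with direction
`τ`: the projection moves points by a multiple of the radial defect, which vanishes to first order
along `τ`. -/
lemma exists_curve_mem_frontier_starBody (hr : 0 < r) (hρ : ∀ u, ‖u‖ = 1 → r ≤ ρ u)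
    (hdiff : ∀ O : E3 ≃ₗᵢ[ℝ] E3, Differentiable ℝ (fun θ => ρ (O (sphericalDir θ))))
    (hx : x ∈ frontier (starBody x₀ ρ)) {τ : E3} (hτ : fderiv ℝ (radialDefect x₀ ρ) x τ = 0) :
    ∃ y : ℝ → E3, y 0 = x ∧ HasDerivAt y τ 0 ∧ ∀ᶠ t in 𝓝 0, y t ∈ frontier (starBody x₀ ρ) := by
  obtain ⟨hne, hzero⟩ := radialDefect_eq_zero_of_mem_frontier hr hρ hdiff hx
  have hw : x - x₀ ≠ 0 := sub_ne_zero.2 hne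
  have hline : ∀ z : E3, HasDerivAt (fun t : ℝ => z + t • τ) τ 0 := fun z => by
    simpa using ((hasDerivAt_id (0 : ℝ)).smul_const τ).const_add z
  have hdefect : HasDerivAt (fun t : ℝ => radialDefect x₀ ρ (x + t • τ)) 0 0 := by
    have hfderiv : HasFDerivAt (radialDefect x₀ ρ) (fderiv ℝ (radialDefect x₀ ρ) x)
        (x + (0 : ℝ) • τ) := by
      simpa using (differentiableAt_radialDefect hdiff hne).hasFDerivAt
    exact (hfderiv.comp_hasDerivAt (0 : ℝ) (hline x)).congr_deriv hτ
  have hnorm : DifferentiableAt ℝ (fun t : ℝ => ‖x - x₀ + t • τ‖) 0 :=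
    (hline _).differentiableAt.norm ℝ (by simpa using hw)
  have hquot : HasDerivAt (fun t : ℝ => radialDefect x₀ ρ (x + t • τ) / ‖x - x₀ + t • τ‖) 0 0 :=
    (hdefect.div hnorm.hasDerivAt (by simpa using hw)).congr_deriv (by simp [hzero])
  refine ⟨fun t => x₀ + ((x - x₀ + t • τ) +
    (radialDefect x₀ ρ (x + t • τ) / ‖x - x₀ + t • τ‖) • (x - x₀ + t • τ)), by simp [hzero],
    (((hline _).add (hquot.smul (hline _))).congr_deriv (by simp [hzero])).const_add x₀, ?_⟩
  filter_upwards [(hline (x - x₀)).continuousAt.eventually_ne (by simpa using hw)] with t ht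
  convert add_smul_mem_frontier_starBody (x₀ := x₀) hr hρ hdiff ht using 1
  rw [radialDefect, sub_div, show x + t • τ - x₀ = x - x₀ + t • τ by abel,
    div_self (norm_ne_zero_iff.2 ht), sub_smul, one_smul, add_sub_cancel]

lemma fderiv_radialDefect_sub_center (hx : DifferentiableAt ℝ (radialDefect x₀ ρ) x) :
    fderiv ℝ (radialDefect x₀ ρ) x (x - x₀) = -‖x - x₀‖ := by
  have hline : HasDerivAt (fun t : ℝ => x₀ + t • (x - x₀)) (x - x₀) 1 := by
    simpa using ((hasDerivAt_id (1 : ℝ)).smul_const (x - x₀)).const_add x₀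
  have hfderiv : HasFDerivAt (radialDefect x₀ ρ) (fderiv ℝ (radialDefect x₀ ρ) x)
      (x₀ + (1 : ℝ) • (x - x₀)) := by
    simpa using hx.hasFDerivAt
  have hlinear : HasDerivAt (fun t : ℝ => ρ (‖x - x₀‖⁻¹ • (x - x₀)) - t * ‖x - x₀‖)
      (-‖x - x₀‖) 1 := by
    simpa using ((hasDerivAt_id (1 : ℝ)).mul_const ‖x - x₀‖).const_sub
      (ρ (‖x - x₀‖⁻¹ • (x - x₀)))
  refine (hfderiv.comp_hasDerivAt (1 : ℝ) hline).unique (hlinear.congr_of_eventuallyEq ?_)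
  filter_upwards [lt_mem_nhds (zero_lt_one (α := ℝ))] with t ht
  exact radialDefect_add_smul ht _

lemma one_le_norm_fderiv_radialDefect (hx : DifferentiableAt ℝ (radialDefect x₀ ρ) x)
    (hne : x ≠ x₀) : 1 ≤ ‖fderiv ℝ (radialDefect x₀ ρ) x‖ := by
  have hle := (fderiv ℝ (radialDefect x₀ ρ) x).le_opNorm (x - x₀)
  rw [fderiv_radialDefect_sub_center hx, norm_neg, norm_norm] at hle
  exact (le_mul_iff_one_le_left (norm_sub_pos_iff.2 hne)).1 hle

end Frontier

lemma IsTangentPlaneNormal.inner_eq_zero {S : Set E3} {x n τ : E3}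
    (hn : IsTangentPlaneNormal S x n) {y : ℝ → E3} (hy0 : y 0 = x) (hy : HasDerivAt y τ 0)
    (hmem : ∀ᶠ t in 𝓝 0, y t ∈ S) : inner ℝ τ n = 0 := by
  have htend : Tendsto y (𝓝 0) (𝓝[S] x) :=
    tendsto_nhdsWithin_iff.2 ⟨hy0 ▸ hy.continuousAt.tendsto, hmem⟩
  have hbigO : (fun t : ℝ => y t - x) =O[𝓝 0] fun t : ℝ => t := by
    simpa [hy0] using hy.differentiableAt.isBigO_sub
  have hlittleO : (fun t : ℝ => inner ℝ (y t - x) n) =o[𝓝 0] fun t : ℝ => t :=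
    (hn.2.2.comp_tendsto htend).trans_isBigO hbigO
  have hderiv_zero : HasDerivAt (fun t : ℝ => inner ℝ (y t - x) n) 0 0 := by
    rw [hasDerivAt_iff_isLittleO]
    simpa [hy0] using hlittleO
  have hderiv_inner : HasDerivAt (fun t : ℝ => inner ℝ (y t - x) n) (inner ℝ τ n) 0 := by
    simpa using (hy.sub_const x).inner ℝ (hasDerivAt_const (0 : ℝ) n)
  exact hderiv_inner.unique hderiv_zero

lemma exists_eq_mul_inner_of_ker_le {E : Type*} [NormedAddCommGroup E] [InnerProductSpace ℝ E]
    {L : E →L[ℝ] ℝ} {n : E} (hn : n ≠ 0) (hker : ∀ τ, L τ = 0 → inner ℝ τ n = 0) :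
    ∃ c : ℝ, ∀ h, L h = c * inner ℝ h n := by
  have hnn : inner ℝ n n ≠ 0 := inner_self_ne_zero.2 hn
  have hLn : L n ≠ 0 := fun hzero => hnn (hker n hzero)
  refine ⟨L n / inner ℝ n n, fun h => ?_⟩
  have hproj : inner ℝ (h - (L h / L n) • n) n = 0 :=
    hker _ (by rw [map_sub, map_smul, smul_eq_mul, div_mul_cancel₀ _ hLn, sub_self])
  rw [inner_sub_left, real_inner_smul_left, sub_eq_zero] at hproj
  rw [hproj]
  field_simp

/-- `φ` is a defining function of `B` near its boundary point `x`: it is nonnegative exactly on `B`,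
its gradient is bounded and Hölder continuous on the `δ`-ball, has norm at least `1` at `x`, and is
there proportional to the normals of tangent planes. -/
structure IsDefiningFunction (a M δ : ℝ) (B : Set E3) (x : E3) (φ : E3 → ℝ) : Prop where
  mem_iff : ∀ y ∈ Metric.ball x δ, (y ∈ B ↔ 0 ≤ φ y)
  gradHolderOn : GradHolderOn a M φ (Metric.ball x δ)
  one_le_norm : 1 ≤ ‖fderiv ℝ φ x‖
  normal : ∀ n, IsTangentPlaneNormal (frontier B) x n →
    ∃ c : ℝ, ∀ h, fderiv ℝ φ x h = c * inner ℝ h n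

lemma gradHolderOn_isometry_sub {E F : Type*} [NormedAddCommGroup E] [NormedSpace ℝ E]
    [NormedAddCommGroup F] [NormedSpace ℝ F] (O : E →ₗᵢ[ℝ] F) (a : ℝ) (x₀ : E) (s : Set E) :
    GradHolderOn a 1 (fun x => O (x - x₀)) s := by
  have hderiv : ∀ x, HasFDerivAt (fun x => O (x - x₀)) O.toContinuousLinearMap x := fun x =>
    O.toContinuousLinearMap.hasFDerivAt.comp x ((hasFDerivAt_id x).sub_const x₀)
  refine ⟨fun x _ => (hderiv x).differentiableAt, fun x _ => ?_, fun x _ y _ => ?_⟩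
  · rw [(hderiv x).fderiv]
    exact O.norm_toContinuousLinearMap_le
  · rw [(hderiv x).fderiv, (hderiv y).fderiv, sub_self, norm_zero]
    positivity

lemma mem_chartRegion_of_norm_sub_le {r t : ℝ} {z : E3} (hrt : r ≤ t) (ht : t ≤ 1)
    (hz : ‖z - t • EuclideanSpace.single 0 (1 : ℝ)‖ ≤ r / 2) : z ∈ chartRegion r := by
  have hcoord := (PiLp.norm_apply_le (z - t • EuclideanSpace.single 0 (1 : ℝ)) 0).trans hz
  have hr : 0 ≤ r / 2 := (norm_nonneg _).trans hz
  constructor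
  · have hz0 : |z 0 - t| ≤ r / 2 := by simpa using hcoord
    change r / 2 ≤ z 0
    linarith [(abs_le.1 hz0).1]
  · have ht0 : ‖t • (EuclideanSpace.single 0 (1 : ℝ) : E3)‖ = t := by
      rw [norm_smul, PiLp.norm_single, norm_one, mul_one, Real.norm_of_nonneg (by linarith)]
    rw [mem_closedBall_zero_iff]
    linarith [norm_le_norm_add_norm_sub (t • (EuclideanSpace.single 0 (1 : ℝ) : E3)) z,
      norm_sub_rev z (t • EuclideanSpace.single 0 (1 : ℝ))]

lemma exists_gradHolderOn_radialDefect {r a : ℝ} (hr : 0 < r) (ha0 : 0 ≤ a) (ha1 : a ≤ 1) (M : ℝ) :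
    ∃ N, ∀ (x₀ : E3) (ρ : E3 → ℝ),
      (∀ O : E3 ≃ₗᵢ[ℝ] E3, GradHolderOn a M (fun θ => ρ (O (sphericalDir θ))) Set.univ) →
      ∀ x, r ≤ ‖x - x₀‖ → ‖x - x₀‖ ≤ 1 →
        GradHolderOn a N (radialDefect x₀ ρ) (Metric.ball x (r / 2)) := by
  obtain ⟨N, hN⟩ := exists_gradHolderOn_chartRegion hr ha0 ha1 M
  refine ⟨N * 1 + N * 1 ^ a * 1, fun x₀ ρ hρ x hrx hx1 => ?_⟩
  obtain ⟨O, hO⟩ := exists_isometry_symm_eq_single_zero (x - x₀)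
  have hmaps : Set.MapsTo (fun y => O.symm (y - x₀)) (Metric.ball x (r / 2)) (chartRegion r) := by
    intro y hy
    refine mem_chartRegion_of_norm_sub_le hrx hx1 ?_
    rw [← hO, ← map_sub, sub_sub_sub_cancel_right, LinearIsometryEquiv.norm_map, ← dist_eq_norm]
    exact (Metric.mem_ball.1 hy).le
  refine GradHolderOn.congr Metric.isOpen_ball ((hN _ (hρ O)).comp ha0 (convex_ball x _)
    (gradHolderOn_isometry_sub O.symm.toLinearIsometry a x₀ _) hmaps) fun y hy => ?_
  exact radialDefect_eq_chart O (apply_zero_pos_of_mem_chartRegion hr (hmaps hy))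

lemma exists_isDefiningFunction {α ν r : ℝ} (h1 : 1 < α) (h2 : α ≤ 2) (hν : 0 ≤ ν) (hr : 0 < r) :
    ∃ M, 0 < M ∧ ∀ B ∈ STAR α ν r, IsClosed B ∧ ∀ x ∈ frontier B,
      ∃ φ, IsDefiningFunction (α - 1) M (r / 2) B x φ := by
  obtain ⟨M, hM⟩ := exists_gradHolderOn_radialDefect (a := α - 1) hr (by linarith) (by linarith)
    ((2 : ℕ) * ((2 : ℕ) * ν) * (1 + (2 : ℕ) * (2 * Real.pi) ^ (α - 1)))
  refine ⟨max M 1, by positivity, ?_⟩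
  rintro B ⟨-, x₀, ρ, rfl, hρr, ⟨ρ₀, hρ₀, hρle⟩, hO⟩
  have hholder := fun O : E3 ≃ₗᵢ[ℝ] E3 => gradHolderOn_univ_of_periodic h1 h2 hν Real.two_pi_pos
    (hO O).1 (hO O).2 (fun θ l => by rw [sphericalDir_periodic])
  have hdiff : ∀ O : E3 ≃ₗᵢ[ℝ] E3, Differentiable ℝ (fun θ => ρ (O (sphericalDir θ))) :=
    fun O θ => (hholder O).differentiableAt θ trivial
  refine ⟨isClosed_starBody hr hρr hdiff, fun x hx => ⟨radialDefect x₀ ρ, ?_⟩⟩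
  obtain ⟨hne, hzero⟩ := radialDefect_eq_zero_of_mem_frontier hr hρr hdiff hx
  have hunit : ‖‖x - x₀‖⁻¹ • (x - x₀)‖ = 1 := norm_smul_inv_norm (𝕜 := ℝ) (sub_ne_zero.2 hne)
  have hnorm : ρ (‖x - x₀‖⁻¹ • (x - x₀)) = ‖x - x₀‖ := sub_eq_zero.1 hzero
  have hdiffx := differentiableAt_radialDefect hdiff hne
  have hrx : r ≤ ‖x - x₀‖ := hnorm ▸ hρr _ hunit
  refine ⟨fun y hy => mem_starBody_iff ?_,
    (hM x₀ ρ hholder x hrx (hnorm ▸ (hρle _ hunit).trans hρ₀.le)).weaken (le_max_left _ _),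
    one_le_norm_fderiv_radialDefect hdiffx hne, fun n hn => ?_⟩
  · rintro rfl
    rw [Metric.mem_ball, dist_comm, dist_eq_norm] at hy
    linarith
  · refine exists_eq_mul_inner_of_ker_le hn.2.1 fun τ hτ => ?_
    obtain ⟨y, hy0, hy, hmem⟩ := exists_curve_mem_frontier_starBody hr hρr hdiff hx hτ
    exact hn.inner_eq_zero hy0 hy hmem

section HalfPlaneSlices

lemma GradHolderOn.norm_sub_sub_le {E F : Type*} [NormedAddCommGroup E] [NormedSpace ℝ E]
    [NormedAddCommGroup F] [NormedSpace ℝ F] {a M d : ℝ} {g : E → F} {s : Set E}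
    (hs : Convex ℝ s) (hg : GradHolderOn a M g s) (ha : 0 ≤ a) {x y : E} (hx : x ∈ s) (hy : y ∈ s)
    (hd : ‖y - x‖ ≤ d) : ‖g y - g x - fderiv ℝ g x (y - x)‖ ≤ M * d ^ a * d := by
  have hM : 0 ≤ M := (norm_nonneg _).trans (hg.norm_fderiv_le x hx)
  have hd0 : 0 ≤ d := (norm_nonneg _).trans hd
  refine (((convex_closedBall x d).inter hs).norm_image_sub_le_of_norm_hasFDerivWithin_le'
    (fun z hz => (hg.differentiableAt z hz.2).hasFDerivAt.hasFDerivWithinAt) (fun z hz => ?_)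
    ⟨Metric.mem_closedBall_self hd0, hx⟩ ⟨mem_closedBall_iff_norm.2 hd, hy⟩).trans
    (mul_le_mul_of_nonneg_left hd (by positivity))
  have hzx : ‖z - x‖ ≤ d := mem_closedBall_iff_norm.1 hz.1
  exact (hg.norm_fderiv_sub_le z hz.2 x hx).trans (by gcongr)

variable {E : Type*} [NormedAddCommGroup E] [NormedSpace ℝ E] {φ : E → ℝ} {s : Set E}

lemma norm_add_smul_le_of_abs_le {c A : ℝ} {w₀ w₁ : E} (hc : |c| ≤ A) :
    ‖w₀ + c • w₁‖ ≤ ‖w₀‖ + A * ‖w₁‖ := by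
  refine (norm_add_le _ _).trans ?_
  rw [norm_smul, Real.norm_eq_abs]
  gcongr

lemma mul_le_sub_of_le_fderiv {q u : ℝ} {z w : E} (hs : Convex ℝ s)
    (hφ : ∀ y ∈ s, DifferentiableAt ℝ φ y) (hq : ∀ y ∈ s, q ≤ fderiv ℝ φ y w) (hu : 0 ≤ u)
    (hz : z ∈ s) (hzu : z + u • w ∈ s) : q * u ≤ φ (z + u • w) - φ z := by
  have hmem : ∀ t ∈ Set.Icc 0 u, z + t • w ∈ s := fun t ht => by
    rcases hu.eq_or_lt with rfl | hu
    · rwa [le_antisymm ht.2 ht.1]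
    · convert hs.add_smul_sub_mem hz hzu ⟨div_nonneg ht.1 hu.le, div_le_one_of_le₀ ht.2 hu.le⟩
        using 2
      rw [add_sub_cancel_left, smul_smul, div_mul_cancel₀ _ hu.ne']
  have hderiv : ∀ t ∈ Set.Icc 0 u, HasDerivAt (fun t : ℝ => φ (z + t • w))
      (fderiv ℝ φ (z + t • w) w) t := fun t ht => by
    have hline : HasDerivAt (fun t : ℝ => z + t • w) w t := by
      simpa using ((hasDerivAt_id t).smul_const w).const_add z
    exact (hφ _ (hmem t ht)).hasFDerivAt.comp_hasDerivAt t hline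
  have hmean := (convex_Icc 0 u).mul_sub_le_image_sub_of_le_deriv
    (fun t ht => (hderiv t ht).continuousAt.continuousWithinAt)
    (fun t ht => (hderiv t (interior_subset ht)).differentiableAt.differentiableWithinAt)
    (fun t ht => (hderiv t (interior_subset ht)).deriv ▸ hq _ (hmem t (interior_subset ht)))
    0 (Set.left_mem_Icc.2 hu) u (Set.right_mem_Icc.2 hu) hu
  simpa using hmean

lemma mul_pos_of_le_fderiv {q u K : ℝ} {z w : E} (hs : Convex ℝ s)
    (hφ : ∀ y ∈ s, DifferentiableAt ℝ φ y) (hq : ∀ y ∈ s, q ≤ fderiv ℝ φ y w) (hz : z ∈ s)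
    (hzu : z + u • w ∈ s) (hK : |φ z| ≤ K) (hu : K < q * |u|) : 0 < u * φ (z + u • w) := by
  have hu0 : u ≠ 0 := by
    rintro rfl
    rw [abs_zero, mul_zero] at hu
    exact hu.not_ge ((abs_nonneg _).trans hK)
  rcases hu0.lt_or_gt with hneg | hpos
  · have hgrow := mul_le_sub_of_le_fderiv hs hφ hq (neg_nonneg.2 hneg.le) hzu (by simpa using hz)
    rw [neg_smul, add_neg_cancel_right] at hgrow
    rw [abs_of_neg hneg] at hu
    exact mul_pos_of_neg_of_neg hneg (by linarith [(abs_le.1 hK).2])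
  · have hgrow := mul_le_sub_of_le_fderiv hs hφ hq hpos.le hz hzu
    rw [abs_of_pos hpos] at hu
    exact mul_pos hpos (by linarith [(abs_le.1 hK).1])

variable {a A M R q W t₀ v₀ : ℝ} {p w₀ w₁ : E}

lemma exists_map_add_smul_eq_zero {L : E →L[ℝ] ℝ} (hq : 0 < q) (hw₁ : q ≤ L w₁)
    (hw₀ : |L w₀| ≤ A * q) : ∃ c : ℝ, |c| ≤ A ∧ L (w₀ + c • w₁) = 0 := by
  have hpos : 0 < L w₁ := hq.trans_le hw₁
  have hA : 0 ≤ A := nonneg_of_mul_nonneg_left ((abs_nonneg _).trans hw₀) hq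
  refine ⟨-(L w₀ / L w₁), ?_, ?_⟩
  · rw [abs_neg, abs_div, abs_of_pos hpos, div_le_iff₀ hpos]
    exact hw₀.trans (by gcongr)
  · rw [map_add, map_smul, smul_eq_mul, neg_mul, div_mul_cancel₀ _ hpos.ne', add_neg_cancel]

/-- The line is tangent at the zero `(t₀, v₀)`, so that along it `φ` vanishes to order `a + 1`. -/
lemma exists_line_abs_le (hs : Convex ℝ s) (hφ : GradHolderOn a M φ s) (ha : 0 < a) (hq : 0 < q)
    (hA : A ≤ 1) (hbox : ∀ t v : ℝ, |t| ≤ R → |v| ≤ 3 * R → p + t • w₀ + v • w₁ ∈ s)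
    (hw₁ : ∀ y ∈ s, q ≤ fderiv ℝ φ y w₁) (hw₀ : M * ‖w₀‖ ≤ A * q) (hW : ‖w₀‖ + A * ‖w₁‖ ≤ W)
    (ht₀ : |t₀| ≤ R) (hv₀ : |v₀| ≤ R) (hzero : φ (p + t₀ • w₀ + v₀ • w₁) = 0) :
    ∃ c b : ℝ, |c| ≤ A ∧ ∀ t : ℝ, |t| ≤ R → |c * t + b| ≤ 3 * R ∧
      |φ (p + t • w₀ + (c * t + b) • w₁)| ≤ M * (2 * R * W) ^ (a + 1) := by
  set P := p + t₀ • w₀ + v₀ • w₁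
  have hP : P ∈ s := hbox t₀ v₀ ht₀ (by linarith [abs_nonneg t₀])
  have : 0 ≤ M := (norm_nonneg _).trans (hφ.norm_fderiv_le P hP)
  have hslope : |fderiv ℝ φ P w₀| ≤ A * q :=
    ((fderiv ℝ φ P).le_of_opNorm_le (hφ.norm_fderiv_le P hP) w₀).trans hw₀
  obtain ⟨c, hcA, htangent⟩ := exists_map_add_smul_eq_zero hq (hw₁ P hP) hslope
  have hnorm : ‖w₀ + c • w₁‖ ≤ W :=
    (norm_add_smul_le_of_abs_le hcA).trans hW
  refine ⟨c, v₀ - c * t₀, hcA, fun t ht => ?_⟩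
  have hdist : |t - t₀| ≤ 2 * R := (abs_sub t t₀).trans (by linarith)
  have hcoord : |c * t + (v₀ - c * t₀)| ≤ 3 * R := by
    rw [show c * t + (v₀ - c * t₀) = v₀ + c * (t - t₀) by ring]
    refine (abs_add_le _ _).trans ?_
    rw [abs_mul]
    linarith [mul_le_mul (hcA.trans hA) hdist (abs_nonneg _) zero_le_one]
  refine ⟨hcoord, ?_⟩
  have hdisp : p + t • w₀ + (c * t + (v₀ - c * t₀)) • w₁ - P = (t - t₀) • (w₀ + c • w₁) := by
    module
  have hR : 0 ≤ 2 * R := (abs_nonneg _).trans hdist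
  have htaylor := hφ.norm_sub_sub_le hs ha.le hP (hbox t _ ht hcoord) (d := 2 * R * W)
    (by rw [hdisp, norm_smul, Real.norm_eq_abs]; gcongr)
  rw [hdisp, map_smul, htangent, smul_zero, hzero, sub_zero, sub_zero, Real.norm_eq_abs] at htaylor
  rwa [Real.rpow_add_one' (mul_nonneg hR ((norm_nonneg _).trans hnorm)) (by linarith), ← mul_assoc]

lemma exists_line_mul_pos (hs : Convex ℝ s) (hφ : GradHolderOn a M φ s) (ha : 0 < a) (hq : 0 < q)
    (hA : A ≤ 1) (hbox : ∀ t v : ℝ, |t| ≤ R → |v| ≤ 3 * R → p + t • w₀ + v • w₁ ∈ s)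
    (hw₁ : ∀ y ∈ s, q ≤ fderiv ℝ φ y w₁) (hw₀ : M * ‖w₀‖ ≤ A * q) (hW : ‖w₀‖ + A * ‖w₁‖ ≤ W)
    (ht₀ : |t₀| ≤ R) (hv₀ : |v₀| ≤ R) (hzero : φ (p + t₀ • w₀ + v₀ • w₁) = 0) :
    ∃ c b : ℝ, |c| ≤ A ∧ ∀ t v : ℝ, |t| ≤ R → |v| ≤ R →
      M * (2 * R * W) ^ (a + 1) / q < |v - c * t - b| →
      0 < (v - c * t - b) * φ (p + t • w₀ + v • w₁) := by
  obtain ⟨c, b, hcA, hline⟩ := exists_line_abs_le hs hφ ha hq hA hbox hw₁ hw₀ hW ht₀ hv₀ hzero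
  refine ⟨c, b, hcA, fun t v ht hv hfar => ?_⟩
  have hpoint : p + t • w₀ + v • w₁ =
      p + t • w₀ + (c * t + b) • w₁ + (v - c * t - b) • w₁ := by module
  have hmem := hbox t v ht (by linarith [abs_nonneg t])
  rw [hpoint] at hmem ⊢
  exact mul_pos_of_le_fderiv hs hφ.differentiableAt hw₁ (hbox t _ ht (hline t ht).1) hmem
    (hline t ht).2 ((div_lt_iff₀' hq).1 hfar)

lemma nonneg_iff_nonneg_of_isPreconnected {X : Type*} [TopologicalSpace X] {S : Set X} {f : X → ℝ}
    (hS : IsPreconnected S) (hf : ContinuousOn f S) (hne : ∀ x ∈ S, f x ≠ 0) {x y : X}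
    (hx : x ∈ S) (hy : y ∈ S) : 0 ≤ f x ↔ 0 ≤ f y := by
  suffices himp : ∀ {x y : X}, x ∈ S → y ∈ S → 0 ≤ f x → 0 ≤ f y from ⟨himp hx hy, himp hy hx⟩
  intro x y hx hy hfx
  by_contra! hfy
  obtain ⟨z, hz, hfz⟩ := hS.intermediate_value hy hx hf ⟨hfy.le, hfx⟩
  exact hne z hz hfz

/-- On the square `[-R, R]²` the set `S` is a half plane `v - c t ≷ b` of slope `|c| ≤ A`, except
for points at distance at most `τ` from the line `v - c t = b`. Only the dependence on `v - c t`
matters for the estimates, so instead of a half line an arbitrary measurable set `V` is allowed. -/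
def IsNearlyHalfPlane (R A τ : ℝ) (S : Set (ℝ × ℝ)) : Prop :=
  ∃ c b : ℝ, ∃ V : Set ℝ, |c| ≤ A ∧ MeasurableSet V ∧ ∀ t v : ℝ, |t| ≤ R → |v| ≤ R →
    τ < |v - c * t - b| → ((t, v) ∈ S ↔ v - c * t ∈ V)

lemma IsNearlyHalfPlane.congr {τ : ℝ} {S S' : Set (ℝ × ℝ)} (hS : IsNearlyHalfPlane R A τ S)
    (hSS' : ∀ t v : ℝ, |t| ≤ R → |v| ≤ R → ((t, v) ∈ S' ↔ (t, v) ∈ S)) :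
    IsNearlyHalfPlane R A τ S' := by
  obtain ⟨c, b, V, hc, hV, hSV⟩ := hS
  exact ⟨c, b, V, hc, hV, fun t v ht hv hfar => (hSS' t v ht hv).trans (hSV t v ht hv hfar)⟩

lemma isNearlyHalfPlane_of_forall_iff {A τ : ℝ} {S : Set (ℝ × ℝ)} (hA : 0 ≤ A) (P : Prop)
    (hS : ∀ t v : ℝ, |t| ≤ R → |v| ≤ R → ((t, v) ∈ S ↔ P)) : IsNearlyHalfPlane R A τ S :=
  ⟨0, 0, {_v | P}, by rwa [abs_zero], MeasurableSet.const P, fun t v ht hv _ => hS t v ht hv⟩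

lemma isNearlyHalfPlane_of_pos_mul {c b τ σ : ℝ} {f : ℝ → ℝ → ℝ} (hc : |c| ≤ A)
    (hf : ∀ t v : ℝ, |t| ≤ R → |v| ≤ R → τ < |v - c * t - b| → 0 < σ * (v - c * t - b) * f t v) :
    IsNearlyHalfPlane R A τ {x | 0 ≤ f x.1 x.2} := by
  refine ⟨c, b, {u | 0 < σ * (u - b)}, hc,
    measurableSet_lt measurable_const (by fun_prop), fun t v ht hv hfar => ?_⟩
  rcases pos_and_pos_or_neg_and_neg_of_mul_pos (hf t v ht hv hfar) with
    ⟨hside, hpos⟩ | ⟨hside, hneg⟩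
  · exact iff_of_true hpos.le hside
  · exact iff_of_false hneg.not_ge hside.not_gt

lemma isNearlyHalfPlane_of_forall_ne_zero {τ : ℝ} (hR : 0 ≤ R) (hA : 0 ≤ A)
    (hφ : ∀ t v : ℝ, |t| ≤ R → |v| ≤ R → ContinuousAt φ (p + t • w₀ + v • w₁))
    (hne : ∀ t v : ℝ, |t| ≤ R → |v| ≤ R → φ (p + t • w₀ + v • w₁) ≠ 0) :
    IsNearlyHalfPlane R A τ {x | 0 ≤ φ (p + x.1 • w₀ + x.2 • w₁)} := by
  have hsquare : IsPreconnected (Set.Icc (-R) R ×ˢ Set.Icc (-R) R) :=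
    isPreconnected_Icc.prod isPreconnected_Icc
  have hzero : (0 : ℝ) ∈ Set.Icc (-R) R := ⟨neg_nonpos.2 hR, hR⟩
  refine isNearlyHalfPlane_of_forall_iff hA (0 ≤ φ (p + (0 : ℝ) • w₀ + (0 : ℝ) • w₁))
    fun t v ht hv => ?_
  refine nonneg_iff_nonneg_of_isPreconnected (x := (t, v)) (y := (0, 0))
    (f := fun x : ℝ × ℝ => φ (p + x.1 • w₀ + x.2 • w₁)) hsquare (fun x hx => ?_)
    (fun x hx => hne _ _ (abs_le.2 hx.1) (abs_le.2 hx.2)) ⟨abs_le.1 ht, abs_le.1 hv⟩ ⟨hzero, hzero⟩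
  exact (ContinuousAt.comp (f := fun x : ℝ × ℝ => p + x.1 • w₀ + x.2 • w₁)
    (hφ _ _ (abs_le.2 hx.1) (abs_le.2 hx.2)) (by fun_prop)).continuousWithinAt

lemma isNearlyHalfPlane_of_le_fderiv (hs : Convex ℝ s) (hφ : GradHolderOn a M φ s) (ha : 0 < a)
    (hq : 0 < q) (hR : 0 ≤ R) (hA0 : 0 ≤ A) (hA : A ≤ 1)
    (hbox : ∀ t v : ℝ, |t| ≤ R → |v| ≤ 3 * R → p + t • w₀ + v • w₁ ∈ s) {σ : ℝ} (hσ : |σ| = 1)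
    (hw₁ : ∀ y ∈ s, q ≤ fderiv ℝ φ y (σ • w₁)) (hw₀ : M * ‖w₀‖ ≤ A * q)
    (hW : ‖w₀‖ + A * ‖w₁‖ ≤ W) :
    IsNearlyHalfPlane R A (M * (2 * R * W) ^ (a + 1) / q)
      {x | 0 ≤ φ (p + x.1 • w₀ + x.2 • w₁)} := by
  have hσσ : σ * σ = 1 := by rw [← abs_mul_abs_self, hσ, one_mul]
  have hflip : ∀ t v : ℝ, p + t • w₀ + (σ * v) • σ • w₁ = p + t • w₀ + v • w₁ := fun t v => by
    rw [smul_smul, mul_right_comm, hσσ, one_mul]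
  have habs : ∀ v : ℝ, |σ * v| = |v| := fun v => by rw [abs_mul, hσ, one_mul]
  by_cases hzero : ∃ t v : ℝ, |t| ≤ R ∧ |v| ≤ R ∧ φ (p + t • w₀ + v • w₁) = 0
  · obtain ⟨t₀, v₀, ht₀, hv₀, hzero⟩ := hzero
    have hnorm : ‖w₀‖ + A * ‖σ • w₁‖ ≤ W := by
      rwa [norm_smul, Real.norm_eq_abs, hσ, one_mul]
    obtain ⟨c, b, hc, hpos⟩ := exists_line_mul_pos (w₁ := σ • w₁) hs hφ ha hq hA
      (fun t v ht hv => by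
        simpa [smul_smul, mul_comm v] using hbox t (σ * v) ht ((habs v).trans_le hv))
      hw₁ hw₀ hnorm ht₀ ((habs v₀).trans_le hv₀) ((congrArg φ (hflip t₀ v₀)).trans hzero)
    refine isNearlyHalfPlane_of_pos_mul (f := fun t v => φ (p + t • w₀ + v • w₁)) (c := σ * c)
      (b := σ * b) (σ := σ) ((habs c).trans_le hc)
      fun t v ht hv hfar => ?_
    have hside : σ * (v - σ * c * t - σ * b) = σ * v - c * t - b := by
      linear_combination (-c * t - b) * hσσ
    rw [← habs, hside] at hfar
    rw [hside, ← hflip]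
    exact hpos t (σ * v) ht ((habs v).trans_le hv) hfar
  · push Not at hzero
    refine isNearlyHalfPlane_of_forall_ne_zero hR hA0 (fun t v ht hv => ?_) hzero
    exact (hφ.differentiableAt _ (hbox t v ht (by linarith))).continuousAt

lemma isNearlyHalfPlane_of_le_abs_fderiv (hs : Convex ℝ s) (hφ : GradHolderOn a M φ s) (ha : 0 < a)
    (hq : 0 < q) (hR : 0 ≤ R) (hA0 : 0 ≤ A) (hA : A ≤ 1)
    (hbox : ∀ t v : ℝ, |t| ≤ R → |v| ≤ 3 * R → p + t • w₀ + v • w₁ ∈ s) {x : E}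
    (hlow : 2 * q ≤ |fderiv ℝ φ x w₁|) (hosc : ∀ y ∈ s, ‖fderiv ℝ φ y - fderiv ℝ φ x‖ * ‖w₁‖ ≤ q)
    (hw₀ : M * ‖w₀‖ ≤ A * q) (hW : ‖w₀‖ + A * ‖w₁‖ ≤ W) :
    IsNearlyHalfPlane R A (M * (2 * R * W) ^ (a + 1) / q)
      {z | 0 ≤ φ (p + z.1 • w₀ + z.2 • w₁)} := by
  have hosc' : ∀ y ∈ s, |fderiv ℝ φ y w₁ - fderiv ℝ φ x w₁| ≤ q := fun y hy =>
    ((fderiv ℝ φ y - fderiv ℝ φ x).le_opNorm w₁).trans (hosc y hy)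
  rcases le_abs.1 hlow with hpos | hneg
  · refine isNearlyHalfPlane_of_le_fderiv hs hφ ha hq hR hA0 hA hbox (σ := 1) abs_one
      (fun y hy => ?_) hw₀ hW
    rw [one_smul]
    linarith [(abs_le.1 (hosc' y hy)).1]
  · refine isNearlyHalfPlane_of_le_fderiv hs hφ ha hq hR hA0 hA hbox (σ := -1) (by simp)
      (fun y hy => ?_) hw₀ hW
    rw [neg_one_smul, map_neg]
    linarith [(abs_le.1 (hosc' y hy)).2]

end HalfPlaneSlices

section PlaneIntegrals

variable {a A C L M N R W c b μ m₀ m₁ τ : ℝ}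

/-- Along the line `g` is replaced by its Taylor polynomial of degree one. -/
lemma norm_integral_comp_line_mul_le {E : Type*} [NormedAddCommGroup E] [NormedSpace ℝ E]
    {g : E → ℂ} {u : ℝ → ℂ} {p w : E} (ha : 0 ≤ a) (hR : 0 ≤ R) (hgμ : ∀ x, ‖g x‖ ≤ μ)
    (hg : GradHolderOn a M g Set.univ) (hu : Continuous u) (hu0 : ∀ t, R < |t| → u t = 0)
    (huN : ∀ t, ‖u t‖ ≤ N) (hm₀ : ‖∫ t, u t‖ ≤ m₀) (hm₁ : ‖∫ t : ℝ, (t : ℂ) * u t‖ ≤ m₁)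
    (hw : ‖w‖ ≤ W) :
    ‖∫ t : ℝ, g (p + t • w) * u t‖ ≤
      μ * m₀ + M * W * m₁ + M * (R * W) ^ a * (R * W) * N * (2 * R) := by
  have hM : 0 ≤ M := (norm_nonneg _).trans (hg.norm_fderiv_le p trivial)
  have hW : 0 ≤ W := (norm_nonneg w).trans hw
  have hμ : 0 ≤ μ := (norm_nonneg _).trans (hgμ p)
  have hsupp : HasCompactSupport u := hasCompactSupport_of_eq_zero_of_lt_abs hu0
  have hgc : Continuous g := hg.continuous
  set D : ℂ := fderiv ℝ g p w
  have hD : ‖D‖ ≤ M * W := (fderiv ℝ g p).le_of_opNorm_le_of_le (hg.norm_fderiv_le p trivial) hw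
  have hvalue : Integrable fun t : ℝ => g p * u t :=
    (continuous_const.mul hu).integrable_of_hasCompactSupport hsupp.mul_left
  have hslope : Integrable fun t : ℝ => D * ((t : ℂ) * u t) :=
    (continuous_const.mul (Complex.continuous_ofReal.mul hu)).integrable_of_hasCompactSupport
      hsupp.mul_left.mul_left
  have hremainder : Integrable fun t : ℝ => (g (p + t • w) - g p - (t : ℂ) * D) * u t :=
    Continuous.integrable_of_hasCompactSupport (by fun_prop) hsupp.mul_left
  have hsplit : ∫ t : ℝ, g (p + t • w) * u t = g p * (∫ t, u t) + D * (∫ t : ℝ, (t : ℂ) * u t) +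
      ∫ t : ℝ, (g (p + t • w) - g p - (t : ℂ) * D) * u t := by
    rw [← integral_const_mul, ← integral_const_mul, ← integral_add hvalue hslope,
      ← integral_add (by exact hvalue.add hslope) hremainder]
    exact integral_congr_ae (.of_forall fun t => by ring)
  rw [hsplit]
  refine (norm_add₃_le).trans (add_le_add_three ?_ ?_ ?_)
  · exact (norm_mul_le _ _).trans (mul_le_mul (hgμ p) hm₀ (norm_nonneg _) hμ)
  · exact (norm_mul_le _ _).trans (mul_le_mul hD hm₁ (norm_nonneg _) (by positivity))
  · refine norm_integral_le_of_eq_zero_of_lt_abs hR (fun t ht => by rw [hu0 t ht, mul_zero])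
      fun t ht => (norm_mul_le _ _).trans ?_
    have htaylor := hg.norm_sub_sub_le convex_univ ha (x := p) (y := p + t • w) (d := R * W)
      trivial trivial (by rw [add_sub_cancel_left, norm_smul, Real.norm_eq_abs]; gcongr)
    rw [add_sub_cancel_left, map_smul, Complex.real_smul] at htaylor
    exact mul_le_mul htaylor (huN t) (norm_nonneg _) (by positivity)

lemma measurePreserving_shear (c : ℝ) :
    MeasurePreserving (fun q : ℝ × ℝ => (q.1, q.2 + c * q.1)) := by
  refine (MeasurePreserving.id (volume : Measure ℝ)).skew_product
    (g := fun t v => v + c * t) (by fun_prop) ?_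
  filter_upwards with t
  exact (measurePreserving_add_right (volume : Measure ℝ) (c * t)).map_eq

lemma measurableEmbedding_shear (c : ℝ) :
    MeasurableEmbedding (fun q : ℝ × ℝ => (q.1, q.2 + c * q.1)) := by
  refine Continuous.measurableEmbedding (by fun_prop) ?_
  rintro ⟨t, v⟩ ⟨t', v'⟩ h
  simp only [Prod.mk.injEq] at h ⊢
  obtain ⟨rfl, h⟩ := h
  exact ⟨rfl, by linarith⟩

lemma volume_shear_strip :
    volume {q : ℝ × ℝ | |q.1| ≤ R ∧ |q.2 - c * q.1 - b| ≤ τ} =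
      ENNReal.ofReal (2 * R) * ENNReal.ofReal (2 * τ) := by
  have hpre : (fun q : ℝ × ℝ => (q.1, q.2 + c * q.1)) ⁻¹'
      {q | |q.1| ≤ R ∧ |q.2 - c * q.1 - b| ≤ τ} = Set.Icc (-R) R ×ˢ Set.Icc (b - τ) (b + τ) := by
    ext q
    simp only [Set.mem_preimage, Set.mem_ofPred_eq, add_sub_cancel_right, Set.mem_prod, abs_le,
      Set.mem_Icc, neg_le_sub_iff_le_add, sub_le_iff_le_add]
    grind
  rw [← (measurePreserving_shear c).measure_preimage_emb (measurableEmbedding_shear c), hpre,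
    Measure.volume_eq_prod, Measure.prod_prod, Real.volume_Icc, Real.volume_Icc]
  congr 2 <;> ring

lemma integral_eq_integral_integral_shear {F : ℝ × ℝ → ℂ} (hF : Integrable F) (c : ℝ) :
    ∫ q, F q = ∫ v, ∫ t, F (t, v + c * t) := by
  have hshear : Integrable fun q : ℝ × ℝ => F (q.1, q.2 + c * q.1) :=
    ((measurePreserving_shear c).integrable_comp_emb (measurableEmbedding_shear c)).2 hF
  rw [← (measurePreserving_shear c).integral_comp (measurableEmbedding_shear c),
    Measure.volume_eq_prod, integral_prod_symm _ hshear]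

variable {F : ℝ × ℝ → ℂ} (hF0 : ∀ t v : ℝ, R < |t| ∨ R < |v| → F (t, v) = 0)
include hF0

lemma norm_integral_indicator_shear_le {V : Set ℝ} (hF : Integrable F) (hR : 0 ≤ R)
    (hV : MeasurableSet V) (hc : |c| ≤ 1) (hL : ∀ v : ℝ, ‖∫ t, F (t, v + c * t)‖ ≤ L) :
    ‖∫ q, {q : ℝ × ℝ | q.2 - c * q.1 ∈ V}.indicator F q‖ ≤ L * (4 * R) := by
  have hmeas : MeasurableSet {q : ℝ × ℝ | q.2 - c * q.1 ∈ V} :=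
    (by fun_prop : Measurable fun q : ℝ × ℝ => q.2 - c * q.1) hV
  have hline : ∀ v t : ℝ, {q : ℝ × ℝ | q.2 - c * q.1 ∈ V}.indicator F (t, v + c * t) =
      V.indicator (fun v => F (t, v + c * t)) v := fun v t => by
    classical simp only [Set.indicator_apply, Set.mem_ofPred_eq, add_sub_cancel_right]
  rw [integral_eq_integral_integral_shear (hF.indicator hmeas) c]
  simp only [hline]
  rw [show L * (4 * R) = L * (2 * (2 * R)) by ring]
  refine norm_integral_le_of_eq_zero_of_lt_abs (by positivity) (fun v hv => ?_) fun v _ => ?_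
  · refine integral_eq_zero_of_ae (.of_forall fun t => Set.indicator_apply_eq_zero.2 fun _ => ?_)
    refine hF0 t _ (or_iff_not_imp_left.2 fun ht => ?_)
    have hct : |c * t| ≤ R := by
      rw [abs_mul]
      exact (mul_le_of_le_one_left (abs_nonneg t) hc).trans (not_lt.1 ht)
    have := abs_sub (v + c * t) (c * t)
    rw [add_sub_cancel_right] at this
    linarith
  · by_cases hv : v ∈ V
    · simpa only [Set.indicator_of_mem hv] using hL v
    · simpa only [Set.indicator_of_notMem hv, integral_zero, norm_zero] using
        (norm_nonneg _).trans (hL v)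

/-- Replacing `S` by the half plane changes the integral only on a strip of area `4 R τ`. -/
lemma norm_integral_indicator_le_of_isNearlyHalfPlane {S : Set (ℝ × ℝ)} (hF : Integrable F)
    (hFC : ∀ q, ‖F q‖ ≤ C) (hR : 0 ≤ R) (hA : A ≤ 1) (hτ : 0 ≤ τ) (hS : MeasurableSet S)
    (hSA : IsNearlyHalfPlane R A τ S)
    (hL : ∀ c v : ℝ, |c| ≤ A → ‖∫ t, F (t, v + c * t)‖ ≤ L) :
    ‖∫ q, S.indicator F q‖ ≤ L * (4 * R) + C * (4 * R * τ) := by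
  obtain ⟨c, b, V, hc, hV, hSV⟩ := hSA
  set H : Set (ℝ × ℝ) := {q | q.2 - c * q.1 ∈ V} 
  set T : Set (ℝ × ℝ) := {q | |q.1| ≤ R ∧ |q.2 - c * q.1 - b| ≤ τ}
  have hHmeas : MeasurableSet H := (by fun_prop : Measurable fun q : ℝ × ℝ => q.2 - c * q.1) hV
  have hoff : ∀ q ∉ T, S.indicator F q - H.indicator F q = 0 := by
    rintro ⟨t, v⟩ hq
    by_cases hsquare : |t| ≤ R ∧ |v| ≤ R
    · have hfar : τ < |v - c * t - b| := not_le.1 fun h => hq ⟨hsquare.1, h⟩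
      have hiff : (t, v) ∈ S ↔ (t, v) ∈ H := hSV t v hsquare.1 hsquare.2 hfar
      classical simp only [Set.indicator_apply, hiff, sub_self]
    · rw [not_and_or, not_le, not_le] at hsquare
      simp only [Set.indicator, hF0 t v hsquare, ite_self, sub_self]
  have hdiff : ∀ q, ‖S.indicator F q - H.indicator F q‖ ≤ C := fun q => by
    have := (norm_nonneg _).trans (hFC q)
    by_cases hqS : q ∈ S <;> by_cases hqH : q ∈ H <;> simp [hqS, hqH, hFC, this]
  have herror : ‖∫ q, (S.indicator F q - H.indicator F q)‖ ≤ C * (4 * R * τ) := by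
    rw [← setIntegral_eq_integral_of_forall_compl_eq_zero hoff]
    refine (norm_setIntegral_le_of_norm_le_const ?_ fun q _ => hdiff q).trans_eq ?_
    · rw [volume_shear_strip]
      exact ENNReal.mul_lt_top ENNReal.ofReal_lt_top ENNReal.ofReal_lt_top
    · rw [Measure.real, volume_shear_strip, ENNReal.toReal_mul,
        ENNReal.toReal_ofReal (by positivity), ENNReal.toReal_ofReal (by positivity)]
      ring
  have hsplit : ∫ q, S.indicator F q =
      (∫ q, H.indicator F q) + ∫ q, (S.indicator F q - H.indicator F q) := by
    rw [integral_sub (hF.indicator hS) (hF.indicator hHmeas), add_sub_cancel]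
  rw [hsplit]
  exact (norm_add_le _ _).trans (add_le_add
    (norm_integral_indicator_shear_le hF0 hF hR hV (hc.trans hA) fun v => hL c v hc) herror)

omit hF0

lemma norm_plane_integral_le {ε : ℝ} {g η : E3 → ℂ} {B : Set E3} {p w₀ w₁ : E3}
    (hη : IsGenerator R N η) (ha : 0 ≤ a) (hgμ : ∀ x, ‖g x‖ ≤ μ)
    (hg : GradHolderOn a M g Set.univ) (i : Fin 2) (s : ℝ) (hε : 0 < ε) (hε1 : ε ≤ 1)
    (hτ : 0 ≤ τ) (hW : ‖w₀‖ + ε * ‖w₁‖ ≤ W) (hB : MeasurableSet B)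
    (hBA : IsNearlyHalfPlane R ε τ {q | p + q.1 • w₀ + q.2 • w₁ ∈ B}) :
    ‖∫ q : ℝ × ℝ, B.indicator g (p + q.1 • w₀ + q.2 • w₁) * η (axisPoint i q.1 q.2 s)‖ ≤
      (μ * (N * ε ^ 3) + M * W * (N * ε) + M * (R * W) ^ a * (R * W) * N * (2 * R)) * (4 * R) +
        μ * N * (4 * R * τ) := by
  have hR : 0 ≤ R := hη.radius_pos.le
  have hgc : Continuous g := hg.continuous
  have hplane : Continuous fun q : ℝ × ℝ => p + q.1 • w₀ + q.2 • w₁ := by fun_prop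
  set F : ℝ × ℝ → ℂ := fun q => g (p + q.1 • w₀ + q.2 • w₁) * η (axisPoint i q.1 q.2 s)
  have hF0 : ∀ t v : ℝ, R < |t| ∨ R < |v| → F (t, v) = 0 := fun t v htv => by
    refine mul_eq_zero_of_right _ (htv.elim (fun ht => hη.eq_zero _ 0 ?_)
      fun hv => hη.eq_zero _ i.succ ?_)
    · rwa [axisPoint_apply_zero]
    · rwa [axisPoint_apply_succ]
  have hFc : Continuous F := (hgc.comp hplane).mul (hη.continuous.comp
    (continuous_axisPoint_comp i continuous_fst continuous_snd continuous_const))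
  have hFsupp : HasCompactSupport F := .intro
    ((isCompact_Icc (a := -R) (b := R)).prod (isCompact_Icc (a := -R) (b := R))) fun q hq =>
      hF0 q.1 q.2 (by simpa only [Set.mem_prod, Set.mem_Icc, ← abs_le, not_and_or, not_le] using hq)
  have hindicator : ∀ q : ℝ × ℝ, B.indicator g (p + q.1 • w₀ + q.2 • w₁) *
      η (axisPoint i q.1 q.2 s) = {q | p + q.1 • w₀ + q.2 • w₁ ∈ B}.indicator F q := fun q => by
    simp only [Set.indicator, Set.mem_ofPred_eq, ite_mul, zero_mul, F]
  simp only [hindicator]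
  refine norm_integral_indicator_le_of_isNearlyHalfPlane hF0
    (hFc.integrable_of_hasCompactSupport hFsupp) (fun q => ?_) hR hε1 hτ (hplane.measurable hB) hBA
    fun c v hc => ?_
  · exact (norm_mul_le _ _).trans
      (mul_le_mul (hgμ _) (hη.norm_le _) (norm_nonneg _) ((norm_nonneg _).trans (hgμ 0)))
  · have hline : ∀ t : ℝ, F (t, v + c * t) =
        g (p + v • w₁ + t • (w₀ + c • w₁)) * η (axisPoint i t (v + c * t) s) := fun t =>
      congrArg (g · * _) (by module)
    simp only [hline]
    refine norm_integral_comp_line_mul_le ha hR hgμ hg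
      (hη.continuous.comp (continuous_axisPoint_comp i (by fun_prop) (by fun_prop) (by fun_prop)))
      (fun t ht => hη.eq_zero _ 0 (by rwa [axisPoint_apply_zero])) (fun t => hη.norm_le _)
      (hη.moment_zero i ε c v s hε hε1 hc) (hη.moment_one i ε c v s hε hε1 hc)
      ((norm_add_smul_le_of_abs_le hc).trans hW)

end PlaneIntegrals

/-! ### The rescaled estimate -/

section Rescaling

lemma norm_integral_le_of_forall_slice_le {F : E3 → ℂ} {R K : ℝ} (hF : Integrable F) (hR : 0 ≤ R)
    (i : Fin 2) (hzero : ∀ x, R < |x i.rev.succ| → F x = 0)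
    (hK : ∀ s, |s| ≤ R → ‖∫ q : ℝ × ℝ, F (axisPoint i q.1 q.2 s)‖ ≤ K) :
    ‖∫ x, F x‖ ≤ K * (2 * R) := by
  have hassoc : MeasurePreserving
      (fun p : (ℝ × ℝ) × ℝ => ((p.1.1, p.1.2, p.2) : ℝ × (ℝ × ℝ))) := volume_preserving_prodAssoc
  have hemb : MeasurableEmbedding
      (fun p : (ℝ × ℝ) × ℝ => ((p.1.1, p.1.2, p.2) : ℝ × (ℝ × ℝ))) :=
    MeasurableEquiv.prodAssoc.measurableEmbedding
  have hint : Integrable fun p : (ℝ × ℝ) × ℝ => F (axisPoint i p.1.1 p.1.2 p.2) :=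
    (hassoc.integrable_comp_emb hemb).2 ((integrable_axisPoint_iff i).2 hF)
  have hfubini : ∫ x, F x = ∫ s, ∫ q : ℝ × ℝ, F (axisPoint i q.1 q.2 s) := by
    rw [← integral_axisPoint i, ← hassoc.integral_comp hemb, Measure.volume_eq_prod,
      integral_prod_symm _ hint]
  rw [hfubini]
  refine norm_integral_le_of_eq_zero_of_lt_abs hR (fun s hs => ?_) hK
  exact integral_eq_zero_of_ae (.of_forall fun q =>
    hzero _ (by rwa [axisPoint_apply_rev_succ]))

/-- Admissible pairs of a scale `D` and a small parameter `ε`. For the shearlets `D = 2 ^ (-j / 2)`,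
and `ε` is the inverse of the distance between shear parameter and slope. -/
structure IsScale (α D ε : ℝ) : Prop where
  scale_pos : 0 < D
  scale_le_one : D ≤ 1
  pos : 0 < ε
  le_one : ε ≤ 1
  rpow_le : D ^ (α - 1) ≤ 5 * ε

namespace IsScale

variable {α β D ε : ℝ}

lemma rpow_le_mul (h : IsScale α D ε) : D ^ α ≤ 5 * (ε * D) := by
  have hD := h.scale_pos
  calc D ^ α = D ^ (α - 1) * D := by rw [← Real.rpow_add_one hD.ne', sub_add_cancel]
    _ ≤ 5 * ε * D := by gcongr; exact h.rpow_le
    _ = _ := mul_assoc _ _ _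

lemma scale_le_rpow (h : IsScale α D ε) (h1 : 1 < α) (h2 : α ≤ 2) : D ≤ 5 * ε ^ (α - 1) := by
  have hD := h.scale_pos
  have hε := h.pos
  calc D = D ^ (1 : ℝ) := (Real.rpow_one D).symm
    _ ≤ D ^ ((α - 1) * (α - 1)) :=
        Real.rpow_le_rpow_of_exponent_ge hD h.scale_le_one (by nlinarith)
    _ = (D ^ (α - 1)) ^ (α - 1) := Real.rpow_mul hD.le _ _
    _ ≤ (5 * ε) ^ (α - 1) := by gcongr; exact h.rpow_le
    _ = 5 ^ (α - 1) * ε ^ (α - 1) := Real.mul_rpow (by norm_num) hε.le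
    _ ≤ 5 ^ (1 : ℝ) * ε ^ (α - 1) := by gcongr <;> linarith
    _ = _ := by rw [Real.rpow_one]

lemma pow_three_le (h : IsScale α D ε) (h2 : α ≤ 2) : ε ^ 3 ≤ ε ^ (α + 1) := by
  rw [← Real.rpow_natCast]
  exact Real.rpow_le_rpow_of_exponent_ge h.pos h.le_one (by norm_num; linarith)

lemma rpow_sub_one_mul_sq (h : IsScale α D ε) : ε ^ (α - 1) * ε ^ 2 = ε ^ (α + 1) := by
  rw [← Real.rpow_natCast, ← Real.rpow_add h.pos]
  congr 1
  push_cast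
  ring

lemma sq_mul_le (h : IsScale α D ε) (h1 : 1 < α) (h2 : α ≤ 2) :
    ε ^ 2 * D ≤ 5 * ε ^ (α + 1) := by
  have hε := h.pos
  calc ε ^ 2 * D ≤ ε ^ 2 * (5 * ε ^ (α - 1)) := by gcongr; exact h.scale_le_rpow h1 h2
    _ = 5 * ε ^ (α + 1) := by rw [← h.rpow_sub_one_mul_sq]; ring

lemma rpow_mul_le (h : IsScale α D ε) (hαβ : α ≤ β) :
    (ε * D) ^ (β - 1) * (ε * D) ≤ 5 * ε ^ (α + 1) := by
  have hε := h.pos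
  have hD := h.scale_pos
  calc (ε * D) ^ (β - 1) * (ε * D) ≤ (ε * D) ^ (α - 1) * (ε * D) := by
        gcongr ?_ * _
        exact Real.rpow_le_rpow_of_exponent_ge (by positivity)
          (mul_le_one₀ h.le_one hD.le h.scale_le_one) (by linarith)
    _ = ε ^ (α - 1) * ε * (D ^ (α - 1) * D) := by rw [Real.mul_rpow hε.le hD.le]; ring
    _ ≤ ε ^ (α - 1) * ε * (5 * ε * 1) := by
        gcongr
        · exact h.rpow_le
        · exact h.scale_le_one
    _ = 5 * ε ^ (α + 1) := by rw [← h.rpow_sub_one_mul_sq]; ring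

lemma strip_width_eq (h : IsScale α D ε) {M P : ℝ} (hP : 0 ≤ P) :
    M * (P * (ε * D)) ^ (α - 1 + 1) / (D ^ α / (24 * ε)) = 24 * M * P ^ α * ε ^ (α + 1) := by
  have hε := h.pos
  have hD := h.scale_pos
  have := Real.rpow_pos_of_pos hD α
  rw [sub_add_cancel, Real.mul_rpow hP (by positivity), Real.mul_rpow hε.le hD.le,
    Real.rpow_add_one hε.ne']
  field_simp

lemma line_bound_le (h : IsScale α D ε) (h1 : 1 < α) (h2 : α ≤ 2) (hαβ : α ≤ β)
    {μ M N P Q R : ℝ} (hμ : 0 ≤ μ) (hM : 0 ≤ M) (hN : 0 ≤ N) (hP : 0 ≤ P) (hQ : 0 ≤ Q)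
    (hR : 0 ≤ R) :
    μ * (N * (P * ε) ^ 3) + M * (Q * (ε * D)) * (N * (P * ε)) +
        M * (R * (Q * (ε * D))) ^ (β - 1) * (R * (Q * (ε * D))) * N * (2 * R) ≤
      (μ * N * P ^ 3 + 5 * (M * Q * N * P) +
        5 * (M * (R * Q) ^ (β - 1) * (R * Q) * N * (2 * R))) * ε ^ (α + 1) := by
  have hε := h.pos
  have hD := h.scale_pos
  calc _ = μ * N * P ^ 3 * ε ^ 3 + M * Q * N * P * (ε ^ 2 * D) +
        M * (R * Q) ^ (β - 1) * (R * Q) * N * (2 * R) * ((ε * D) ^ (β - 1) * (ε * D)) := by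
        rw [← mul_assoc R Q, Real.mul_rpow (by positivity) (by positivity)]
        ring
    _ ≤ μ * N * P ^ 3 * ε ^ (α + 1) + M * Q * N * P * (5 * ε ^ (α + 1)) +
        M * (R * Q) ^ (β - 1) * (R * Q) * N * (2 * R) * (5 * ε ^ (α + 1)) := by
        gcongr ?_ + ?_ + ?_
        · exact mul_le_mul_of_nonneg_left (h.pow_three_le h2) (by positivity)
        · exact mul_le_mul_of_nonneg_left (h.sq_mul_le h1 h2) (by positivity)
        · exact mul_le_mul_of_nonneg_left (h.rpow_mul_le hαβ) (by positivity)
    _ = _ := by ring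

/-- As `D ^ (α - 1) ≤ 5 ε`, every condition met by all small `D` is met by all small `ε`. -/
lemma exists_forall_scale_le (h1 : 1 < α) {d : ℝ} (hd : 0 < d) :
    ∃ ε₀ : ℝ, 0 < ε₀ ∧ ∀ D ε : ℝ, IsScale α D ε → ε ≤ ε₀ → D ≤ d := by
  refine ⟨d ^ (α - 1) / 5, by positivity, fun D ε h hε => ?_⟩
  rw [← Real.rpow_le_rpow_iff h.scale_pos.le hd.le (sub_pos.2 h1)]
  linarith [h.rpow_le]

end IsScale

/-- The linear part of the change of variables which normalizes a shearlet: up to the scaling by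
`D ^ α` and `D` it is a shear with parameters `-κ`. -/
structure IsShearScaling (α D : ℝ) (κ : Fin 2 → ℝ) (X : E3 →ₗ[ℝ] E3) : Prop where
  map_zero_axis : X (EuclideanSpace.single 0 1) = D ^ α • EuclideanSpace.single 0 (1 : ℝ)
  map_succ_axis : ∀ i : Fin 2, X (EuclideanSpace.single i.succ 1) =
    D • (EuclideanSpace.single i.succ (1 : ℝ) - κ i • EuclideanSpace.single 0 (1 : ℝ))
  abs_le : ∀ i, |κ i| ≤ 2

namespace IsShearScaling

variable {α D : ℝ} {κ : Fin 2 → ℝ} {X : E3 →ₗ[ℝ] E3}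

lemma norm_zero_axis (hX : IsShearScaling α D κ X) (hD : 0 ≤ D) :
    ‖X (EuclideanSpace.single 0 1)‖ = D ^ α := by
  rw [hX.map_zero_axis, norm_smul, PiLp.norm_single, norm_one, mul_one,
    Real.norm_of_nonneg (Real.rpow_nonneg hD α)]

lemma norm_succ_axis_le (hX : IsShearScaling α D κ X) (hD : 0 ≤ D) (i : Fin 2) :
    ‖X (EuclideanSpace.single i.succ 1)‖ ≤ 3 * D := by
  have hshear : ‖(EuclideanSpace.single i.succ (1 : ℝ) - κ i • EuclideanSpace.single 0 1 : E3)‖ ≤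
      1 + 2 := by
    refine (norm_sub_le _ _).trans (add_le_add (by simp) ?_)
    rw [norm_smul]
    simpa using hX.abs_le i
  rw [hX.map_succ_axis, norm_smul, Real.norm_of_nonneg hD]
  nlinarith

lemma norm_apply_le (hX : IsShearScaling α D κ X) (hα : 1 ≤ α) (hD : 0 < D) (hD1 : D ≤ 1) {r : ℝ}
    {y : E3} (hy : ∀ l, |y l| ≤ r) : ‖X y‖ ≤ 7 * r * D := by
  have hr : 0 ≤ r := (abs_nonneg _).trans (hy 0)
  have hDα : D ^ α ≤ D := by simpa using Real.rpow_le_rpow_of_exponent_ge hD hD1 hα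
  have hsum : X y = ∑ l, y l • X (EuclideanSpace.single l 1) := by
    conv_lhs => rw [← (EuclideanSpace.basisFun (Fin 3) ℝ).sum_repr y]
    simp
  have hterm : ∀ l, ∀ c, ‖X (EuclideanSpace.single l 1)‖ ≤ c →
      ‖y l • X (EuclideanSpace.single l 1)‖ ≤ r * c := fun l c hc => by
    rw [norm_smul]
    exact mul_le_mul (hy l) hc (norm_nonneg _) hr
  rw [hsum, Fin.sum_univ_three]
  refine (norm_add₃_le).trans ?_
  linarith [hterm 0 D ((hX.norm_zero_axis hD.le).trans_le hDα),
    hterm 1 _ (hX.norm_succ_axis_le hD.le 0), hterm 2 _ (hX.norm_succ_axis_le hD.le 1)]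

lemma norm_add_mul_norm_le (hX : IsShearScaling α D κ X) {ε A : ℝ} (hs : IsScale α D ε)
    (hA : 0 ≤ A) (i : Fin 2) :
    ‖X (EuclideanSpace.single 0 1)‖ + A * ε * ‖X (EuclideanSpace.single i.succ 1)‖ ≤
      (5 + 3 * A) * (ε * D) := by
  have := hs.pos
  calc _ ≤ 5 * (ε * D) + A * ε * (3 * D) := by
        gcongr
        · exact (hX.norm_zero_axis hs.scale_pos.le).trans_le hs.rpow_le_mul
        · exact hX.norm_succ_axis_le hs.scale_pos.le i
    _ = _ := by ring

end IsShearScaling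

lemma axisPoint_eq_add (i : Fin 2) (t v s : ℝ) :
    axisPoint i t v s = axisPoint i 0 0 s + t • EuclideanSpace.single 0 (1 : ℝ) +
      v • EuclideanSpace.single i.succ (1 : ℝ) := by
  simp only [axisPoint, zero_smul, zero_add, add_zero]
  abel

lemma add_map_axisPoint_sub (i : Fin 2) (x y₀ : E3) (X : E3 →ₗ[ℝ] E3) (t v s : ℝ) :
    x + X (axisPoint i t v s - y₀) = x + X (axisPoint i 0 0 s - y₀) +
      t • X (EuclideanSpace.single 0 1) + v • X (EuclideanSpace.single i.succ 1) := by
  rw [axisPoint_eq_add i t v s]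
  simp only [map_sub, map_add, map_smul]
  abel

lemma IsDefiningFunction.one_le {a M δ : ℝ} {B : Set E3} {x : E3} {φ : E3 → ℝ}
    (hφ : IsDefiningFunction a M δ B x φ) (hδ : 0 < δ) : 1 ≤ M :=
  hφ.one_le_norm.trans (hφ.gradHolderOn.norm_fderiv_le x (Metric.mem_ball_self hδ))

variable {α β D ε M R δ μ M' N : ℝ} {κ : Fin 2 → ℝ} {X : E3 →ₗ[ℝ] E3} {B : Set E3} {x y₀ : E3}
  {φ : E3 → ℝ} {η g f₀ f₁ : E3 → ℂ}

lemma isNearlyHalfPlane_rescaled (h1 : 1 < α) (hR : 0 ≤ R)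
    (hφ : IsDefiningFunction (α - 1) M δ B x φ) (hs : IsScale α D ε)
    (hX : IsShearScaling α D κ X) (i : Fin 2) (hy₀ : ∀ l, |y₀ l| ≤ R)
    (hlow : D ^ α / (12 * ε) ≤ |fderiv ℝ φ x (X (EuclideanSpace.single i.succ 1))|)
    (hslope : 24 * M * ε ≤ 1) (hδ : 28 * R * D < δ)
    (hosc : M * (28 * R * D) ^ (α - 1) * (3 * D) ≤ D ^ α / (24 * ε)) {s : ℝ} (hsR : |s| ≤ R) :
    IsNearlyHalfPlane R (24 * M * ε) (24 * M * (2 * R * (5 + 72 * M)) ^ α * ε ^ (α + 1))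
      {q | x + X (axisPoint i q.1 q.2 s - y₀) ∈ B} := by
  have hε := hs.pos
  have hD := hs.scale_pos
  have hM : 1 ≤ M := hφ.one_le ((by positivity : 0 ≤ 28 * R * D).trans_lt hδ)
  have hsub : Metric.closedBall x (28 * R * D) ⊆ Metric.ball x δ :=
    Metric.closedBall_subset_ball hδ
  have hx : x ∈ Metric.closedBall x (28 * R * D) := Metric.mem_closedBall_self (by positivity)
  have hbox : ∀ t v : ℝ, |t| ≤ R → |v| ≤ 3 * R →
      x + X (axisPoint i t v s - y₀) ∈ Metric.closedBall x (28 * R * D) := fun t v ht hv => by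
    rw [mem_closedBall_iff_norm, add_sub_cancel_left, show 28 * R * D = 7 * (4 * R) * D by ring]
    refine hX.norm_apply_le h1.le hD hs.scale_le_one fun l => ?_
    have hl : |axisPoint i t v s l| ≤ 3 * R := by
      fin_cases i <;> fin_cases l <;> simp [axisPoint, Fin.rev] <;> linarith
    rw [PiLp.sub_apply]
    linarith [hy₀ l, abs_sub (axisPoint i t v s l) (y₀ l)]
  have hhalf := isNearlyHalfPlane_of_le_abs_fderiv (q := D ^ α / (24 * ε)) (x := x)
    (convex_closedBall x (28 * R * D)) (hφ.gradHolderOn.mono hsub) (sub_pos.2 h1) (by positivity)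
    hR (by positivity) hslope
    (fun t v ht hv => by rw [← add_map_axisPoint_sub]; exact hbox t v ht hv)
    (le_trans (by field_simp; norm_num) hlow) (fun y hy => le_trans ?_ hosc)
    (le_of_eq ?_) (hX.norm_add_mul_norm_le hs (A := 24 * M) (by positivity) i)
  · rw [show 5 + 3 * (24 * M) = 5 + 72 * M by ring, ← mul_assoc (2 * R),
      hs.strip_width_eq (by positivity)] at hhalf
    refine hhalf.congr fun t v ht hv => ?_
    simp only [Set.mem_ofPred_eq, ← add_map_axisPoint_sub]
    exact hφ.mem_iff _ (hsub (hbox t v ht (hv.trans (by linarith))))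
  · gcongr
    · refine (hφ.gradHolderOn.norm_fderiv_sub_le y (hsub hy) x (hsub hx)).trans ?_
      gcongr
      exact mem_closedBall_iff_norm.1 hy
    · exact hX.norm_succ_axis_le hD.le i
  · rw [hX.norm_zero_axis hD.le]
    field_simp

lemma IsGenerator.integrable (hη : IsGenerator R N η) : Integrable η := by
  refine hη.continuous.integrable_of_hasCompactSupport
    (.intro (isCompact_closedBall (0 : E3) (3 * R)) fun y hy => ?_)
  by_contra hne
  have hle : ∀ l, y l ^ 2 ≤ R ^ 2 := fun l =>
    sq_le_sq' (abs_le.1 (not_lt.1 (mt (hη.eq_zero y l) hne))).1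
      (abs_le.1 (not_lt.1 (mt (hη.eq_zero y l) hne))).2
  refine hy (mem_closedBall_zero_iff.2 (abs_le_of_sq_le_sq' ?_ (by linarith [hη.radius_pos])).2)
  rw [norm_sq_eq_sum_three]
  nlinarith [hle 0, hle 1, hle 2]

lemma IsGenerator.integrable_indicator_comp_mul (hη : IsGenerator R N η) (hgμ : ∀ x, ‖g x‖ ≤ μ)
    (hg : Continuous g) (hB : MeasurableSet B) (X : E3 →ₗ[ℝ] E3) (x y₀ : E3) :
    Integrable fun y => B.indicator g (x + X (y - y₀)) * η y := by
  have hX : Continuous X := X.continuous_of_finiteDimensional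
  have hmeas : Measurable fun y => B.indicator g (x + X (y - y₀)) :=
    (hg.measurable.indicator hB).comp (by fun_prop)
  exact hη.integrable.bdd_mul hmeas.aestronglyMeasurable
    (.of_forall fun y => (norm_indicator_le_norm_self _ _).trans (hgμ _))

/-- Slice by planes parallel to the axes `0` and `i.succ`. -/
lemma exists_norm_integral_indicator_le (h1 : 1 < α) (h2 : α ≤ 2) (hαβ : α ≤ β)
    (hη : IsGenerator R N η) (hM : 0 < M) (hμ : 0 ≤ μ) (hM' : 0 ≤ M') :
    ∃ C : ℝ, 0 ≤ C ∧ ∀ g : E3 → ℂ, (∀ x, ‖g x‖ ≤ μ) → GradHolderOn (β - 1) M' g Set.univ →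
      ∀ (D ε τ : ℝ) (κ : Fin 2 → ℝ) (X : E3 →ₗ[ℝ] E3) (i : Fin 2) (x y₀ : E3) (B : Set E3),
      IsScale α D ε → 24 * M * ε ≤ 1 → 0 ≤ τ → IsShearScaling α D κ X → MeasurableSet B →
      (∀ s : ℝ, |s| ≤ R →
        IsNearlyHalfPlane R (24 * M * ε) τ {q | x + X (axisPoint i q.1 q.2 s - y₀) ∈ B}) →
      ‖∫ y, B.indicator g (x + X (y - y₀)) * η y‖ ≤ C * (ε ^ (α + 1) + τ) := by
  have hR := hη.radius_pos
  have hN := hη.bound_nonneg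
  set Q := 5 + 3 * (24 * M)
  set K := μ * N * (24 * M) ^ 3 + 5 * (M' * Q * N * (24 * M)) +
    5 * (M' * (R * Q) ^ (β - 1) * (R * Q) * N * (2 * R))
  have : 0 ≤ K := by positivity
  refine ⟨(K * (4 * R) + μ * N * (4 * R)) * (2 * R), by positivity, ?_⟩
  intro g hgμ hg D ε τ κ X i x y₀ B hs hslope hτ hX hB hBA
  have hε := hs.pos
  refine (norm_integral_le_of_forall_slice_le (hη.integrable_indicator_comp_mul hgμ hg.continuous
    hB X x y₀) hR.le i (fun y hy => by rw [hη.eq_zero y _ hy, mul_zero])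
    (K := K * ε ^ (α + 1) * (4 * R) + μ * N * (4 * R * τ)) fun s hsR => ?_).trans ?_
  · have hplane := fun q : ℝ × ℝ => add_map_axisPoint_sub i x y₀ X q.1 q.2 s
    generalize x + X (axisPoint i 0 0 s - y₀) = p at hplane
    have hhalf := hBA s hsR
    simp only [hplane] at hhalf ⊢
    refine (norm_plane_integral_le hη (by linarith) hgμ hg i s (by positivity) hslope hτ
      (hX.norm_add_mul_norm_le hs (by positivity) i) hB hhalf).trans ?_
    gcongr
    exact hs.line_bound_le h1 h2 hαβ hμ hM' hN (by positivity) (by positivity) hR.le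
  · have := Real.rpow_nonneg hε.le (α + 1)
    have : 0 ≤ K * (4 * R) * τ + μ * N * (4 * R) * ε ^ (α + 1) := by positivity
    nlinarith

lemma exists_forall_isNearlyHalfPlane_rescaled (h1 : 1 < α) (hR : 0 < R) (hM : 0 < M)
    (hδ : 0 < δ) :
    ∃ ε₀ > 0, ∀ (B : Set E3) (x : E3) (φ : E3 → ℝ), IsDefiningFunction (α - 1) M δ B x φ →
      ∀ (D ε : ℝ) (κ : Fin 2 → ℝ) (X : E3 →ₗ[ℝ] E3) (i : Fin 2) (y₀ : E3),
      IsScale α D ε → ε ≤ ε₀ → IsShearScaling α D κ X → (∀ l, |y₀ l| ≤ R) →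
      (ε ≤ 1 / 24 → D ^ α / (12 * ε) ≤ |fderiv ℝ φ x (X (EuclideanSpace.single i.succ 1))|) →
      24 * M * ε ≤ 1 ∧ ∀ s : ℝ, |s| ≤ R →
        IsNearlyHalfPlane R (24 * M * ε) (24 * M * (2 * R * (5 + 72 * M)) ^ α * ε ^ (α + 1))
          {q | x + X (axisPoint i q.1 q.2 s - y₀) ∈ B} := by
  obtain ⟨ε₁, hε₁, hsmall⟩ := IsScale.exists_forall_scale_le h1
    (by positivity : 0 < δ / (56 * R))
  refine ⟨min (1 / (24 * M)) (min (1 / (72 * M * (28 * R) ^ (α - 1))) ε₁), by positivity, ?_⟩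
  intro B x φ hφ D ε κ X i y₀ hs hle hX hy₀ hlow
  obtain ⟨hεM, hle⟩ := le_min_iff.1 hle
  obtain ⟨hεR, hεδ⟩ := le_min_iff.1 hle
  have hε := hs.pos
  have hD := hs.scale_pos
  have hslope : 24 * M * ε ≤ 1 := by
    rwa [le_div_iff₀ (by positivity), mul_comm] at hεM
  have hball : 28 * R * D < δ := by
    have := hsmall D ε hs hεδ
    rw [le_div_iff₀ (by positivity)] at this
    linarith
  have hosc : M * (28 * R * D) ^ (α - 1) * (3 * D) ≤ D ^ α / (24 * ε) := by
    rw [le_div_iff₀ (by positivity)] at hεR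
    rw [le_div_iff₀ (by positivity), Real.mul_rpow (by positivity) hD.le]
    calc M * ((28 * R) ^ (α - 1) * D ^ (α - 1)) * (3 * D) * (24 * ε)
        = ε * (72 * M * (28 * R) ^ (α - 1)) * (D ^ (α - 1) * D) := by ring
      _ ≤ 1 * (D ^ (α - 1) * D) := by gcongr
      _ = D ^ α := by rw [one_mul, ← Real.rpow_add_one hD.ne', sub_add_cancel]
  have hM1 : 1 ≤ M := hφ.one_le hδ
  refine ⟨hslope, fun s hsR => isNearlyHalfPlane_rescaled h1 hR.le hφ hs hX i hy₀
    (hlow ?_) hslope hball hosc hsR⟩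
  rw [le_div_iff₀ (by norm_num)]
  nlinarith

lemma integral_add_indicator_comp_mul (hη : IsGenerator R N η) (hb₀ : ∀ x, ‖f₀ x‖ ≤ μ)
    (hb₁ : ∀ x, ‖f₁ x‖ ≤ μ) (hc₀ : Continuous f₀) (hc₁ : Continuous f₁) (hB : MeasurableSet B) :
    ∫ y, (f₀ + B.indicator f₁) (x + X (y - y₀)) * η y =
      (∫ y, Set.univ.indicator f₀ (x + X (y - y₀)) * η y) +
        ∫ y, B.indicator f₁ (x + X (y - y₀)) * η y := by
  rw [← integral_add (hη.integrable_indicator_comp_mul hb₀ hc₀ .univ X x y₀)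
    (hη.integrable_indicator_comp_mul hb₁ hc₁ hB X x y₀)]
  simp only [Set.indicator_univ, Pi.add_apply, add_mul]

lemma norm_integral_add_indicator_mul_le (hη : Integrable η) (hb₀ : ∀ x, ‖f₀ x‖ ≤ μ)
    (hb₁ : ∀ x, ‖f₁ x‖ ≤ μ) (g : E3 → E3) :
    ‖∫ y, (f₀ + B.indicator f₁) (g y) * η y‖ ≤ ∫ y, 2 * μ * ‖η y‖ := by
  refine norm_integral_le_of_norm_le (hη.norm.const_mul (2 * μ)) (.of_forall fun y => ?_)
  rw [norm_mul, two_mul μ]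
  gcongr
  exact norm_add_le_of_le (hb₀ _) ((norm_indicator_le_norm_self _ _).trans (hb₁ _))

/-- For `ε` bounded below the trivial bound suffices; for small `ε` the set `B` is nearly a half
plane in every slice. -/
lemma exists_norm_rescaled_integral_le (h1 : 1 < α) (h2 : α ≤ 2) (hαβ : α ≤ β)
    (hη : IsGenerator R N η) (hM : 0 < M) (hμ : 0 ≤ μ) (hM' : 0 ≤ M') (hδ : 0 < δ) :
    ∃ C : ℝ, 0 < C ∧ ∀ f₀ f₁ : E3 → ℂ, (∀ x, ‖f₀ x‖ ≤ μ) → (∀ x, ‖f₁ x‖ ≤ μ) →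
      GradHolderOn (β - 1) M' f₀ Set.univ → GradHolderOn (β - 1) M' f₁ Set.univ →
      ∀ (B : Set E3) (x : E3) (φ : E3 → ℝ), MeasurableSet B →
      IsDefiningFunction (α - 1) M δ B x φ →
      ∀ (D ε : ℝ) (κ : Fin 2 → ℝ) (X : E3 →ₗ[ℝ] E3) (i : Fin 2) (y₀ : E3),
      IsScale α D ε → IsShearScaling α D κ X → (∀ l, |y₀ l| ≤ R) →
      (ε ≤ 1 / 24 → D ^ α / (12 * ε) ≤ |fderiv ℝ φ x (X (EuclideanSpace.single i.succ 1))|) →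
      ‖∫ y, (f₀ + B.indicator f₁) (x + X (y - y₀)) * η y‖ ≤ C * ε ^ (α + 1) := by
  have hR := hη.radius_pos
  obtain ⟨ε₀, hε₀, hhalf⟩ := exists_forall_isNearlyHalfPlane_rescaled h1 hR hM hδ
  obtain ⟨C, hC, hbound⟩ := exists_norm_integral_indicator_le h1 h2 hαβ hη hM hμ hM'
  set A := 24 * M * (2 * R * (5 + 72 * M)) ^ α
  set I := ∫ y, 2 * μ * ‖η y‖
  have : 0 ≤ I := integral_nonneg fun y => by positivity
  refine ⟨C * (2 + A) + I / ε₀ ^ (α + 1) + 1, by positivity, ?_⟩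
  intro f₀ f₁ hb₀ hb₁ hf₀ hf₁ B x φ hB hφ D ε κ X i y₀ hs hX hy₀ hlow
  have := Real.rpow_pos_of_pos hs.pos (α + 1)
  rcases le_total ε ε₀ with hle | hle
  · obtain ⟨hslope, hslices⟩ := hhalf B x φ hφ D ε κ X i y₀ hs hle hX hy₀ hlow
    have hε := hs.pos
    have hsmooth := hbound f₀ hb₀ hf₀ D ε 0 κ X i x y₀ Set.univ hs hslope le_rfl hX .univ
      fun s _ => isNearlyHalfPlane_of_forall_iff (by positivity) True fun _ _ _ _ => by simp
    have hjump := hbound f₁ hb₁ hf₁ D ε (A * ε ^ (α + 1)) κ X i x y₀ B hs hslope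
      (by positivity) hX hB hslices
    rw [integral_add_indicator_comp_mul hη hb₀ hb₁ hf₀.continuous hf₁.continuous hB]
    calc _ ≤ C * (ε ^ (α + 1) + 0) + C * (ε ^ (α + 1) + A * ε ^ (α + 1)) :=
          norm_add_le_of_le hsmooth hjump
      _ = (C * (2 + A) + 0 + 0) * ε ^ (α + 1) := by ring
      _ ≤ _ := by gcongr <;> positivity
  · calc _ ≤ I := norm_integral_add_indicator_mul_le hη.integrable hb₀ hb₁ _
      _ = (0 + I / ε₀ ^ (α + 1) + 0) * ε₀ ^ (α + 1) := by field_simp; ring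
      _ ≤ _ := by gcongr <;> positivity

end Rescaling

/-! ### The change of variables -/

lemma integral_comp_add_linearMap_sub {E F : Type*} [NormedAddCommGroup E] [NormedSpace ℝ E]
    [FiniteDimensional ℝ E] [MeasurableSpace E] [BorelSpace E] [NormedAddCommGroup F]
    [NormedSpace ℝ F] (μ : Measure E) [μ.IsAddHaarMeasure] {X : E →ₗ[ℝ] E}
    (hX : LinearMap.det X ≠ 0) (f : E → F) (x y₀ : E) :
    ∫ y, f (x + X (y - y₀)) ∂μ = |(LinearMap.det X)⁻¹| • ∫ y, f y ∂μ := by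
  have hemb : MeasurableEmbedding X :=
    (LinearMap.equivOfDetNeZero X hX).toContinuousLinearEquiv.toHomeomorph.measurableEmbedding
  rw [integral_sub_right_eq_self (fun y => f (x + X y)) y₀,
    ← hemb.integral_map fun z => f (x + z),
    Measure.map_linearMap_addHaar_eq_smul_addHaar μ hX, integral_smul_measure,
    ENNReal.toReal_ofReal (abs_nonneg _), integral_add_left_eq_self]

section Shearlets

variable (α : ℝ) (j : ℕ) (k : Fin 2 → ℤ)

/-- The scale `2 ^ (-j / 2)` of the shearlets of index `j` along the last two axes. -/
noncomputable def dyadicScale : ℝ := 2 ^ (-((j : ℝ) / 2))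

/-- The map `S_k A_{2^j}`, as a linear map. -/
noncomputable def shearletMap : E3 →ₗ[ℝ] E3 :=
  Matrix.toEuclideanLin (shearMatrix k * scalingMatrix α j)

/-- The inverse of `shearletMap`. -/
noncomputable def shearletInv : E3 →ₗ[ℝ] E3 :=
  Matrix.toEuclideanLin !![dyadicScale j ^ α, -(dyadicScale j ^ α * k 0),
    -(dyadicScale j ^ α * k 1); 0, dyadicScale j, 0; 0, 0, dyadicScale j]

lemma dyadicScale_pos : 0 < dyadicScale j := by
  unfold dyadicScale
  positivity

lemma dyadicScale_le_one : dyadicScale j ≤ 1 :=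
  Real.rpow_le_one_of_one_le_of_nonpos one_le_two (neg_nonpos.2 (by positivity))

lemma dyadicScale_rpow (a : ℝ) : dyadicScale j ^ a = 2 ^ (-((j : ℝ) / 2) * a) :=
  (Real.rpow_mul zero_le_two _ _).symm

lemma two_rpow_mul_dyadicScale_rpow :
    (2 : ℝ) ^ ((j : ℝ) * (α - 1) / 2) * dyadicScale j ^ (α - 1) = 1 := by
  rw [dyadicScale_rpow, ← Real.rpow_add two_pos,
    show (j : ℝ) * (α - 1) / 2 + -((j : ℝ) / 2) * (α - 1) = 0 by ring, Real.rpow_zero]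

lemma scalingMatrix_eq :
    scalingMatrix α j =
      Matrix.diagonal ![(dyadicScale j ^ α)⁻¹, (dyadicScale j)⁻¹, (dyadicScale j)⁻¹] := by
  rw [scalingMatrix, dyadicScale_rpow, dyadicScale, ← Real.rpow_neg zero_le_two,
    ← Real.rpow_neg zero_le_two]
  ring_nf

lemma shearletMap_shearletInv (y : E3) : shearletMap α j k (shearletInv α j k y) = y := by
  have hD := (dyadicScale_pos j).ne'
  have hDα := (Real.rpow_pos_of_pos (dyadicScale_pos j) α).ne'
  ext l
  fin_cases l <;>
    simp [shearletMap, shearletInv, shearMatrix, scalingMatrix_eq, Matrix.mulVec, dotProduct,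
      Fin.sum_univ_three, Matrix.vecMul_diagonal] <;>
    field_simp
  ring

lemma det_shearletInv : LinearMap.det (shearletInv α j k) = dyadicScale j ^ (α + 2) := by
  rw [shearletInv, Matrix.toEuclideanLin, Matrix.toLpLin_eq_toLin, LinearMap.det_toLin,
    Matrix.det_fin_three, Real.rpow_add (dyadicScale_pos j), Real.rpow_two]
  simp [sq, mul_assoc]

variable {α j k}

lemma isShearScaling_shearletInv (hk : ∀ i, |k i * dyadicScale j ^ (α - 1)| ≤ 2) :
    IsShearScaling α (dyadicScale j) (fun i => k i * dyadicScale j ^ (α - 1))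
      (shearletInv α j k) := by
  have hD := (dyadicScale_pos j).ne'
  refine ⟨?_, fun i => ?_, hk⟩
  · ext l
    fin_cases l <;> simp [shearletInv, Matrix.mulVec, dotProduct, Fin.sum_univ_three]
  · rw [Real.rpow_sub_one hD]
    ext l
    fin_cases i <;> fin_cases l <;>
      simp [shearletInv, Matrix.mulVec, dotProduct, Fin.sum_univ_three] <;> field_simp

lemma shearlet_eq (ψ : E3 → ℂ) (m x : E3) :
    shearlet α ψ j k m x =
      ((dyadicScale j ^ (-(α / 2 + 1)) : ℝ) : ℂ) * ψ (shearletMap α j k x - m) := by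
  rw [dyadicScale_rpow,
    show -((j : ℝ) / 2) * -(α / 2 + 1) = (j : ℝ) * (α + 2) / 4 by ring]
  rfl

lemma sub_mem_tsupport_of_mem_tsupport_shearlet {ψ : E3 → ℂ} {m x : E3}
    (hx : x ∈ tsupport (shearlet α ψ j k m)) : shearletMap α j k x - m ∈ tsupport ψ := by
  have hcont : Continuous fun x => shearletMap α j k x - m :=
    (shearletMap α j k).continuous_of_finiteDimensional.sub continuous_const
  refine tsupport_comp_subset_preimage ψ hcont (tsupport_mul_subset_right
    (f := fun _ => ((dyadicScale j ^ (-(α / 2 + 1)) : ℝ) : ℂ)) ?_)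
  simpa only [← shearlet_eq, Function.comp_apply] using hx

lemma norm_coeff_shearlet_eq {ψ η : E3 → ℂ} (hη : (fun x => conj (ψ x)) =ᵐ[volume] η)
    (f : E3 → ℂ) (m x : E3) :
    ‖coeff f (shearlet α ψ j k m)‖ = dyadicScale j ^ (α / 2 + 1) *
      ‖∫ y, f (x + shearletInv α j k (y - (shearletMap α j k x - m))) * η y‖ := by
  have hD := dyadicScale_pos j
  have hdet : LinearMap.det (shearletInv α j k) ≠ 0 := by
    rw [det_shearletInv]
    positivity
  set y₀ := shearletMap α j k x - m with hy₀
  have hshearlet : ∀ y, shearlet α ψ j k m (x + shearletInv α j k (y - y₀)) =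
      ((dyadicScale j ^ (-(α / 2 + 1)) : ℝ) : ℂ) * ψ y := fun y => by
    rw [shearlet_eq, map_add, shearletMap_shearletInv, hy₀]
    congr 2
    abel
  have hcoeff : ∫ y, f (x + shearletInv α j k (y - y₀)) * η y =
      ((dyadicScale j ^ (α / 2 + 1) : ℝ) : ℂ) * ∫ y, f (x + shearletInv α j k (y - y₀)) *
        conj (shearlet α ψ j k m (x + shearletInv α j k (y - y₀))) := by
    rw [← integral_const_mul]
    refine integral_congr_ae ?_
    filter_upwards [hη] with y hy
    have hcancel : ((dyadicScale j ^ (α / 2 + 1) : ℝ) : ℂ) ≠ 0 := by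
      exact_mod_cast (Real.rpow_pos_of_pos hD _).ne'
    rw [hshearlet, ← hy, map_mul, Complex.conj_ofReal, Real.rpow_neg hD.le, Complex.ofReal_inv,
      mul_left_comm (f _), mul_inv_cancel_left₀ hcancel]
  have hfactor : dyadicScale j ^ (α / 2 + 1) *
      (dyadicScale j ^ (α / 2 + 1) * |(dyadicScale j ^ (α + 2))⁻¹|) = 1 := by
    rw [abs_of_pos (by positivity), ← mul_assoc, ← Real.rpow_add hD,
      show α / 2 + 1 + (α / 2 + 1) = α + 2 by ring, mul_inv_cancel₀ (by positivity)]
  rw [hcoeff, integral_comp_add_linearMap_sub volume hdet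
    (fun z => f z * conj (shearlet α ψ j k m z)) x y₀, ← coeff, det_shearletInv, norm_mul,
    norm_smul, Complex.norm_real, Real.norm_of_nonneg (by positivity), norm_abs_eq_norm,
    Real.norm_eq_abs, ← mul_assoc, ← mul_assoc, mul_assoc (_ ^ _), hfactor, one_mul]

lemma abs_mul_dyadicScale_rpow_le
    (hk : ∀ i, |k i| ≤ ⌈(2 : ℝ) ^ ((j : ℝ) * (α - 1) / 2)⌉) (i : Fin 2) :
    |k i * dyadicScale j ^ (α - 1)| ≤ 1 + dyadicScale j ^ (α - 1) := by
  have hceil : |(k i : ℝ)| ≤ 2 ^ ((j : ℝ) * (α - 1) / 2) + 1 := by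
    have : ((|k i| : ℤ) : ℝ) ≤ ⌈(2 : ℝ) ^ ((j : ℝ) * (α - 1) / 2)⌉ := by exact_mod_cast hk i
    rw [Int.cast_abs] at this
    exact this.trans (Int.ceil_lt_add_one _).le
  have hinv := two_rpow_mul_dyadicScale_rpow α j
  have hpos := Real.rpow_pos_of_pos (dyadicScale_pos j) (α - 1)
  rw [abs_mul, abs_of_pos hpos]
  nlinarith

end Shearlets

/-! ### The position of the tangent plane -/

section TangentPlane

variable {α D c n₀ : ℝ} {κ s : Fin 2 → ℝ} {X : E3 →ₗ[ℝ] E3} {L : E3 →L[ℝ] ℝ}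

lemma IsShearScaling.inner_succ_axis (hX : IsShearScaling α D κ X) (i : Fin 2) :
    inner ℝ (X (EuclideanSpace.single i.succ 1)) (!₂[n₀, s 0, s 1] : E3) =
      D * (s i - κ i * n₀) := by
  rw [hX.map_succ_axis, inner_smul_left, inner_sub_left, inner_smul_left]
  fin_cases i <;> simp [EuclideanSpace.inner_single_left]

lemma norm_vec_three_le {a₀ b : ℝ} {s : Fin 2 → ℝ} (hb : 0 ≤ b)
    (h : a₀ ^ 2 + s 0 ^ 2 + s 1 ^ 2 ≤ b ^ 2) : ‖(!₂[a₀, s 0, s 1] : E3)‖ ≤ b := by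
  refine (abs_le_of_sq_le_sq' ?_ hb).2
  rw [norm_sq_eq_sum_three]
  simpa using h

lemma one_le_abs_mul_norm {E : Type*} [NormedAddCommGroup E] [InnerProductSpace ℝ E]
    {L : E →L[ℝ] ℝ} (hL : 1 ≤ ‖L‖) {c : ℝ} {n : E} (h : ∀ y, L y = c * inner ℝ y n) :
    1 ≤ |c| * ‖n‖ := by
  refine hL.trans (L.opNorm_le_bound (by positivity) fun y => ?_)
  rw [h, norm_mul, Real.norm_eq_abs, mul_assoc, mul_comm ‖n‖]
  gcongr
  exact norm_inner_le_norm y n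

/-- The axis is the one along which the normal vector is longest. -/
lemma exists_le_abs_apply_succ_axis (hL : 1 ≤ ‖L‖)
    (h : ∀ y, L y = c * inner ℝ y (!₂[n₀, s 0, s 1] : E3)) (hn : ∃ i, 3 / 2 * |n₀| ≤ |s i|)
    (hD : 0 < D) (hX : IsShearScaling α D κ X) :
    ∃ i : Fin 2, |κ i| ≤ 25 / 24 → D / 12 ≤ |L (X (EuclideanSpace.single i.succ 1))| := by
  obtain ⟨i, hi, hmax⟩ : ∃ i, 3 / 2 * |n₀| ≤ |s i| ∧ ∀ l, |s l| ≤ |s i| := by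
    obtain ⟨i, hi⟩ := hn
    obtain ⟨l, hl⟩ := Finite.exists_max fun l => |s l|
    exact ⟨l, hi.trans (hl i), hl⟩
  have hnorm : ‖(!₂[n₀, s 0, s 1] : E3)‖ ≤ 2 * |s i| := by
    refine norm_vec_three_le (by positivity) ?_
    rw [mul_pow, ← sq_abs n₀, ← sq_abs (s 0), ← sq_abs (s 1)]
    have hs := fun l => pow_le_pow_left₀ (abs_nonneg _) (hmax l) 2
    have hn₀ := pow_le_pow_left₀ (by positivity) hi 2
    nlinarith [hs 0, hs 1, sq_nonneg |n₀|]
  have hcs : 1 ≤ |c| * (2 * |s i|) := (one_le_abs_mul_norm hL h).trans (by gcongr)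
  refine ⟨i, fun hκ => ?_⟩
  have hslope : 11 / 36 * |s i| ≤ |s i - κ i * n₀| := by
    have hshear : |κ i * n₀| ≤ 25 / 24 * (2 / 3 * |s i|) := by
      rw [abs_mul]
      gcongr
      linarith
    linarith [abs_sub_abs_le_abs_sub (s i) (κ i * n₀)]
  rw [h, hX.inner_succ_axis, abs_mul, abs_mul, abs_of_pos hD]
  calc D / 12 ≤ (|c| * (2 * |s i|)) * (11 / 72) * D := by
        rw [div_eq_inv_mul]
        gcongr
        linarith
    _ = |c| * (D * (11 / 36 * |s i|)) := by ring
    _ ≤ _ := by gcongr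

lemma mul_abs_add_le_abs_apply_succ_axis (hL : 1 ≤ ‖L‖)
    (h : ∀ y, L y = c * inner ℝ y (!₂[-1, s 0, s 1] : E3)) (hs : ∀ i, |s i| ≤ 3)
    (hD : 0 < D) (hX : IsShearScaling α D κ X) (i : Fin 2) :
    D * |κ i + s i| / 12 ≤ |L (X (EuclideanSpace.single i.succ 1))| := by
  have hnorm : ‖(!₂[-1, s 0, s 1] : E3)‖ ≤ 5 := by
    have hsq := fun i => sq_le_sq' (abs_le.1 (hs i)).1 (abs_le.1 (hs i)).2
    exact norm_vec_three_le (by norm_num) (by linarith [hsq 0, hsq 1])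
  have hc : 1 ≤ |c| * 5 := (one_le_abs_mul_norm hL h).trans (by gcongr)
  rw [h, hX.inner_succ_axis, mul_neg_one, sub_neg_eq_add, add_comm (s i), abs_mul, abs_mul,
    abs_of_pos hD, div_eq_inv_mul]
  gcongr
  linarith

end TangentPlane

/-! ### Shearlet coefficients of cartoon-like images -/

section Coefficients

variable {α β ν μ r K : ℝ} {ψ : E3 → ℂ} {j : ℕ}

lemma isScale_dyadicScale {ε : ℝ} (hε : 0 < ε) (hε1 : ε ≤ 1)
    (h : dyadicScale j ^ (α - 1) ≤ 5 * ε) : IsScale α (dyadicScale j) ε :=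
  ⟨dyadicScale_pos j, dyadicScale_le_one j, hε, hε1, h⟩

/-- Here `L` is the derivative at `x` of a function defining `B`. -/
lemma exists_norm_coeff_le (hα : 1 < α) (hαβ : α ≤ β) (hβ : β ≤ 2) (hν : 0 ≤ ν) (hμ : 0 ≤ μ)
    (hr : 0 < r) (hψ : Integrable ψ) (hψsupp : HasCompactSupport ψ)
    (hdecay : HasFourierDecay K (𝓕 ψ)) :
    ∃ C : ℝ, 0 < C ∧ ∀ (B : Set E3) (f : E3 → ℂ), IsCartoon α β ν μ r B f →
      ∀ x ∈ frontier B, ∃ L : E3 →L[ℝ] ℝ, 1 ≤ ‖L‖ ∧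
        (∀ n, IsTangentPlaneNormal (frontier B) x n → ∃ c : ℝ, ∀ h, L h = c * inner ℝ h n) ∧
        ∀ (j : ℕ) (k : Fin 2 → ℤ) (m : E3) (κ : Fin 2 → ℝ) (ε : ℝ) (i : Fin 2),
          IsShearScaling α (dyadicScale j) κ (shearletInv α j k) →
          x ∈ tsupport (shearlet α ψ j k m) → IsScale α (dyadicScale j) ε →
          (ε ≤ 1 / 24 → dyadicScale j ^ α / (12 * ε) ≤
            |L (shearletInv α j k (EuclideanSpace.single i.succ 1))|) →
          ‖coeff f (shearlet α ψ j k m)‖ ≤ C * (dyadicScale j ^ (α / 2 + 1) * ε ^ (α + 1)) := by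
  obtain ⟨R, N, η, hη, hsupp, hae⟩ := exists_isGenerator_conj_ae_eq hψ hψsupp hdecay
  obtain ⟨M, hM, hstar⟩ := exists_isDefiningFunction hα (hαβ.trans hβ) hν hr
  obtain ⟨C, hC, hbound⟩ := exists_norm_rescaled_integral_le hα (hαβ.trans hβ) hαβ hη hM hμ
    (M' := (3 : ℕ) * ((3 : ℕ) * μ)) (by positivity) (half_pos hr)
  refine ⟨C, hC, ?_⟩
  rintro B f ⟨hB, f₀, f₁, rfl, -, ⟨hd₀, hn₀⟩, ⟨hd₁, hn₁⟩⟩ x hx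
  obtain ⟨hclosed, hdefining⟩ := hstar B hB
  obtain ⟨φ, hφ⟩ := hdefining x hx
  refine ⟨fderiv ℝ φ x, hφ.one_le_norm, hφ.normal, fun j k m κ ε i hX hxs hs hlow => ?_⟩
  have hβ1 := hα.trans_le hαβ
  rw [norm_coeff_shearlet_eq hae _ m x, mul_left_comm]
  have := dyadicScale_pos j
  gcongr
  exact hbound f₀ f₁ (norm_le_of_holderNorm_le hμ hn₀) (norm_le_of_holderNorm_le hμ hn₁)
    (gradHolderOn_univ_of_holderNorm_le hβ1 hβ hμ hd₀ hn₀)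
    (gradHolderOn_univ_of_holderNorm_le hβ1 hβ hμ hd₁ hn₁) B x φ hclosed.measurableSet hφ
    _ ε κ _ i _ hs hX (hsupp _ (sub_mem_tsupport_of_mem_tsupport_shearlet hxs)) hlow

lemma isScale_min_inv (hα : 1 < α) {d : ℝ} (hd : 0 < d)
    (h : dyadicScale j ^ (α - 1) * d ≤ 5) : IsScale α (dyadicScale j) (min 1 d⁻¹) := by
  refine isScale_dyadicScale (by positivity) (min_le_left _ _) ?_
  rw [mul_min_of_nonneg _ _ (by norm_num), ← div_eq_mul_inv]
  refine le_min ?_ ((le_div_iff₀ hd).2 h)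
  linarith [Real.rpow_le_one (dyadicScale_pos j).le (dyadicScale_le_one j) (sub_pos.2 hα).le]

lemma abs_mul_dyadicScale_rpow_add (t u : ℝ) :
    |t * dyadicScale j ^ (α - 1) + u| =
      dyadicScale j ^ (α - 1) * |t + 2 ^ ((j : ℝ) * (α - 1) / 2) * u| := by
  have hpos := Real.rpow_pos_of_pos (dyadicScale_pos j) (α - 1)
  rw [← abs_of_pos hpos, ← abs_mul, abs_of_pos hpos]
  congr 1
  linear_combination (-u) * two_rpow_mul_dyadicScale_rpow α j

lemma dyadicScale_rpow_div_min_inv {d : ℝ} (h : min 1 d⁻¹ < 1) :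
    dyadicScale j ^ α / (12 * min 1 d⁻¹) =
      dyadicScale j * (dyadicScale j ^ (α - 1) * d) / 12 := by
  rw [min_eq_right_of_lt (by simpa using h), Real.rpow_sub_one (dyadicScale_pos j).ne']
  field_simp [(dyadicScale_pos j).ne']

lemma dyadicScale_rpow_div :
    dyadicScale j ^ α / (12 * dyadicScale j ^ (α - 1)) = dyadicScale j / 12 := by
  have hD := dyadicScale_pos j
  rw [Real.rpow_sub_one hD.ne']
  field_simp

lemma two_rpow_eq_dyadicScale_rpow :
    (2 : ℝ) ^ (-(j : ℝ) * (α / 4 + 1 / 2)) = dyadicScale j ^ (α / 2 + 1) := by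
  rw [dyadicScale_rpow]
  ring_nf

lemma two_rpow_eq_dyadicScale_rpow_mul :
    (2 : ℝ) ^ (-(j : ℝ) * (α / 2 + 1 / 4) * α) =
      dyadicScale j ^ (α / 2 + 1) * (dyadicScale j ^ (α - 1)) ^ (α + 1) := by
  rw [← Real.rpow_mul (dyadicScale_pos j).le, ← Real.rpow_add (dyadicScale_pos j),
    dyadicScale_rpow]
  ring_nf

theorem mainTheorem10_general (hα : 1 < α) (hαβ : α ≤ β) (hβ : β ≤ 2) (hν : 0 ≤ ν) (hμ : 0 ≤ μ)
    (hr : 0 < r) (hψ : Integrable ψ) (hψsupp : HasCompactSupport ψ)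
    (hdecay : HasFourierDecay K (𝓕 ψ)) :
    ∃ C : ℝ, 0 < C ∧ ∀ (B : Set E3) (f : E3 → ℂ), IsCartoon α β ν μ r B f →
      ∀ (j : ℕ) (k : Fin 2 → ℤ) (m : E3),
        (∀ i, |k i| ≤ ⌈(2 : ℝ) ^ ((j : ℝ) * (α - 1) / 2)⌉) →
      ∀ x ∈ tsupport (shearlet α ψ j k m) ∩ frontier B,
        (∀ s : Fin 2 → ℝ, IsTangentPlaneNormal (frontier B) x !₂[-1, s 0, s 1] →
          (∀ i, |s i| ≤ 3) →
          ∀ i, (k i : ℝ) + (2 : ℝ) ^ ((j : ℝ) * (α - 1) / 2) * s i ≠ 0 →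
            ‖coeff f (shearlet α ψ j k m)‖ ≤ C * ((2 : ℝ) ^ (-(j : ℝ) * (α / 4 + 1 / 2)) /
              |(k i : ℝ) + (2 : ℝ) ^ ((j : ℝ) * (α - 1) / 2) * s i| ^ (α + 1))) ∧
        (∀ (n₀ : ℝ) (s : Fin 2 → ℝ),
          IsTangentPlaneNormal (frontier B) x !₂[n₀, s 0, s 1] → (∃ i, 3 / 2 * |n₀| ≤ |s i|) →
            ‖coeff f (shearlet α ψ j k m)‖ ≤
              C * (2 : ℝ) ^ (-(j : ℝ) * (α / 2 + 1 / 4) * α)) := by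
  obtain ⟨C, hC, hbound⟩ := exists_norm_coeff_le hα hαβ hβ hν hμ hr hψ hψsupp hdecay
  refine ⟨C, hC, fun B f hf j k m hk x ⟨hxψ, hxB⟩ => ?_⟩
  obtain ⟨L, hL, hnormal, hcoeff⟩ := hbound B f hf x hxB
  have hD := dyadicScale_pos j
  have hD1 := Real.rpow_le_one hD.le (dyadicScale_le_one j) (sub_pos.2 hα).le
  have hκ := abs_mul_dyadicScale_rpow_le hk
  have hX := isShearScaling_shearletInv fun i => (hκ i).trans (by linarith)
  refine ⟨fun s hs hs3 i hne => ?_, fun n₀ s hs hsteep => ?_⟩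
  · obtain ⟨c, hc⟩ := hnormal _ hs
    have hle : |k i * dyadicScale j ^ (α - 1) + s i| ≤ 5 := by
      linarith [abs_add_le (k i * dyadicScale j ^ (α - 1)) (s i), hX.abs_le i, hs3 i]
    have hlow := mul_abs_add_le_abs_apply_succ_axis hL hc hs3 hD hX i
    rw [abs_mul_dyadicScale_rpow_add] at hle hlow
    refine (hcoeff j k m _ _ i hX hxψ (isScale_min_inv hα (abs_pos.2 hne) hle) fun hε => ?_).trans
      ?_
    · rwa [dyadicScale_rpow_div_min_inv (by linarith)]
    · rw [two_rpow_eq_dyadicScale_rpow, div_eq_mul_inv (_ ^ _), ← Real.inv_rpow (abs_nonneg _)]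
      gcongr
      exact min_le_right _ _
  · obtain ⟨c, hc⟩ := hnormal _ hs
    have hscale : IsScale α (dyadicScale j) (dyadicScale j ^ (α - 1)) :=
      isScale_dyadicScale (by positivity) hD1 (by linarith [Real.rpow_pos_of_pos hD (α - 1)])
    obtain ⟨i, hlow⟩ := exists_le_abs_apply_succ_axis hL hc hsteep hD hX
    rw [two_rpow_eq_dyadicScale_rpow_mul]
    refine hcoeff j k m _ _ i hX hxψ hscale fun hε => ?_
    rw [dyadicScale_rpow_div]
    exact hlow ((hκ i).trans (by linarith))

end Coefficients

theorem mainTheorem10 (α β ν μ r c₁ c₂ : ℝ)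
    (hα : 1 < α) (hαβ : α ≤ β) (hβ : β ≤ 2) (hν : 0 < ν) (hμ : 0 < μ) (hr : 0 < r)
    (hc₁ : 0 < c₁) (hc₂ : 0 < c₂)
    (ψ : E3 → ℂ) (hψL2 : MemLp ψ 2 volume) (hψsupp : HasCompactSupport ψ)
    (hψ : DecayConditions ψ) :
    ∃ C : ℝ, 0 < C ∧
      ∀ (B : Set E3) (f : E3 → ℂ), IsCartoon α β ν μ r B f →
      ∀ (j : ℕ) (p : Fin 3 → ℤ) (k : Fin 2 → ℤ) (z : Fin 3 → ℤ),
        (∀ i, |k i| ≤ ⌈(2 : ℝ) ^ ((j : ℝ) * (α - 1) / 2)⌉) →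
      ∀ x : E3,
        x ∈ interior (dyadicCube j p) ∩
          interior (tsupport (shearlet α ψ j k (latticePoint c₁ c₂ z))) ∩ frontier B →
        (∀ s : Fin 2 → ℝ, IsTangentPlaneNormal (frontier B) x !₂[-1, s 0, s 1] →
          (∀ i, |s i| ≤ 3) →
          ∀ i, (k i : ℝ) + (2 : ℝ) ^ ((j : ℝ) * (α - 1) / 2) * s i ≠ 0 →
            ‖coeff f (shearlet α ψ j k (latticePoint c₁ c₂ z))‖ ≤
              C * ((2 : ℝ) ^ (-(j : ℝ) * (α / 4 + 1 / 2)) /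
                |(k i : ℝ) + (2 : ℝ) ^ ((j : ℝ) * (α - 1) / 2) * s i| ^ (α + 1))) ∧
        (∀ s : Fin 2 → ℝ, IsTangentPlaneNormal (frontier B) x !₂[-1, s 0, s 1] →
          (∃ i, 3 / 2 ≤ |s i|) →
            ‖coeff f (shearlet α ψ j k (latticePoint c₁ c₂ z))‖ ≤
              C * (2 : ℝ) ^ (-(j : ℝ) * (α / 2 + 1 / 4) * α)) ∧
        (∀ s : Fin 2 → ℝ, IsTangentPlaneNormal (frontier B) x !₂[0, s 0, s 1] →
            ‖coeff f (shearlet α ψ j k (latticePoint c₁ c₂ z))‖ ≤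
              C * (2 : ℝ) ^ (-(j : ℝ) * (α / 2 + 1 / 4) * α)) := by
  obtain ⟨K, hdecay⟩ := hψ.exists_hasFourierDecay
  obtain ⟨C, hC, hbound⟩ := mainTheorem10_general hα hαβ hβ hν.le hμ.le hr
    (integrable_of_memLp_two_of_hasCompactSupport hψL2 hψsupp) hψsupp hdecay
  refine ⟨C, hC, fun B f hf j p k z hk x hx => ?_⟩
  obtain ⟨hflat, hsteep⟩ := hbound B f hf j k _ hk x ⟨interior_subset hx.1.2, hx.2⟩
  exact ⟨hflat, fun s hs hs' => hsteep (-1) s hs (by simpa using hs'),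
    fun s hs => hsteep 0 s hs ⟨0, by simp⟩⟩
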